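/- Work over $\mathbb{C}$. Fix $d\ge 2$ and let $\mathbb{C}\langle\!\langle z_1,\dots,z_{d-2},x,y\rangle\!\rangle$ be the algebra of formal power series in $d$ noncommuting variables. For a potential $f$ in it, let $\mathrm{Jac}(f)$ be the quotient by the closure (in the topology given by powers of the ideal $\mathfrak{n}$ of series without constant term) of the two-sided ideal generated by all cyclic derivatives $\delta_v f$, where $v$ runs over the variables and $\delta_v$ is the continuous linear map sending a monomial $w$ to the sum, over all cyclic rotations of $w$ that begin with $v$, of the rotation with this first letter removed. Consider the following potentials $f$ and elements $s$ (a term with exponent involving $\infty$ is omitted): * Type $A$: $f=z_1^2+\dots+z_{d-2}^2+x^2+y^n$, with $n\in\mathbb{N}_{\ge2}\cup\{\infty\}$, and $s=y$. * Type $D$: $f=z_1^2+\dots+z_{d-2}^2+xy^2+x^{2n}+x^{2m-1}$, with $n,m\in\mathbb{N}_{\ge2}\cup\{\infty\}$, and $s=x^2$. * Type $E$: $f=z_1^2+\dots+z_{d-2}^2+x^3+xy^3+y^n$, with $n\in\mathbb{N}_{\ge4}\cup\{\infty\}$, and $s=g_{6,n}$, where $$g_{6,n}=\begin{cases} x^2+xyx+yx^2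 & \text{if } n=3t+1 \text{ or } n=\infty,\\ x^2+xyx+yx^2+(-1)^t3^t(3t+2)x^{2t+1} & \text{if } n=3t+2,\\ x^2+xyx+yx^2+(-1)^{t+1}3^t\,t\,(xyx^{2t-2}+yx^{2t-1}) & \text{if } n=3t.\end{cases}$$ For $Q$ one of the Dynkin diagrams $A_1$, $D_4$, $E_6$, let $\Pi$ be the preprojective algebra of $Q$ and $e\in\Pi$ the idempotent of the following vertex: the only vertex of $A_1$, respectively the trivalent vertex of $D_4$ or $E_6$. Then the following hold. 1. In each case $s$ is central in $\mathrm{Jac}(f)$, and $\mathrm{Jac}(f)/(s)\cong e\Pi e$ as $\mathbb{C}$-algebras, where $\Pi$ is the preprojective algebra of $A_1$ in Type $A$, of $D_4$ in Type $D$, and of $E_6$ in Type $E$. 2. In Types $A$ and $D$, let $\mathcal{Z}$ be the centre of $\mathrm{Jac}(f)$ and $\mathfrak{m}_{\mathcal{Z}}$ its Jacobson radical. Then $\mathfrak{m}_{\mathcal{Z}}/\mathfrak{m}_{\mathcal{Z}}^2$ is finite-dimensional, and for every finite-dimensional subspace $V\subset\mathfrak{m}_{\mathcal{Z}}$ that maps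 onto $\mathfrak{m}_{\mathcal{Z}}/\mathfrak{m}_{\mathcal{Z}}^2$ there is a nonempty Zariski open subset $U\subset V$ such that $\mathrm{Jac}(f)/(u)\cong e\Pi e$ as $\mathbb{C}$-algebras for all $u\in U$, where $\Pi$ is the preprojective algebra of $A_1$ in Type $A$ and of $D_4$ in Type $D$. -/

import Mathlib

/-! ### Noncommutative formal power series over `ℂ` -/

/-- `ℂ⟪σ⟫`: formal power series in the noncommuting variables `σ`, a series being the family of
its coefficients on words. -/
def NCSeries (σ : Type) : Type := List σ → ℂ

namespace NCSeries

variable {σ : Type}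

instance : AddCommGroup (NCSeries σ) := inferInstanceAs (AddCommGroup (List σ → ℂ))

instance : Module ℂ (NCSeries σ) := inferInstanceAs (Module ℂ (List σ → ℂ))

@[ext] theorem ext {f g : NCSeries σ} (h : ∀ w, f w = g w) : f = g := funext h

@[simp] theorem add_coeff (f g : NCSeries σ) (w : List σ) : (f + g) w = f w + g w := rfl

@[simp] theorem zero_coeff (w : List σ) : (0 : NCSeries σ) w = 0 := rfl

@[simp] theorem neg_coeff (f : NCSeries σ) (w : List σ) : (-f) w = -f w := rfl

@[simp] theorem sub_coeff (f g : NCSeries σ) (w : List σ) : (f - g) w = f w - g w := rfl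

@[simp] theorem smul_coeff (c : ℂ) (f : NCSeries σ) (w : List σ) : (c • f) w = c * f w := rfl

open Classical in
/-- The monomial with word `w` and coefficient `1`. -/
noncomputable def monomial (w : List σ) : NCSeries σ := fun v => if v = w then 1 else 0

/-- The variable `i`. -/
noncomputable def X (i : σ) : NCSeries σ := monomial [i]

noncomputable instance : One (NCSeries σ) := ⟨monomial []⟩

/-- The concatenation product: sum over all ways of cutting a word into two pieces. -/
noncomputable instance : Mul (NCSeries σ) :=
  ⟨fun f g w => ∑ i ∈ Finset.range (w.length + 1), f (w.take i) * g (w.drop i)⟩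

theorem one_coeff [DecidableEq (List σ)] (w : List σ) :
    (1 : NCSeries σ) w = if w = [] then 1 else 0 := by
  change monomial [] w = _
  unfold monomial
  congr

theorem mul_coeff (f g : NCSeries σ) (w : List σ) :
    (f * g) w = ∑ i ∈ Finset.range (w.length + 1), f (w.take i) * g (w.drop i) := rfl

/-- `∂ᵢ`: strike off the leftmost letter `i` of each monomial beginning with `i`, and kill all
other monomials. -/
def strike (i : σ) (f : NCSeries σ) : NCSeries σ := fun w => f (i :: w)

theorem mul_nil (f g : NCSeries σ) : (f * g) [] = f [] * g [] := by
  simp [mul_coeff]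

theorem mul_cons (f g : NCSeries σ) (a : σ) (w : List σ) :
    (f * g) (a :: w) = f [] * g (a :: w) + (strike a f * g) w := by
  rw [mul_coeff, mul_coeff, List.length_cons, Finset.sum_range_succ']
  simp [strike, add_comm]

theorem strike_mul (f g : NCSeries σ) (a : σ) :
    strike a (f * g) = f [] • strike a g + strike a f * g := by
  ext w
  exact mul_cons f g a w

theorem add_mul' (f g h : NCSeries σ) : (f + g) * h = f * h + g * h := by
  ext w
  simp [mul_coeff, add_mul, Finset.sum_add_distrib]

theorem mul_add' (f g h : NCSeries σ) : f * (g + h) = f * g + f * h := by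
  ext w
  simp [mul_coeff, mul_add, Finset.sum_add_distrib]

theorem smul_mul' (c : ℂ) (f g : NCSeries σ) : (c • f) * g = c • (f * g) := by
  ext w
  simp [mul_coeff, Finset.mul_sum, mul_assoc]

theorem mul_smul' (c : ℂ) (f g : NCSeries σ) : f * (c • g) = c • (f * g) := by
  ext w
  simp only [mul_coeff, smul_coeff, Finset.mul_sum]
  exact Finset.sum_congr rfl fun i _ => by ring

theorem zero_mul' (f : NCSeries σ) : 0 * f = 0 := by
  ext w
  simp [mul_coeff]

theorem mul_zero' (f : NCSeries σ) : f * 0 = 0 := by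
  ext w
  simp [mul_coeff]

theorem one_nil : (1 : NCSeries σ) [] = 1 := by
  classical simp [one_coeff]

theorem strike_one (a : σ) : strike a (1 : NCSeries σ) = 0 := by
  classical
  ext w
  simp [strike, one_coeff]

theorem one_mul' (f : NCSeries σ) : 1 * f = f := by
  ext w
  cases w with
  | nil => rw [mul_nil, one_nil, one_mul]
  | cons a w => rw [mul_cons, one_nil, strike_one, zero_mul', one_mul, zero_coeff, add_zero]

theorem mul_one' (f : NCSeries σ) : f * 1 = f := by
  ext w
  induction w generalizing f with
  | nil => rw [mul_nil, one_nil, mul_one]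
  | cons a w ih =>
    classical
    rw [mul_cons, ih]
    simp [strike, one_coeff]

theorem mul_assoc' (f g h : NCSeries σ) : f * g * h = f * (g * h) := by
  ext w
  induction w generalizing f g h with
  | nil => simp only [mul_nil, mul_assoc]
  | cons a w ih =>
    rw [mul_cons, mul_cons, mul_cons, strike_mul, add_mul', add_coeff, ih, smul_mul', smul_coeff,
      mul_nil]
    ring

noncomputable instance : Ring (NCSeries σ) :=
  { (inferInstance : AddCommGroup (NCSeries σ)) with
    mul := (· * ·)
    one := 1
    left_distrib := mul_add'
    right_distrib := add_mul'
    zero_mul := zero_mul'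
    mul_zero := mul_zero'
    mul_assoc := mul_assoc'
    one_mul := one_mul'
    mul_one := mul_one' }

noncomputable instance : Algebra ℂ (NCSeries σ) := Algebra.ofModule smul_mul' mul_smul'

/-- Cyclic symmetrisation: a monomial `w` goes to the sum of its `w.length` rotations.  On
coefficients this is the sum over all rotations of the given word. -/
noncomputable def sym (f : NCSeries σ) : NCSeries σ :=
  fun w => ∑ j ∈ Finset.range w.length, f (w.rotate j)

/-- The cyclic derivative `δᵢ = ∂ᵢ ∘ sym`. -/
noncomputable def cyclicDeriv (i : σ) (f : NCSeries σ) : NCSeries σ := strike i (sym f)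

/-- `f` and `g` have the same coefficients in all degrees `< N`, i.e. `f - g ∈ 𝔫 ^ N` where `𝔫` is
the ideal of series without constant term (when `σ` is finite). -/
def AgreeBelow (N : ℕ) (f g : NCSeries σ) : Prop := ∀ w : List σ, w.length < N → f w = g w

theorem AgreeBelow.mul {N : ℕ} {f f' g g' : NCSeries σ} (hf : AgreeBelow N f f')
    (hg : AgreeBelow N g g') : AgreeBelow N (f * g) (f' * g') := by
  intro w hw
  rw [mul_coeff, mul_coeff]
  refine Finset.sum_congr rfl fun i _ => ?_
  rw [hf _ (by rw [List.length_take]; omega), hg _ (by rw [List.length_drop]; omega)]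

/-- The closure of a two-sided ideal in the `𝔫`-adic topology. -/
noncomputable def closure (I : TwoSidedIdeal (NCSeries σ)) : TwoSidedIdeal (NCSeries σ) :=
  TwoSidedIdeal.mk' {f | ∀ N, ∃ g ∈ I, AgreeBelow N f g}
    (fun _ => ⟨0, I.zero_mem, fun _ _ => rfl⟩)
    (fun {f f'} hf hf' N => by
      obtain ⟨g, hg, h⟩ := hf N
      obtain ⟨g', hg', h'⟩ := hf' N
      exact ⟨g + g', I.add_mem hg hg', fun w hw => by simp [h w hw, h' w hw]⟩)
    (fun {f} hf N => by
      obtain ⟨g, hg, h⟩ := hf N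
      exact ⟨-g, I.neg_mem hg, fun w hw => by simp [h w hw]⟩)
    (fun {a f} hf N => by
      obtain ⟨g, hg, h⟩ := hf N
      exact ⟨a * g, I.mul_mem_left _ _ hg, AgreeBelow.mul (fun _ _ => rfl) h⟩)
    (fun {f a} hf N => by
      obtain ⟨g, hg, h⟩ := hf N
      exact ⟨g * a, I.mul_mem_right _ _ hg, AgreeBelow.mul h (fun _ _ => rfl)⟩)

end NCSeries

/-! ### Jacobi algebras -/

/-- The quotient of a ring by a two-sided ideal. -/
abbrev TwoSidedQuot {A : Type} [Ring A] (I : TwoSidedIdeal A) : Type := I.ringCon.Quotient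

/-- `A / (s)`, the quotient by the two-sided ideal generated by one element. -/
abbrev QuotBy {A : Type} [Ring A] (s : A) : Type := TwoSidedQuot (TwoSidedIdeal.span {s})

section Jacobi

variable {σ : Type}

/-- The closed two-sided ideal `((δᵢ f ∣ i))`. -/
noncomputable def jacobiIdeal (f : NCSeries σ) : TwoSidedIdeal (NCSeries σ) :=
  NCSeries.closure (TwoSidedIdeal.span (Set.range fun i => NCSeries.cyclicDeriv i f))

/-- The Jacobi algebra of the potential `f`. -/
def Jac (f : NCSeries σ) : Type := TwoSidedQuot (jacobiIdeal f)

noncomputable instance (f : NCSeries σ) : Ring (Jac f) :=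
  inferInstanceAs (Ring (TwoSidedQuot (jacobiIdeal f)))

noncomputable instance (f : NCSeries σ) : Algebra ℂ (Jac f) :=
  inferInstanceAs (Algebra ℂ (TwoSidedQuot (jacobiIdeal f)))

/-- The class of a power series in the Jacobi algebra. -/
noncomputable def Jac.mk (f : NCSeries σ) (g : NCSeries σ) : Jac f := (jacobiIdeal f).ringCon.mk' g

/-- The centre `𝒵` of the Jacobi algebra. -/
noncomputable abbrev JacCentre (f : NCSeries σ) : Type := Subalgebra.center ℂ (Jac f)

/-- `𝔪_𝒵`, the Jacobson radical of the centre. -/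
noncomputable abbrev centreRadical (f : NCSeries σ) : Ideal (JacCentre f) := Ring.jacobson (JacCentre f)

end Jacobi

/-! ### Contracted preprojective algebras -/

/-- A finite quiver together with a marked vertex. -/
structure MarkedQuiver where
  Vertex : Type
  Arrow : Type
  [vertexFintype : Fintype Vertex]
  [vertexDecEq : DecidableEq Vertex]
  [arrowFintype : Fintype Arrow]
  source : Arrow → Vertex
  target : Arrow → Vertex
  marked : Vertex

attribute [instance] MarkedQuiver.vertexFintype MarkedQuiver.vertexDecEq MarkedQuiver.arrowFintype

namespace MarkedQuiver

/-- The generators of the path algebra of the double quiver: the trivial paths, the arrows, and a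
reversed arrow for each arrow. -/
inductive Gen (Q : MarkedQuiver)
  | vertex (v : Q.Vertex)
  | arrow (a : Q.Arrow)
  | dual (a : Q.Arrow)

open FreeAlgebra in
/-- The relations of the preprojective algebra: those of the path algebra of the double quiver
(paths composed like functions), and the preprojective relation `∑ (a a* - a* a) = 0`. -/
inductive Rel (Q : MarkedQuiver) : FreeAlgebra ℂ Q.Gen → FreeAlgebra ℂ Q.Gen → Prop
  | vertex_mul_self (v : Q.Vertex) :
      Rel Q (ι ℂ (.vertex v) * ι ℂ (.vertex v)) (ι ℂ (.vertex v))
  | vertex_mul_vertex (v w : Q.Vertex) (h : v ≠ w) :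
      Rel Q (ι ℂ (.vertex v) * ι ℂ (.vertex w)) 0
  | sum_vertex : Rel Q (∑ v, ι ℂ (.vertex v)) 1
  | arrow_mul_source (a : Q.Arrow) :
      Rel Q (ι ℂ (.arrow a) * ι ℂ (.vertex (Q.source a))) (ι ℂ (.arrow a))
  | target_mul_arrow (a : Q.Arrow) :
      Rel Q (ι ℂ (.vertex (Q.target a)) * ι ℂ (.arrow a)) (ι ℂ (.arrow a))
  | dual_mul_target (a : Q.Arrow) :
      Rel Q (ι ℂ (.dual a) * ι ℂ (.vertex (Q.target a))) (ι ℂ (.dual a))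
  | source_mul_dual (a : Q.Arrow) :
      Rel Q (ι ℂ (.vertex (Q.source a)) * ι ℂ (.dual a)) (ι ℂ (.dual a))
  | preprojective :
      Rel Q (∑ a, (ι ℂ (.arrow a) * ι ℂ (.dual a) - ι ℂ (.dual a) * ι ℂ (.arrow a))) 0

/-- The preprojective algebra `Π` of the underlying graph of the quiver. -/
abbrev Preprojective (Q : MarkedQuiver) : Type := RingQuot Q.Rel

/-- The idempotent `e` of the marked vertex. -/
noncomputable def idem (Q : MarkedQuiver) : Q.Preprojective :=
  RingQuot.mkAlgHom ℂ Q.Rel (FreeAlgebra.ι ℂ (.vertex Q.marked))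

theorem isIdempotentElem_idem (Q : MarkedQuiver) : IsIdempotentElem Q.idem := by
  unfold IsIdempotentElem idem
  rw [← map_mul]
  exact RingQuot.mkAlgHom_rel ℂ (Rel.vertex_mul_self Q.marked)

end MarkedQuiver

/-- The corner ring `e A e` of an algebra is an algebra. -/
instance cornerAlgebra {A : Type} [Ring A] [Algebra ℂ A] {e : A} (he : IsIdempotentElem e) :
    Algebra ℂ he.Corner where
  smul c a := ⟨c • a.1, c • a.1, by
    obtain ⟨h₁, h₂⟩ := (Subsemigroup.mem_corner_iff he).mp a.2
    simp only [mul_smul_comm, smul_mul_assoc, h₁, h₂]⟩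
  algebraMap :=
    { toFun := fun c => ⟨c • e, c • e, by simp [he.eq]⟩
      map_one' := Subtype.ext (one_smul ℂ e)
      map_mul' := fun c d => Subtype.ext <| by
        change (c * d) • e = (c • e) * (d • e)
        rw [smul_mul_smul_comm, he.eq]
      map_zero' := Subtype.ext (zero_smul ℂ e)
      map_add' := fun c d => Subtype.ext (add_smul c d e) }
  commutes' c a := Subtype.ext <| by
    obtain ⟨h₁, h₂⟩ := (Subsemigroup.mem_corner_iff he).mp a.2
    change (c • e) * a.1 = a.1 * (c • e)
    rw [smul_mul_assoc, mul_smul_comm, h₁, h₂]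
  smul_def' c a := Subtype.ext <| by
    obtain ⟨h₁, h₂⟩ := (Subsemigroup.mem_corner_iff he).mp a.2
    change c • a.1 = (c • e) * a.1
    rw [smul_mul_assoc, h₁]

namespace MarkedQuiver

/-- The contracted preprojective algebra `e Π e`. -/
abbrev Contracted (Q : MarkedQuiver) : Type := Q.isIdempotentElem_idem.Corner

/-- The Dynkin diagram `A₁` with its only vertex marked. -/
def A₁ : MarkedQuiver where
  Vertex := Fin 1
  Arrow := Fin 0
  source := Fin.elim0
  target := Fin.elim0
  marked := 0

/-- The Dynkin diagram `D₄` with its central vertex `0` marked: the edges are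
`1 - 0`, `2 - 0`, `3 - 0`. -/
def D₄ : MarkedQuiver where
  Vertex := Fin 4
  Arrow := Fin 3
  source := ![1, 2, 3]
  target := ![0, 0, 0]
  marked := 0

/-- The Dynkin diagram `E₆` with its trivalent vertex `0` marked: the edges are
`1 - 0`, `2 - 0`, `3 - 2`, `4 - 0`, `5 - 4`. -/
def E₆ : MarkedQuiver where
  Vertex := Fin 6
  Arrow := Fin 5
  source := ![1, 2, 3, 4, 5]
  target := ![0, 0, 2, 0, 4]
  marked := 0

end MarkedQuiver

/-! ### Generic central elements -/

/-- Zariski open subsets of a complex vector space `V`: complements of the common zero sets of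
families of polynomials in linear functionals on `V`. -/
def IsZariskiOpen {V : Type} [AddCommGroup V] [Module ℂ V] (U : Set V) : Prop :=
  ∃ S : Set (MvPolynomial (Module.Dual ℂ V) ℂ),
    U = {v | ∃ p ∈ S, MvPolynomial.eval (fun φ : Module.Dual ℂ V => φ v) p ≠ 0}

/-- `Jac f` has the type of `Q`: for every finite-dimensional subspace `V` of `𝔪_𝒵` that maps
onto `𝔪_𝒵 / 𝔪_𝒵²`, there is a nonempty Zariski open `U ⊆ V` such that `Jac f / (u) ≅ e Π e` for
all `u ∈ U`. -/
def HasType {σ : Type} (f : NCSeries σ) (Q : MarkedQuiver) : Prop :=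
  ∀ V : Submodule ℂ (centreRadical f), FiniteDimensional ℂ V →
    Function.Surjective (fun v : V => (centreRadical f).toCotangent v.1) →
    ∃ U : Set V, IsZariskiOpen U ∧ U.Nonempty ∧
      ∀ u ∈ U, Nonempty (QuotBy (u.1.1.1 : Jac f) ≃ₐ[ℂ] Q.Contracted)

/-! ### The normal forms -/

/-- The `k + 2` variables `z₁, …, z_k, x, y`. -/
inductive Var (k : ℕ)
  | z (i : Fin k)
  | x
  | y

namespace NormalForm

open NCSeries

variable (k : ℕ)

/-- The variable `x`. -/
noncomputable def x : NCSeries (Var k) := X .x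

/-- The variable `y`. -/
noncomputable def y : NCSeries (Var k) := X .y

/-- `z₁² + ⋯ + z_k²`. -/
noncomputable def zSquares : NCSeries (Var k) := ∑ i : Fin k, X (.z i) ^ 2

/-- `A_n` for finite `n`, and `A_∞`: `∑ zᵢ² + x² + yⁿ`, where the last term is dropped if
`n = ∞`. -/
noncomputable def potA (n : ℕ∞) : NCSeries (Var k) :=
  zSquares k + x k ^ 2 + ENat.recTopCoe 0 (fun n : ℕ => y k ^ n) n

/-- `D_{n,m}`, `D_{n,∞}`, `D_{∞,m}` and `D_{∞,∞}`: `∑ zᵢ² + x y² + x²ⁿ + x²ᵐ⁻¹`, where terms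
with infinite exponent are dropped. -/
noncomputable def potD (n m : ℕ∞) : NCSeries (Var k) :=
  zSquares k + x k * y k ^ 2 + ENat.recTopCoe 0 (fun n : ℕ => x k ^ (2 * n)) n
    + ENat.recTopCoe 0 (fun m : ℕ => x k ^ (2 * m - 1)) m

/-- `E_{6,n}` for finite `n`, and `E_{6,∞}`: `∑ zᵢ² + x³ + x y³ + yⁿ`, where the last term is
dropped if `n = ∞`. -/
noncomputable def potE (n : ℕ∞) : NCSeries (Var k) :=
  zSquares k + x k ^ 3 + x k * y k ^ 3 + ENat.recTopCoe 0 (fun n : ℕ => y k ^ n) n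

/-- The term of `g_{6,n}`, `n` finite, that is added to `x² + x y x + y x²`. -/
noncomputable def gCorrection (n : ℕ) : NCSeries (Var k) :=
  let t := n / 3
  if n % 3 = 1 then 0
  else if n % 3 = 2 then
    ((-1) ^ t * 3 ^ t * (3 * t + 2) : ℂ) • x k ^ (2 * t + 1)
  else
    ((-1) ^ (t + 1) * 3 ^ t * t : ℂ) •
      (x k * y k * x k ^ (2 * t - 2) + y k * x k ^ (2 * t - 1))

/-- The element `g_{6,n}`; for `n = ∞` it is `x² + x y x + y x²`. -/
noncomputable def gE (n : ℕ∞) : NCSeries (Var k) :=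
  x k ^ 2 + x k * y k * x k + y k * x k ^ 2 + ENat.recTopCoe 0 (gCorrection k) n

end NormalForm

/-! The isomorphisms are obtained without computing a dimension. Put R = Jac(f)/(s) and B = eΠe. The
relations make all long words in the variables vanish in R, so R is finite-dimensional; surjections
R → B and B → R then suffice, because their composite is a surjective, hence injective, endomorphism
of R (`nonempty_quotBy_algEquiv`). Maps out of R are evaluations of power series at generators of B
whose long words vanish (`evalNilpotent`). Maps out of B come from a presentation by the loops at
the marked vertex: p² = q² = (p + q)² = 0 for D₄, and p³ = q³ = (p + q)² = 0 for E₆. Its universal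
property comes from a representation rather than from rewriting in Π: a solution in S lets Π act on
a sum of subspaces of S, with S itself at the marked vertex, arrows acting by inclusions and
reversed arrows by left multiplications (`exists_contracted_lift`).

In Types A and D the relations of R are already those of B. In Type E, δ_x f = 0 reads y³ = -3x², so
x² is central, and the correction term of g is exactly what makes g commute with y. Modulo g a unit
argument forces x³ = 0 (`mul_self_eq_zero_of_relations`). With c = x² what remains is a filtered
deformation `DeformedE6` of the relations of B, and n enters only through the parameters a. Explicit
substitutions lead to x² = 0, y³ = -κ·xyx, y²x + yxy + xy² = 0 with κ = k 0 + (a 0)²/4, and back.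
For κ = μ² ≠ 0 the elements p = y + μx and q = μx - y then satisfy the E₆ relations.

For generic central elements in Types A and D, the point is that every central element without
constant term is a multiple s·w (`hasType_of_forall_eq_mul`). In Type A this is clear, since only y
survives. In Type D an element is a₀ + a₁x + b₀y + b₁xy modulo x², and a representation with x³ = 0
but x²y ≠ 0 shows that centrality forces a₁ = b₀ = b₁ = 0. If s ≠ 0, the constant term of w is a
well-defined linear functional on the radical of the centre; it vanishes on the square of the
radical and not at s. Where it is nonzero, w is a unit and (u) = (s). The cotangent space is
finite-dimensional because Jac(f) is finite over power series in s, so that the centre is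
Noetherian, and its residue field is ℂ. -/

/-! ### Deformations of the contracted preprojective algebra of type `E₆` -/

set_option linter.unusedSimpArgs false

section Deformation

variable {S : Type} [Ring S] [Algebra ℂ S]

/-- The defining relations of the filtered deformations of `e Π(E₆) e` in terms of two generators
`x`, `y` and the central element `c = x²`. -/
structure DeformedE6 (k a : Fin 3 → ℂ) (x y c : S) : Prop where
  xx : x * x = c
  xc : x * c = 0
  cx : c * x = 0
  yc : y * c = c * y
  cyyy : c * (y * (y * y)) = 0
  yyy : y * (y * y) = k 0 • c + k 1 • (c * y) + k 2 • (c * (y * y))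
  yyx : y * (y * x) = a 0 • c + a 1 • (c * y) + a 2 • (c * (y * y)) - x * (y * y) - y * (x * y)
  xyx : x * (y * x) = -c - c * y

namespace DeformedE6

variable {k a : Fin 3 → ℂ} {x y c : S}

theorem cc (h : DeformedE6 k a x y c) : c * c = 0 := by
  nth_rewrite 2 [← h.xx]
  rw [← mul_assoc, h.cx, zero_mul]

theorem cyx (h : DeformedE6 k a x y c) : c * (y * x) = 0 := by
  rw [← mul_assoc, ← h.yc, mul_assoc, h.cx, mul_zero]

theorem xcy (h : DeformedE6 k a x y c) (w : S) : x * (c * w) = 0 := by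
  rw [← mul_assoc, h.xc, zero_mul]

theorem ycw (h : DeformedE6 k a x y c) (w : S) : y * (c * w) = c * (y * w) := by
  rw [← mul_assoc, h.yc, mul_assoc]

theorem ccw (h : DeformedE6 k a x y c) (w : S) : c * (c * w) = 0 := by
  rw [← mul_assoc, h.cc, zero_mul]

theorem cxw (h : DeformedE6 k a x y c) (w : S) : c * (x * w) = 0 := by
  rw [← mul_assoc, h.cx, zero_mul]

theorem cyxw (h : DeformedE6 k a x y c) (w : S) : c * (y * (x * w)) = 0 := by
  rw [← mul_assoc y, ← mul_assoc c, h.cyx, zero_mul]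

theorem cyyyw (h : DeformedE6 k a x y c) (w : S) : c * (y * (y * (y * w))) = 0 := by
  have : c * (y * (y * (y * w))) = c * (y * (y * y)) * w := by simp only [mul_assoc]
  rw [this, h.cyyy, zero_mul]

theorem xxw (h : DeformedE6 k a x y c) (w : S) : x * (x * w) = c * w := by
  rw [← mul_assoc, h.xx]

theorem xyxw (h : DeformedE6 k a x y c) (w : S) : x * (y * (x * w)) = -(c * w) - c * (y * w) := by
  have : x * (y * (x * w)) = x * (y * x) * w := by simp only [mul_assoc]
  rw [this, h.xyx]
  simp only [sub_mul, neg_mul, mul_assoc]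

theorem yyyw (h : DeformedE6 k a x y c) (w : S) :
    y * (y * (y * w)) = k 0 • (c * w) + k 1 • (c * (y * w)) + k 2 • (c * (y * (y * w))) := by
  have : y * (y * (y * w)) = y * (y * y) * w := by simp only [mul_assoc]
  rw [this, h.yyy]
  simp only [add_mul, smul_mul_assoc, mul_assoc]

theorem yyxw (h : DeformedE6 k a x y c) (w : S) :
    y * (y * (x * w)) = a 0 • (c * w) + a 1 • (c * (y * w)) + a 2 • (c * (y * (y * w)))
      - x * (y * (y * w)) - y * (x * (y * w)) := by
  have : y * (y * (x * w)) = y * (y * x) * w := by simp only [mul_assoc]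
  rw [this, h.yyx]
  simp only [add_mul, sub_mul, smul_mul_assoc, mul_assoc]

/-- Replacing `y` by `y + t x`. -/
theorem add_smul_x (h : DeformedE6 k a x y c) (t : ℂ) :
    DeformedE6 ![k 0 + t * a 0 - t ^ 2, k 1 + t * a 1 + t ^ 2, k 2 + t * a 2]
      ![a 0 - 2 * t, a 1 + 2 * t, a 2] x (y + t • x) c := by
  constructor <;>
  simp [mul_add, add_mul, mul_sub, sub_mul, mul_smul_comm, smul_mul_assoc, mul_assoc, h.xx, h.xxw, h.xc, h.xcy, h.cx,
    h.cxw, h.yc, h.ycw, h.cyyy, h.cyyyw, h.yyy, h.yyyw, h.yyx, h.yyxw, h.xyx, h.xyxw, h.cyx,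
    h.cyxw, h.cc, h.ccw]
  · module
  · module

/-- Replacing `y` by `y + t x y`. -/
theorem add_smul_x_mul_y (h : DeformedE6 k a x y c) (t : ℂ) :
    DeformedE6 ![k 0, k 1 + t * a 0, k 2 + t * a 1 - t ^ 2]
      ![a 0, a 1 - 2 * t, a 2 - t] x (y + t • (x * y)) c := by
  constructor <;>
  simp [mul_add, add_mul, mul_sub, sub_mul, mul_smul_comm, smul_mul_assoc, mul_assoc, h.xx, h.xxw, h.xc, h.xcy, h.cx,
    h.cxw, h.yc, h.ycw, h.cyyy, h.cyyyw, h.yyy, h.yyyw, h.yyx, h.yyxw, h.xyx, h.xyxw, h.cyx,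
    h.cyxw, h.cc, h.ccw]
  · module
  · module

/-- Replacing `x` by `x + t c`. -/
theorem add_smul_c (h : DeformedE6 k a x y c) (t : ℂ) :
    DeformedE6 k ![a 0, a 1, a 2 + 3 * t] (x + t • c) y c := by
  constructor <;>
  simp [mul_add, add_mul, mul_sub, sub_mul, mul_smul_comm, smul_mul_assoc, mul_assoc, h.xx, h.xxw, h.xc, h.xcy, h.cx,
    h.cxw, h.yc, h.ycw, h.cyyy, h.cyyyw, h.yyy, h.yyyw, h.yyx, h.yyxw, h.xyx, h.xyxw, h.cyx,
    h.cyxw, h.cc, h.ccw]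
  · module

end DeformedE6

/-- The homogeneous relations of `e Π(E₆) e` in terms of two generators `x`, `y`, with `d = x y x`. -/
structure HomogeneousE6 (t : ℂ) (x y d : S) : Prop where
  xx : x * x = 0
  xyx : x * (y * x) = d
  yyy : y * (y * y) = t • d
  yyx : y * (y * x) = -(x * (y * y)) - y * (x * y)

namespace HomogeneousE6

variable {t : ℂ} {x y d : S}

theorem xxw (h : HomogeneousE6 t x y d) (w : S) : x * (x * w) = 0 := by
  rw [← mul_assoc, h.xx, zero_mul]

theorem xyxw (h : HomogeneousE6 t x y d) (w : S) : x * (y * (x * w)) = d * w := by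
  rw [← h.xyx]; simp only [mul_assoc]

theorem yyyw (h : HomogeneousE6 t x y d) (w : S) : y * (y * (y * w)) = t • (d * w) := by
  have : y * (y * (y * w)) = y * (y * y) * w := by simp only [mul_assoc]
  rw [this, h.yyy, smul_mul_assoc]

theorem yyxw (h : HomogeneousE6 t x y d) (w : S) :
    y * (y * (x * w)) = -(x * (y * (y * w))) - y * (x * (y * w)) := by
  have : y * (y * (x * w)) = y * (y * x) * w := by simp only [mul_assoc]
  rw [this, h.yyx]
  simp only [neg_mul, sub_mul, mul_assoc]

theorem xd (h : HomogeneousE6 t x y d) : x * d = 0 := by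
  rw [← h.xyx, h.xxw]

theorem dx (h : HomogeneousE6 t x y d) : d * x = 0 := by
  rw [← h.xyx]; simp only [mul_assoc, h.xx, mul_zero]

theorem xdw (h : HomogeneousE6 t x y d) (w : S) : x * (d * w) = 0 := by
  rw [← mul_assoc, h.xd, zero_mul]

theorem dxw (h : HomogeneousE6 t x y d) (w : S) : d * (x * w) = 0 := by
  rw [← mul_assoc, h.dx, zero_mul]

/-- Both sides come from x·y·y·x: multiplying the relation for y·y·x by x on the right gives xyyx =
-yd, and by x on the left gives xyyx = -dy. -/
theorem yd (h : HomogeneousE6 t x y d) : y * d = d * y := by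
  have h1 := congrArg (· * x) h.yyx
  simp only [sub_mul, neg_mul, mul_assoc, h.xx, mul_zero, h.xyx] at h1
  simp only [h.yyx, mul_sub, mul_neg, h.xxw, h.xyxw] at h1
  linear_combination (norm := module) h1

theorem ydw (h : HomogeneousE6 t x y d) (w : S) : y * (d * w) = d * (y * w) := by
  rw [← mul_assoc, h.yd, mul_assoc]

theorem dyx (h : HomogeneousE6 t x y d) : d * (y * x) = 0 := by
  rw [← mul_assoc, ← h.yd, mul_assoc, h.dx, mul_zero]

theorem dyxw (h : HomogeneousE6 t x y d) (w : S) : d * (y * (x * w)) = 0 := by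
  rw [← mul_assoc y, ← mul_assoc d, h.dyx, zero_mul]

theorem dd (h : HomogeneousE6 t x y d) : d * d = 0 := by
  nth_rewrite 2 [← h.xyx]
  rw [h.dxw]

theorem ddw (h : HomogeneousE6 t x y d) (w : S) : d * (d * w) = 0 := by
  rw [← mul_assoc, h.dd, zero_mul]

theorem dyyy (h : HomogeneousE6 t x y d) : d * (y * (y * y)) = 0 := by
  rw [h.yyy, mul_smul_comm, h.dd, smul_zero]

theorem dyyyw (h : HomogeneousE6 t x y d) (w : S) : d * (y * (y * (y * w))) = 0 := by
  rw [h.yyyw, mul_smul_comm, h.ddw, smul_zero]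

/-- The change of variables that turns the homogeneous relations into deformed ones. -/
theorem deformed {κ r s : ℂ} (h : HomogeneousE6 (-κ) x y d) (a b : ℂ) (ha : 4 * a = r - 1)
    (hb : 3 * b = s - r - 3 * a ^ 2) :
    ∃ c, DeformedE6 ![κ, κ * r, κ * s] 0 (x - y * x - a • (y * (y * x)))
      (y + a • (y * y) + b • (y * (y * y))) c := by
  -- Eliminating r and s in favour of a and b makes each relation an identity with polynomial
  -- coefficients. The witness for c is the square of the new x, fixed by the `rfl` below.
  obtain rfl : r = 4 * a + 1 := by linear_combination -ha
  obtain rfl : s = 3 * b + (4 * a + 1) + 3 * a ^ 2 := by linear_combination -hb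
  refine ⟨_, ⟨rfl, ?_, ?_, ?_, ?_, ?_, ?_, ?_⟩⟩ <;>
  simp [mul_add, add_mul, mul_sub, sub_mul, mul_smul_comm, smul_mul_assoc, mul_assoc, h.xx, h.xxw,
    h.xyx, h.xyxw, h.yyy, h.yyyw, h.yyx, h.yyxw, h.xd, h.dx, h.xdw, h.dxw, h.yd, h.ydw, h.dyx,
    h.dyxw, h.dd, h.ddw, h.dyyy, h.dyyyw]
  all_goals module

end HomogeneousE6

/-- The change of variables that turns the deformed relations into homogeneous ones. -/
theorem DeformedE6.homogeneous {κ r s : ℂ} {x y c : S} (h : DeformedE6 ![κ, κ * r, κ * s] 0 x y c)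
    (a b : ℂ) (ha : 4 * a = 1 - r) (hb : 3 * b = 1 - a - s - 3 * a * r - 3 * a ^ 2) :
    ∃ d, HomogeneousE6 (-κ) (x + y * x + y * (y * x)) (y + a • (y * y) + b • (y * (y * y))) d := by
  obtain rfl : r = 1 - 4 * a := by linear_combination ha
  obtain rfl : s = 1 - a - 3 * a * (1 - 4 * a) - 3 * a ^ 2 - 3 * b := by linear_combination hb
  refine ⟨_, ⟨?_, rfl, ?_, ?_⟩⟩ <;>
  simp [mul_add, add_mul, mul_sub, sub_mul, mul_smul_comm, smul_mul_assoc, mul_assoc, h.xx, h.xxw, h.xc, h.xcy, h.cx,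
    h.cxw, h.yc, h.ycw, h.cyyy, h.cyyyw, h.yyy, h.yyyw, h.yyx, h.yyxw, h.xyx, h.xyxw, h.cyx,
    h.cyxw, h.cc, h.ccw]
  all_goals module

end Deformation

/-! ### Generators, vanishing of long words, and passage to the loops p, q. -/

section Generation

variable {S : Type} [Ring S] [Algebra ℂ S]

theorem adjoin_pair_eq_top {x y x' y' : S} (h : Algebra.adjoin ℂ {x, y} = ⊤)
    (hx : x ∈ Algebra.adjoin ℂ {x', y'}) (hy : y ∈ Algebra.adjoin ℂ {x', y'}) :
    Algebra.adjoin ℂ {x', y'} = ⊤ := by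
  rw [eq_top_iff, ← h, Algebra.adjoin_le_iff]
  rintro _ (rfl | rfl)
  exacts [hx, hy]

theorem left_mem_adjoin_pair (x y : S) : x ∈ Algebra.adjoin ℂ {x, y} :=
  Algebra.subset_adjoin (by simp)

theorem right_mem_adjoin_pair (x y : S) : y ∈ Algebra.adjoin ℂ {x, y} :=
  Algebra.subset_adjoin (by simp)

open Polynomial in
/-- A subalgebra that contains `y + y² g(y)` for a nilpotent `y` contains `y`. -/
theorem mem_of_aeval_mem {y : S} {N : ℕ} (hy : y ^ N = 0) (g : ℂ[X]) (W : Subalgebra ℂ S)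
    (hW : aeval y (X * (1 + X * g)) ∈ W) : y ∈ W := by
  -- Descending induction on k: every multiple of y ^ k in ℂ[y] lies in `W`. The start is y ^ N = 0,
  -- and j bounds the distance N - k.
  have key : ∀ j k : ℕ, 1 ≤ k → N ≤ k + j → ∀ q : ℂ[X], aeval y (X ^ k * q) ∈ W := by
    intro j
    induction j with
    | zero =>
      intro k _ hk q
      rw [map_mul, map_pow, aeval_X, pow_eq_zero_of_le (show N ≤ k by omega) hy, zero_mul]
      exact W.zero_mem
    | succ j ih =>
      intro k hk hN q
      obtain ⟨r, hr⟩ : X ∣ (1 + X * g) ^ k - 1 := by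
        rw [X_dvd_iff]
        simp [coeff_zero_eq_eval_zero]
      -- Since 1 + Xg has constant term 1, the leading term of X ^ k * q can be replaced by a
      -- multiple of the k-th power of the given element, at the cost of a multiple of X ^ (k + 1).
      have e : (X : ℂ[X]) ^ k * q = C (q.coeff 0) * (X * (1 + X * g)) ^ k
          + X ^ (k + 1) * (q.divX - C (q.coeff 0) * r) := by
        conv_lhs => rw [← divX_mul_X_add q]
        rw [mul_pow]
        linear_combination (-C (q.coeff 0) * X ^ k) * hr
      rw [e, map_add, map_mul, aeval_C, ← Algebra.smul_def, map_pow]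
      exact W.add_mem (W.smul_mem (W.pow_mem hW _) _) (ih _ (by omega) (by omega) _)
  simpa using key N 1 le_rfl (by omega) 1

/-- Products of elements of `V` lie in the steps of a filtration that `V` shifts. -/
theorem prod_mem_filtration {σ : Type} (v : σ → S) (G : ℕ → Submodule ℂ S) (h0 : 1 ∈ G 0)
    (hG : ∀ i n, G n ≤ (G (n + 1)).comap (LinearMap.mulLeft ℂ (v i))) (l : List σ) :
    (l.map v).prod ∈ G l.length := by
  induction l with
  | nil => simpa using h0
  | cons i l ih => simpa using hG i _ ih

namespace DeformedE6

variable {k a : Fin 3 → ℂ} {x y c : S}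

/-- The filtration by degree. -/
def filtration (x y c : S) : ℕ → Submodule ℂ S
  | 0 => Submodule.span ℂ {1}
  | 1 => Submodule.span ℂ {x, y}
  | 2 => Submodule.span ℂ {x * y, y * x, y * y, c}
  | 3 => Submodule.span ℂ {x * (y * y), y * (x * y), c, c * y, c * (y * y)}
  | 4 => Submodule.span ℂ {y * (x * (y * y)), c * y, c * (y * y)}
  | 5 => Submodule.span ℂ {c * (y * y)}
  | _ => ⊥

/-- Each product of a letter with a spanning word is rewritten by the relations. As these are
inhomogeneous (y³ and y²x involve c, of degree two), step three has to contain c itself. The steps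
need not be nested: all that matters is that they reach zero. -/
theorem mulLeft_filtration (h : DeformedE6 k a x y c) {v : S} (hv : v = 0 ∨ v = x ∨ v = y) (n : ℕ) :
    filtration x y c n ≤ (filtration x y c (n + 1)).comap (LinearMap.mulLeft ℂ v) := by
  rcases hv with rfl | rfl | rfl
  · intro m _; simp
  all_goals
    match n with
    | 0 | 1 | 2 | 3 | 4 | 5 =>
      simp only [filtration]
      rw [Submodule.span_le]
      intro m hm
      simp only [Set.mem_insert_iff, Set.mem_singleton_iff] at hm
      rw [SetLike.mem_coe, Submodule.mem_comap, LinearMap.mulLeft_apply]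
      try rcases hm with rfl | rfl | rfl | rfl | rfl
      try rcases hm with rfl | rfl | rfl | rfl
      try rcases hm with rfl | rfl | rfl
      try rcases hm with rfl | rfl
      try subst hm
      all_goals
        try simp only [mul_one, mul_add, add_mul, mul_sub, sub_mul, mul_neg, neg_mul,
          mul_smul_comm, smul_mul_assoc, mul_assoc, h.xx, h.xxw, h.xc, h.xcy, h.cx, h.cxw, h.yc,
          h.ycw, h.cyyy, h.cyyyw, h.yyy, h.yyyw, h.yyx, h.yyxw, h.xyx, h.xyxw, h.cyx, h.cyxw, h.cc,
          h.ccw, smul_zero, mul_zero, add_zero, zero_add, sub_zero, neg_zero]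
        repeat first
          | exact Submodule.zero_mem _
          | (refine Submodule.subset_span ?_; focus (simp; done))
          | apply Submodule.sub_mem
          | apply Submodule.add_mem
          | apply Submodule.neg_mem
          | apply Submodule.smul_mem
    | n + 6 => intro m hm; simp_all [filtration]

theorem prod_eq_zero {σ : Type} (h : DeformedE6 k a x y c) (v : σ → S)
    (hv : ∀ i, v i = 0 ∨ v i = x ∨ v i = y) (l : List σ) (hl : 6 ≤ l.length) :
    (l.map v).prod = 0 := by
  have := prod_mem_filtration v (filtration x y c) (Submodule.subset_span rfl)
    (fun i n => h.mulLeft_filtration (hv i) n) l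
  obtain ⟨n, hn⟩ := Nat.exists_eq_add_of_le' hl
  rw [hn] at this
  simpa [filtration] using this

theorem y_pow_six (h : DeformedE6 k a x y c) : y ^ 6 = 0 := by
  simp [pow_succ, mul_assoc, h.yyyw, h.yyy, h.cyyyw, h.cyyy, mul_add, h.yc, h.ycw, h.cc, h.ccw,
    mul_smul_comm, smul_mul_assoc, add_mul]

theorem c_mem_adjoin (h : DeformedE6 k a x y c) : c ∈ Algebra.adjoin ℂ {x, y} := by
  rw [← h.xx]
  exact mul_mem (left_mem_adjoin_pair x y) (left_mem_adjoin_pair x y)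

theorem adjoin_add_smul_x (t : ℂ) (hg : Algebra.adjoin ℂ {x, y} = ⊤) :
    Algebra.adjoin ℂ {x, y + t • x} = ⊤ := by
  refine adjoin_pair_eq_top hg (left_mem_adjoin_pair _ _) ?_
  have := sub_mem (right_mem_adjoin_pair x (y + t • x))
    (Subalgebra.smul_mem _ (left_mem_adjoin_pair x (y + t • x)) t)
  rwa [add_sub_cancel_right] at this

theorem adjoin_add_smul_x_mul_y (h : DeformedE6 k a x y c) (t : ℂ)
    (hg : Algebra.adjoin ℂ {x, y} = ⊤) : Algebra.adjoin ℂ {x, y + t • (x * y)} = ⊤ := by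
  refine adjoin_pair_eq_top hg (left_mem_adjoin_pair _ _) ?_
  have hx := left_mem_adjoin_pair x (y + t • (x * y))
  have hy := right_mem_adjoin_pair x (y + t • (x * y))
  -- The new element is (1 + tx)y, and 1 - tx + t²x² inverts 1 + tx because x³ = xc = 0.
  have e : y = (y + t • (x * y)) - t • (x * (y + t • (x * y)))
      + t ^ 2 • (x * (x * (y + t • (x * y)))) := by
    simp only [mul_add, mul_smul_comm, h.xxw, h.xcy, h.cxw]
    module
  have := add_mem (sub_mem hy (Subalgebra.smul_mem _ (mul_mem hx hy) t))
    (Subalgebra.smul_mem _ (mul_mem hx (mul_mem hx hy)) (t ^ 2))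
  rwa [← e] at this

theorem adjoin_add_smul_c (h : DeformedE6 k a x y c) (t : ℂ)
    (hg : Algebra.adjoin ℂ {x, y} = ⊤) : Algebra.adjoin ℂ {x + t • c, y} = ⊤ := by
  refine adjoin_pair_eq_top hg ?_ (right_mem_adjoin_pair _ _)
  -- The element c is also the square of x + tc, so it lies in the new subalgebra.
  have := sub_mem (left_mem_adjoin_pair (x + t • c) y)
    (Subalgebra.smul_mem _ (h.add_smul_c t).c_mem_adjoin t)
  rwa [add_sub_cancel_right] at this

end DeformedE6

open Polynomial in
theorem mem_adjoin_of_cubic {y : S} (hy : y ^ 6 = 0) (a b : ℂ) (W : Subalgebra ℂ S)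
    (hW : y + a • (y * y) + b • (y * (y * y)) ∈ W) : y ∈ W := by
  refine mem_of_aeval_mem hy (C a + C b * X) W ?_
  convert hW using 1
  simp only [map_mul, map_add, aeval_X, aeval_C, map_one, mul_add, mul_one, Algebra.algebraMap_eq_smul_one,
    smul_mul_assoc, mul_smul_comm, one_mul]
  module

namespace HomogeneousE6

variable {t : ℂ} {x y d : S}

theorem y_pow_six (h : HomogeneousE6 t x y d) : y ^ 6 = 0 := by
  simp [pow_succ, mul_assoc, h.yyyw, h.yyy, h.yd, h.ydw, h.dd, h.ddw, h.dyyy]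

/-- With μ² = κ, the cube of y ± μx expands to y³ + μ²xyx ± μ(y²x + yxy + xy²), and both brackets
vanish. The sum p + q = 2μx has square zero, and μ ≠ 0 allows x to be recovered. -/
theorem exists_generators {κ : ℂ} (h : HomogeneousE6 (-κ) x y d) (hκ : κ ≠ 0)
    (hg : Algebra.adjoin ℂ {x, y} = ⊤) :
    ∃ p q : S, p * (p * p) = 0 ∧ q * (q * q) = 0 ∧ (p + q) * (p + q) = 0 ∧
      Algebra.adjoin ℂ {p, q} = ⊤ := by
  obtain ⟨μ, rfl⟩ := IsAlgClosed.exists_pow_nat_eq κ two_pos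
  have hμ : μ ≠ 0 := by rintro rfl; simp at hκ
  refine ⟨y + μ • x, μ • x - y, ?_, ?_, ?_, ?_⟩
  · simp [mul_add, add_mul, smul_mul_assoc, mul_smul_comm, mul_assoc, h.xx, h.xxw,
      h.xyx, h.yyy, h.yyx]
    module
  · simp [mul_sub, sub_mul, smul_mul_assoc, mul_smul_comm, mul_assoc, h.xx, h.xxw,
      h.xyx, h.yyy, h.yyx]
    module
  · have : y + μ • x + (μ • x - y) = (2 * μ) • x := by module
    rw [this, smul_mul_smul_comm, h.xx, smul_zero]
  · have hp := left_mem_adjoin_pair (y + μ • x) (μ • x - y)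
    have hq := right_mem_adjoin_pair (y + μ • x) (μ • x - y)
    refine adjoin_pair_eq_top hg ?_ ?_
    · convert Subalgebra.smul_mem _ (add_mem hp hq) (2 * μ)⁻¹ using 1
      have : y + μ • x + (μ • x - y) = (2 * μ) • x := by module
      rw [this, inv_smul_smul₀ (by simpa using hμ)]
    · convert Subalgebra.smul_mem _ (sub_mem hp hq) (2 : ℂ)⁻¹ using 1
      module

/-- Converse change of variables: p³ - q³ isolates the part even in μ, which gives y³ + μ²xyx = 0,
and p³ + q³ isolates the odd part, which gives y²x + yxy + xy² = 0 after division by 2μ. -/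
theorem exists_of_generators {p q : S} (hp : p * (p * p) = 0) (hq : q * (q * q) = 0)
    (hpq : (p + q) * (p + q) = 0) (hg : Algebra.adjoin ℂ {p, q} = ⊤) {κ : ℂ} (hκ : κ ≠ 0) :
    ∃ x y d : S, HomogeneousE6 (-κ) x y d ∧ Algebra.adjoin ℂ {x, y} = ⊤ := by
  obtain ⟨μ, rfl⟩ := IsAlgClosed.exists_pow_nat_eq κ two_pos
  have hμ : μ ≠ 0 := by rintro rfl; simp at hκ
  obtain ⟨x, hx⟩ : ∃ x, x = (2 * μ)⁻¹ • (p + q) := ⟨_, rfl⟩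
  obtain ⟨y, hy⟩ : ∃ y, y = (2 : ℂ)⁻¹ • (p - q) := ⟨_, rfl⟩
  have hxp : μ • x = (2 : ℂ)⁻¹ • (p + q) := by
    rw [hx, smul_smul]; congr 1; field_simp
  have ep : p = y + μ • x := by rw [hxp, hy]; module
  have eq : q = μ • x - y := by rw [hxp, hy]; module
  have hxx : x * x = 0 := by rw [hx, smul_mul_smul_comm, hpq, smul_zero]
  clear hx hy hxp hpq
  subst ep eq
  have hxxw : ∀ w, x * (x * w) = 0 := fun w => by rw [← mul_assoc, hxx, zero_mul]
  simp only [mul_add, add_mul, mul_sub, sub_mul, smul_mul_assoc, mul_smul_comm, mul_assoc, hxx,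
    hxxw, smul_zero, mul_zero] at hp hq
  refine ⟨x, y, _, ⟨hxx, rfl, ?_, ?_⟩, adjoin_pair_eq_top hg ?_ ?_⟩
  · linear_combination (norm := module) (2 : ℂ)⁻¹ • hp - (2 : ℂ)⁻¹ • hq
  · have key : (2 * μ) • (y * (y * x) + x * (y * y) + y * (x * y)) = 0 := by
      linear_combination (norm := module) hp + hq
    rw [smul_eq_zero_iff_right (by simpa using hμ)] at key
    linear_combination (norm := module) key
  · exact add_mem (right_mem_adjoin_pair _ _) (Subalgebra.smul_mem _ (left_mem_adjoin_pair _ _) _)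
  · exact sub_mem (Subalgebra.smul_mem _ (left_mem_adjoin_pair _ _) _) (right_mem_adjoin_pair _ _)

end HomogeneousE6

/-- The elements that the deformed relations yield in `e Π(E₆) e`. -/
theorem DeformedE6.exists_generators {k a : Fin 3 → ℂ} {x y c : S} (h : DeformedE6 k a x y c)
    (hk : k 0 + a 0 ^ 2 / 4 ≠ 0) (hg : Algebra.adjoin ℂ {x, y} = ⊤) :
    ∃ p q : S, p * (p * p) = 0 ∧ q * (q * q) = 0 ∧ (p + q) * (p + q) = 0 ∧
      Algebra.adjoin ℂ {p, q} = ⊤ := by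
  -- The three substitutions kill a 0, a 1 and a 2 in this order. The first turns a 1 into a 0 + a
  -- 1, the second turns a 2 into a 2 - (a 0 + a 1)/2, which explains the constants.
  have g1 := DeformedE6.adjoin_add_smul_x (a 0 / 2) hg
  have h1 := h.add_smul_x (a 0 / 2)
  have g2 := h1.adjoin_add_smul_x_mul_y ((a 0 + a 1) / 2) g1
  have h2 := h1.add_smul_x_mul_y ((a 0 + a 1) / 2)
  have g3 := h2.adjoin_add_smul_c (-(a 2 - (a 0 + a 1) / 2) / 3) g2
  have h3 := h2.add_smul_c (-(a 2 - (a 0 + a 1) / 2) / 3)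
  generalize x + (-(a 2 - (a 0 + a 1) / 2) / 3) • c = x' at *
  generalize y + (a 0 / 2) • x + ((a 0 + a 1) / 2) • (x * (y + (a 0 / 2) • x)) = y' at *
  -- The first substitution changes k 0 into κ; as κ ≠ 0, the two other coefficients may be written
  -- κr and κs.
  obtain ⟨κ, hκ⟩ : ∃ κ, κ = k 0 + a 0 ^ 2 / 4 := ⟨_, rfl⟩
  rw [← hκ] at hk
  obtain ⟨r, hr⟩ : ∃ r, κ * r = k 1 + a 0 / 2 * a 1 + (a 0 / 2) ^ 2 :=
    ⟨_, mul_div_cancel₀ _ hk⟩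
  obtain ⟨s, hs⟩ : ∃ s, κ * s = k 2 + a 0 / 2 * a 2 + (a 0 + a 1) / 2 * (a 1 + a 0)
      - ((a 0 + a 1) / 2) ^ 2 := ⟨_, mul_div_cancel₀ _ hk⟩
  have h4 : DeformedE6 ![κ, κ * r, κ * s] 0 x' y' c := by
    convert h3 using 1
    · funext i; fin_cases i
      · simp [hκ]; ring
      · simp only [Fin.mk_one, Fin.isValue, Matrix.cons_val]; linear_combination hr
      · simp only [Fin.reduceFinMk, Fin.isValue, Matrix.cons_val]; linear_combination hs
    · funext i; fin_cases i <;> simp <;> ring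
  obtain ⟨d, h5⟩ := h4.homogeneous ((1 - r) / 4)
    ((1 - (1 - r) / 4 - s - 3 * ((1 - r) / 4) * r - 3 * ((1 - r) / 4) ^ 2) / 3) (by ring) (by ring)
  set a' := (1 - r) / 4
  set b' := (1 - a' - s - 3 * a' * r - 3 * a' ^ 2) / 3
  have hx := left_mem_adjoin_pair (x' + y' * x' + y' * (y' * x'))
    (y' + a' • (y' * y') + b' • (y' * (y' * y')))
  have hy := mem_adjoin_of_cubic h4.y_pow_six _ _ _ (right_mem_adjoin_pair
    (x' + y' * x' + y' * (y' * x')) (y' + a' • (y' * y') + b' • (y' * (y' * y'))))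
  refine h5.exists_generators hk (adjoin_pair_eq_top g3 ?_ hy)
  -- The new element is (1 + y + y²)x, and left multiplication by 1 - y recovers x because y³x = 0.
  have e : x' = (x' + y' * x' + y' * (y' * x')) - y' * (x' + y' * x' + y' * (y' * x')) := by
    have : y' * (y' * (y' * x')) = 0 := by
      rw [h4.yyyw, h4.cx, h4.cyx, ← mul_assoc y', ← mul_assoc c, mul_assoc, mul_assoc, ← h4.ycw,
        h4.cyx]
      simp
    rw [mul_add, mul_add, this]
    abel
  have := sub_mem hx (mul_mem hy hx)
  rwa [← e] at this

/-- The contracted preprojective algebra of type `E₆` satisfies the deformed relations. -/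
theorem DeformedE6.exists_of_generators {p q : S} (hp : p * (p * p) = 0) (hq : q * (q * q) = 0)
    (hpq : (p + q) * (p + q) = 0) (hg : Algebra.adjoin ℂ {p, q} = ⊤) (k a : Fin 3 → ℂ)
    (hk : k 0 + a 0 ^ 2 / 4 ≠ 0) :
    ∃ x y c : S, DeformedE6 k a x y c ∧ Algebra.adjoin ℂ {x, y} = ⊤ := by
  obtain ⟨κ, hκ⟩ : ∃ κ, κ = k 0 + a 0 ^ 2 / 4 := ⟨_, rfl⟩
  rw [← hκ] at hk
  obtain ⟨x', y', d, h0, g0⟩ := HomogeneousE6.exists_of_generators hp hq hpq hg hk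
  obtain ⟨r, hr⟩ : ∃ r, κ * r = k 1 + a 0 / 2 * a 1 + (a 0 / 2) ^ 2 :=
    ⟨_, mul_div_cancel₀ _ hk⟩
  obtain ⟨s, hs⟩ : ∃ s, κ * s = k 2 + a 0 / 2 * a 2 + (a 0 + a 1) / 2 * (a 1 + a 0)
      - ((a 0 + a 1) / 2) ^ 2 := ⟨_, mul_div_cancel₀ _ hk⟩
  obtain ⟨c, h1⟩ := h0.deformed (r := r) (s := s) ((r - 1) / 4)
    ((s - r - 3 * ((r - 1) / 4) ^ 2) / 3) (by ring) (by ring)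
  set a' := (r - 1) / 4
  set b' := (s - r - 3 * a' ^ 2) / 3
  have hx := left_mem_adjoin_pair (x' - y' * x' - a' • (y' * (y' * x')))
    (y' + a' • (y' * y') + b' • (y' * (y' * y')))
  have hy := mem_adjoin_of_cubic h0.y_pow_six _ _ _ (right_mem_adjoin_pair
    (x' - y' * x' - a' • (y' * (y' * x'))) (y' + a' • (y' * y') + b' • (y' * (y' * y'))))
  have g1 : Algebra.adjoin ℂ {x' - y' * x' - a' • (y' * (y' * x')),
      y' + a' • (y' * y') + b' • (y' * (y' * y'))} = ⊤ := by
    refine adjoin_pair_eq_top g0 ?_ hy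
    -- Modulo y³ the inverse of 1 - y - ay² is 1 + y + (1 + a)y², and y³x = 0.
    have := add_mem (add_mem hx (mul_mem hy hx))
      (Subalgebra.smul_mem _ (mul_mem hy (mul_mem hy hx)) (1 + a'))
    convert this using 1
    have e : y' * (y' * (y' * x')) = 0 := by rw [h0.yyyw, h0.dx, smul_zero]
    simp only [mul_sub, mul_smul_comm, e, mul_zero]
    module
  -- From here on the three substitutions that remove a are undone, in reverse order and with
  -- opposite signs.
  have h2 := h1.add_smul_c ((a 2 - (a 0 + a 1) / 2) / 3)
  have g2 := h1.adjoin_add_smul_c ((a 2 - (a 0 + a 1) / 2) / 3) g1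
  have h3 := h2.add_smul_x_mul_y (-((a 0 + a 1) / 2))
  have g3 := h2.adjoin_add_smul_x_mul_y (-((a 0 + a 1) / 2)) g2
  have h4 := h3.add_smul_x (-(a 0 / 2))
  have g4 := DeformedE6.adjoin_add_smul_x (-(a 0 / 2)) g3
  refine ⟨_, _, c, ?_, g4⟩
  convert h4 using 1
  · funext i; fin_cases i
    · simp [hκ]; ring
    · simp only [Fin.mk_one, Fin.isValue, Matrix.cons_val, Pi.zero_apply]; linear_combination -hr
    · simp only [Fin.reduceFinMk, Fin.isValue, Matrix.cons_val, Pi.zero_apply]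
      linear_combination -hs
  · funext i; fin_cases i <;> simp <;> ring

end Generation

/-! ### Evaluation of noncommutative power series -/

namespace NCSeries

variable {σ : Type}

theorem AgreeBelow.refl (N : ℕ) (f : NCSeries σ) : AgreeBelow N f f := fun _ _ => rfl

theorem AgreeBelow.symm {N : ℕ} {f g : NCSeries σ} (h : AgreeBelow N f g) : AgreeBelow N g f :=
  fun w hw => (h w hw).symm

theorem AgreeBelow.trans {N : ℕ} {f g h : NCSeries σ} (h₁ : AgreeBelow N f g)
    (h₂ : AgreeBelow N g h) : AgreeBelow N f h := fun w hw => (h₁ w hw).trans (h₂ w hw)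

theorem AgreeBelow.add {N : ℕ} {f f' g g' : NCSeries σ} (hf : AgreeBelow N f f')
    (hg : AgreeBelow N g g') : AgreeBelow N (f + g) (f' + g') := fun w hw => by
  simp [hf w hw, hg w hw]

theorem AgreeBelow.sub {N : ℕ} {f f' g g' : NCSeries σ} (hf : AgreeBelow N f f')
    (hg : AgreeBelow N g g') : AgreeBelow N (f - g) (f' - g') := fun w hw => by
  simp [hf w hw, hg w hw]

theorem AgreeBelow.sum {ι : Type} {N : ℕ} {s : Finset ι} {f g : ι → NCSeries σ}
    (h : ∀ i ∈ s, AgreeBelow N (f i) (g i)) : AgreeBelow N (∑ i ∈ s, f i) (∑ i ∈ s, g i) := by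
  classical
  induction s using Finset.induction_on with
  | empty => simpa using AgreeBelow.refl N 0
  | insert i s hi ih =>
    rw [Finset.sum_insert hi, Finset.sum_insert hi]
    exact (h i (by simp)).add (ih fun j hj => h j (by simp [hj]))

/-- `f` has order at least `m` when it agrees with `0` below `m`; orders add up in products. -/
theorem AgreeBelow.mul_zero_zero {m n : ℕ} {f g : NCSeries σ} (hf : AgreeBelow m f 0)
    (hg : AgreeBelow n g 0) : AgreeBelow (m + n) (f * g) 0 := by
  intro w hw
  rw [mul_coeff, zero_coeff]
  refine Finset.sum_eq_zero fun i hi => ?_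
  rw [Finset.mem_range] at hi
  by_cases h : i < m
  · rw [hf _ (by rw [List.length_take]; omega), zero_coeff, zero_mul]
  · rw [hg _ (by rw [List.length_drop]; omega), zero_coeff, mul_zero]

theorem agreeBelow_one_of_nil {f : NCSeries σ} (hf : f [] = 0) : AgreeBelow 1 f 0 := by
  intro w hw
  rw [List.length_eq_zero_iff.mp (by omega : w.length = 0), hf, zero_coeff]

theorem agreeBelow_pow {f : NCSeries σ} (hf : f [] = 0) (n : ℕ) : AgreeBelow n (f ^ n) 0 := by
  induction n with
  | zero => intro w hw; omega
  | succ n ih => rw [pow_succ]; exact ih.mul_zero_zero (agreeBelow_one_of_nil hf)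

theorem X_nil (a : σ) : (X a : NCSeries σ) [] = 0 := by
  simp [X, monomial]

theorem sum_coeff {ι : Type} (s : Finset ι) (f : ι → NCSeries σ) (w : List σ) :
    (∑ i ∈ s, f i) w = ∑ i ∈ s, f i w := Finset.sum_apply _ _ _

theorem strike_X (a b : σ) [Decidable (a = b)] :
    strike a (X b : NCSeries σ) = if a = b then 1 else 0 := by
  classical
  ext w
  by_cases h : a = b
  · subst h
    simp [strike, X, monomial, one_coeff]
  · simp [strike, X, monomial, h]

theorem X_mul_nil (a : σ) (f : NCSeries σ) : (X a * f) [] = 0 := by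
  rw [mul_nil, X_nil, zero_mul]

theorem X_mul_cons (a b : σ) [Decidable (b = a)] (f : NCSeries σ) (w : List σ) :
    (X a * f) (b :: w) = if b = a then f w else 0 := by
  rw [mul_cons, X_nil, zero_mul, zero_add, strike_X]
  split_ifs with h
  · rw [one_mul']
  · rw [zero_mul', zero_coeff]

theorem monomial_nil : (monomial [] : NCSeries σ) = 1 := rfl

theorem monomial_cons (a : σ) (w : List σ) :
    (monomial (a :: w) : NCSeries σ) = X a * monomial w := by
  classical
  ext v
  cases v with
  | nil => rw [X_mul_nil]; simp [monomial]
  | cons b v => rw [X_mul_cons]; by_cases h : b = a <;> simp [monomial, h]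

theorem strike_add (a : σ) (f g : NCSeries σ) : strike a (f + g) = strike a f + strike a g := rfl

theorem strike_smul (a : σ) (c : ℂ) (f : NCSeries σ) : strike a (c • f) = c • strike a f := rfl

/-- The constant term, as an algebra homomorphism. -/
noncomputable def constTerm : NCSeries σ →ₐ[ℂ] ℂ where
  toFun f := f []
  map_one' := one_nil
  map_mul' := mul_nil
  map_zero' := rfl
  map_add' _ _ := rfl
  commutes' c := by
    rw [Algebra.algebraMap_eq_smul_one, smul_coeff, one_nil]
    simp

section Fintype

variable [Fintype σ]

/-- Splitting off the first letter is the recursion behind truncated evaluation: it replaces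
infinite sums over words by induction on the degree. -/
theorem eq_const_add_sum (f : NCSeries σ) : f = f [] • 1 + ∑ a, X a * strike a f := by
  classical
  ext w
  rw [add_coeff, smul_coeff, sum_coeff]
  cases w with
  | nil => simp [one_nil, X_mul_nil]
  | cons b w => simp [one_coeff, X_mul_cons, strike]

/-- Polynomials are dense. -/
theorem exists_polynomial_agreeBelow (N : ℕ) (f : NCSeries σ) :
    ∃ p ∈ Algebra.adjoin ℂ (Set.range (X : σ → NCSeries σ)), AgreeBelow N f p := by
  induction N generalizing f with
  | zero => exact ⟨0, zero_mem _, fun w hw => by omega⟩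
  | succ N ih =>
    choose p hp h using ih
    refine ⟨f [] • 1 + ∑ a, X a * p (strike a f), ?_, ?_⟩
    · refine add_mem (Subalgebra.smul_mem _ (one_mem _) _) (sum_mem fun a _ => ?_)
      exact mul_mem (Algebra.subset_adjoin ⟨a, rfl⟩) (hp _)
    · conv_lhs => rw [eq_const_add_sum f]
      refine (AgreeBelow.refl _ _).add (AgreeBelow.sum fun a _ => ?_)
      classical
      intro w hw
      cases w with
      | nil => rw [X_mul_nil, X_mul_nil]
      | cons b w =>
        rw [X_mul_cons, X_mul_cons]
        split_ifs
        · exact h _ w (by simpa using hw)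
        · rfl

variable {S : Type} [Ring S] [Algebra ℂ S]

/-- The value of the truncation of `f` below degree `N` at the elements `v`. -/
noncomputable def evalTrunc (v : σ → S) : ℕ → NCSeries σ → S
  | 0, _ => 0
  | N + 1, f => f [] • 1 + ∑ a, v a * evalTrunc v N (strike a f)

theorem evalTrunc_congr (v : σ → S) {N : ℕ} {f g : NCSeries σ} (h : AgreeBelow N f g) :
    evalTrunc v N f = evalTrunc v N g := by
  induction N generalizing f g with
  | zero => rfl
  | succ N ih =>
    rw [evalTrunc, evalTrunc, h [] (by simp)]
    congr 1
    exact Finset.sum_congr rfl fun a _ => by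
      rw [ih (f := strike a f) (g := strike a g) fun w hw => h (a :: w) (by simpa using hw)]

theorem evalTrunc_add (v : σ → S) (N : ℕ) (f g : NCSeries σ) :
    evalTrunc v N (f + g) = evalTrunc v N f + evalTrunc v N g := by
  induction N generalizing f g with
  | zero => simp [evalTrunc]
  | succ N ih =>
    simp only [evalTrunc, strike_add, ih, mul_add, Finset.sum_add_distrib, add_coeff, add_smul]
    abel

theorem evalTrunc_smul (v : σ → S) (N : ℕ) (c : ℂ) (f : NCSeries σ) :
    evalTrunc v N (c • f) = c • evalTrunc v N f := by
  induction N generalizing f with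
  | zero => simp [evalTrunc]
  | succ N ih =>
    simp only [evalTrunc, strike_smul, ih, mul_smul_comm, smul_add, Finset.smul_sum, smul_coeff,
      mul_smul]

theorem evalTrunc_zero (v : σ → S) (N : ℕ) : evalTrunc v N (0 : NCSeries σ) = 0 := by
  simpa using evalTrunc_smul v N 0 0

theorem evalTrunc_one (v : σ → S) (N : ℕ) : evalTrunc v (N + 1) (1 : NCSeries σ) = 1 := by
  simp [evalTrunc, one_nil, strike_one, evalTrunc_zero]

variable {v : σ → S} {N : ℕ}

/-- Any homomorphism that kills all long words is given by truncated evaluation. -/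
theorem prod_mul_map_eq (π : NCSeries σ →ₐ[ℂ] S)
    (h : ∀ l : List σ, N ≤ l.length → (l.map fun a => π (X a)).prod = 0) (M : ℕ) (l : List σ)
    (hl : N ≤ l.length + M) (f : NCSeries σ) :
    (l.map fun a => π (X a)).prod * π f
      = (l.map fun a => π (X a)).prod * evalTrunc (fun a => π (X a)) M f := by
  induction M generalizing l f with
  | zero => rw [h l hl, zero_mul, zero_mul]
  | succ M ih =>
    conv_lhs => rw [eq_const_add_sum f]
    simp only [evalTrunc, map_add, map_smul, map_one, map_sum, map_mul, mul_add, Finset.mul_sum]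
    congr 1
    refine Finset.sum_congr rfl fun a _ => ?_
    -- The letter struck off moves into the prefix, so the prefix length plus the remaining
    -- truncation degree stays at least N. Once the truncation degree is zero the prefix is long
    -- enough to vanish.
    have := ih (l ++ [a]) (by simp; omega) (strike a f)
    simpa [mul_assoc] using this

theorem map_eq_evalTrunc (π : NCSeries σ →ₐ[ℂ] S)
    (h : ∀ l : List σ, N ≤ l.length → (l.map fun a => π (X a)).prod = 0) (f : NCSeries σ) :
    π f = evalTrunc (fun a => π (X a)) N f := by
  simpa using prod_mul_map_eq π h N [] (by simp) f

variable (h : ∀ l : List σ, N ≤ l.length → (l.map v).prod = 0)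
include h

/-- Behind a prefix l, terms of degree at least N - l.length contribute nothing. Carrying the prefix
through the induction is what makes truncations of different degrees comparable. -/
theorem prod_mul_evalTrunc_succ (M : ℕ) (l : List σ) (hl : N ≤ l.length + M) (f : NCSeries σ) :
    (l.map v).prod * evalTrunc v (M + 1) f = (l.map v).prod * evalTrunc v M f := by
  induction M generalizing l f with
  | zero => rw [h l hl, zero_mul, zero_mul]
  | succ M ih =>
    rw [evalTrunc, evalTrunc, mul_add, mul_add, Finset.mul_sum, Finset.mul_sum]
    congr 1
    refine Finset.sum_congr rfl fun a _ => ?_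
    have := ih (l ++ [a]) (by simp; omega) (strike a f)
    simpa [mul_assoc] using this

theorem prod_mul_evalTrunc_of_le {M M' : ℕ} (l : List σ) (hl : N ≤ l.length + M) (hM : M ≤ M')
    (f : NCSeries σ) : (l.map v).prod * evalTrunc v M' f = (l.map v).prod * evalTrunc v M f := by
  induction M', hM using Nat.le_induction with
  | base => rfl
  | succ M' hM ih => rw [prod_mul_evalTrunc_succ h M' l (by omega), ih]

/-- A single truncation is not multiplicative, since fg and f, g are cut off differently. Behind a
prefix the discrepancy consists of vanishing words. -/
theorem prod_mul_evalTrunc_mul (M : ℕ) (l : List σ) (hl : N ≤ l.length + M) (f g : NCSeries σ) :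
    (l.map v).prod * evalTrunc v M (f * g)
      = (l.map v).prod * evalTrunc v M f * evalTrunc v N g := by
  induction M generalizing l f with
  | zero => rw [h l hl]; simp
  | succ M ih =>
    have e : evalTrunc v (M + 1) (f * g) = f [] • evalTrunc v (M + 1) g
        + ∑ a, v a * evalTrunc v M (strike a f * g) := by
      simp only [evalTrunc, mul_nil, strike_mul, evalTrunc_add, evalTrunc_smul, mul_add,
        Finset.sum_add_distrib, mul_smul_comm, smul_add, Finset.smul_sum, mul_smul]
      abel
    have e1 : (l.map v).prod * evalTrunc v (M + 1) g = (l.map v).prod * evalTrunc v N g := by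
      rcases le_total N (M + 1) with h1 | h1
      · exact prod_mul_evalTrunc_of_le h l (by omega) h1 g
      · exact (prod_mul_evalTrunc_of_le h l hl h1 g).symm
    rw [e, mul_add, mul_smul_comm, e1, evalTrunc, mul_add, add_mul, mul_smul_comm, mul_one,
      smul_mul_assoc, Finset.mul_sum, Finset.mul_sum, Finset.sum_mul]
    congr 1
    refine Finset.sum_congr rfl fun a _ => ?_
    have := ih (l ++ [a]) (by simp; omega) (strike a f)
    simpa [mul_assoc] using this

/-- Evaluation of power series at elements all of whose long words vanish. -/
noncomputable def evalNilpotent : NCSeries σ →ₐ[ℂ] S where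
  toFun := evalTrunc v N
  map_one' := by
    -- The truncation of 1 in degree N is 1 only for N > 0. For N = 0 the hypothesis on the empty
    -- word says 1 = 0 in `S`; comparison with degree N + 1 covers both cases.
    have := prod_mul_evalTrunc_succ h N [] (by simp) (1 : NCSeries σ)
    simp only [evalTrunc_one] at this
    simpa using this.symm
  map_mul' f g := by simpa using prod_mul_evalTrunc_mul h N [] (by simp) f g
  map_zero' := evalTrunc_zero v N
  map_add' := evalTrunc_add v N
  commutes' c := by
    have := prod_mul_evalTrunc_succ h N [] (by simp) (1 : NCSeries σ)
    simp only [evalTrunc_one] at this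
    rw [Algebra.algebraMap_eq_smul_one, Algebra.algebraMap_eq_smul_one, evalTrunc_smul]
    congr 1
    simpa using this.symm

theorem evalNilpotent_apply (f : NCSeries σ) : evalNilpotent h f = evalTrunc v N f := rfl

theorem evalNilpotent_X (a : σ) : evalNilpotent h (X a : NCSeries σ) = v a := by
  classical
  rw [evalNilpotent_apply]
  have e : evalTrunc v (N + 1 + 1) (X a : NCSeries σ) = v a := by
    rw [evalTrunc, X_nil, zero_smul, zero_add, Finset.sum_eq_single a]
    · rw [strike_X, if_pos rfl, evalTrunc_one, mul_one]
    · intro b _ hb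
      rw [strike_X, if_neg hb, evalTrunc_zero, mul_zero]
    · simp
  rw [← e]
  simpa using (prod_mul_evalTrunc_of_le h [] (M := N) (M' := N + 1 + 1) (by simp) (by omega)
    (X a : NCSeries σ)).symm

theorem evalNilpotent_congr {f g : NCSeries σ} (hfg : AgreeBelow N f g) :
    evalNilpotent h f = evalNilpotent h g := evalTrunc_congr v hfg

end Fintype

end NCSeries

/-! ### Substitution into power series in one variable, and units. -/

namespace NCSeries

variable {σ : Type}

theorem AgreeBelow.mono {M N : ℕ} {f g : NCSeries σ} (h : AgreeBelow M f g) (hN : N ≤ M) :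
    AgreeBelow N f g := fun w hw => h w (hw.trans_le hN)

theorem aeval_agreeBelow_of_X_pow_dvd {g : NCSeries σ} (hg : g [] = 0) {N : ℕ} {p : Polynomial ℂ}
    (h : Polynomial.X ^ N ∣ p) : AgreeBelow N (Polynomial.aeval g p) 0 := by
  obtain ⟨q, rfl⟩ := h
  rw [map_mul, map_pow, Polynomial.aeval_X]
  have := (agreeBelow_pow hg N).mul_zero_zero (n := 0) (g := Polynomial.aeval g q) fun w hw => by omega
  simpa using this

theorem aeval_agreeBelow_of_X_pow_dvd_sub {g : NCSeries σ} (hg : g [] = 0) {N : ℕ} {p q : Polynomial ℂ}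
    (h : Polynomial.X ^ N ∣ p - q) :
    AgreeBelow N (Polynomial.aeval g p) (Polynomial.aeval g q) := by
  intro w hw
  have := aeval_agreeBelow_of_X_pow_dvd hg h w hw
  rwa [map_sub, sub_coeff, zero_coeff, sub_eq_zero] at this

theorem X_pow_dvd_trunc_sub_trunc {M N : ℕ} (h : N ≤ M) (p : PowerSeries ℂ) :
    (Polynomial.X : Polynomial ℂ) ^ N ∣ p.trunc M - p.trunc N := by
  rw [Polynomial.X_pow_dvd_iff]
  intro d hd
  rw [Polynomial.coeff_sub, PowerSeries.coeff_trunc, PowerSeries.coeff_trunc, if_pos hd,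
    if_pos (hd.trans_le h), sub_self]

/-- Substitution of a series without constant term into a power series in one variable. -/
noncomputable def substFun (g : NCSeries σ) (p : PowerSeries ℂ) : NCSeries σ :=
  fun w => Polynomial.aeval g (p.trunc (w.length + 1)) w

theorem substFun_agreeBelow {g : NCSeries σ} (hg : g [] = 0) (N : ℕ) (p : PowerSeries ℂ) :
    AgreeBelow N (substFun g p) (Polynomial.aeval g (p.trunc N)) := by
  intro w hw
  exact (aeval_agreeBelow_of_X_pow_dvd_sub hg
    (X_pow_dvd_trunc_sub_trunc (M := N) (N := w.length + 1) hw p) w (by omega)).symm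

theorem eq_of_agreeBelow {f g : NCSeries σ} (h : ∀ N, AgreeBelow N f g) : f = g := by
  ext w
  exact h (w.length + 1) w (by omega)

/-- Substitution of a series without constant term into power series in one variable. -/
noncomputable def subst {g : NCSeries σ} (hg : g [] = 0) : PowerSeries ℂ →ₐ[ℂ] NCSeries σ where
  toFun := substFun g
  map_one' := eq_of_agreeBelow fun N => by
    -- Truncation in degree 0 would lose the constant term, so the comparison is made one degree
    -- higher.
    refine AgreeBelow.mono (M := N + 1) ((substFun_agreeBelow hg (N + 1) 1).trans ?_) (Nat.le_add_right _ _)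
    rw [PowerSeries.trunc_one, map_one]
    exact AgreeBelow.refl _ _
  map_mul' p q := eq_of_agreeBelow fun N => by
    refine (substFun_agreeBelow hg N (p * q)).trans (AgreeBelow.trans ?_
      ((substFun_agreeBelow hg N p).mul (substFun_agreeBelow hg N q)).symm)
    rw [← map_mul]
    refine aeval_agreeBelow_of_X_pow_dvd_sub hg ?_
    rw [Polynomial.X_pow_dvd_iff]
    intro d hd
    rw [Polynomial.coeff_sub, PowerSeries.coeff_trunc, if_pos hd, Polynomial.coeff_mul,
      PowerSeries.coeff_mul, ← Finset.sum_sub_distrib]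
    refine Finset.sum_eq_zero fun ij hij => ?_
    rw [Finset.HasAntidiagonal.mem_antidiagonal] at hij
    rw [PowerSeries.coeff_trunc, PowerSeries.coeff_trunc, if_pos (by omega), if_pos (by omega),
      sub_self]
  map_zero' := eq_of_agreeBelow fun N => by
    refine (substFun_agreeBelow hg N 0).trans ?_
    simpa using AgreeBelow.refl N (0 : NCSeries σ)
  map_add' p q := eq_of_agreeBelow fun N => by
    refine (substFun_agreeBelow hg N (p + q)).trans (AgreeBelow.trans ?_
      ((substFun_agreeBelow hg N p).add (substFun_agreeBelow hg N q)).symm)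
    rw [map_add, map_add]
    exact AgreeBelow.refl _ _
  commutes' c := eq_of_agreeBelow fun N => by
    refine AgreeBelow.mono (M := N + 1) ((substFun_agreeBelow hg (N + 1) _).trans ?_) (Nat.le_add_right _ _)
    rw [PowerSeries.algebraMap_apply, Algebra.algebraMap_self_apply, PowerSeries.trunc_C,
      Polynomial.aeval_C]
    exact AgreeBelow.refl _ _

theorem subst_agreeBelow {g : NCSeries σ} (hg : g [] = 0) (N : ℕ) (p : PowerSeries ℂ) :
    AgreeBelow N (subst hg p) (Polynomial.aeval g (p.trunc N)) := substFun_agreeBelow hg N p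

theorem subst_X {g : NCSeries σ} (hg : g [] = 0) : subst hg PowerSeries.X = g :=
  eq_of_agreeBelow fun N => by
    refine AgreeBelow.mono (M := N + 2) ((subst_agreeBelow hg (N + 2) _).trans ?_) (Nat.le_add_right _ _)
    rw [PowerSeries.trunc_X, Polynomial.aeval_X]
    exact AgreeBelow.refl _ _

/-- With g the part of f without constant term, f is the value at g of the one-variable series f []
+ X, which is invertible. -/
theorem isUnit_of_nil_ne_zero {f : NCSeries σ} (hf : f [] ≠ 0) : IsUnit f := by
  obtain ⟨g, hfg⟩ : ∃ g, g = f - f [] • 1 := ⟨_, rfl⟩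
  have hg : g [] = 0 := by simp [hfg, one_nil]
  have h : f = subst hg (PowerSeries.C (f []) + PowerSeries.X) := by
    have : subst hg (PowerSeries.C (f [])) = f [] • 1 := by
      rw [← Algebra.algebraMap_eq_smul_one]
      exact (subst hg).commutes (f [])
    rw [map_add, subst_X, this, hfg, add_sub_cancel]
  rw [h]
  refine IsUnit.map _ (PowerSeries.isUnit_iff_constantCoeff.mpr ?_)
  simpa using hf

end NCSeries

/-! ### Homomorphisms from Jacobi algebras -/

section Jacobi

variable {σ : Type}

open NCSeries

/-- The projection to the Jacobi algebra as an algebra homomorphism. -/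
noncomputable def Jac.mkₐ (f : NCSeries σ) : NCSeries σ →ₐ[ℂ] Jac f :=
  { (jacobiIdeal f).ringCon.mk' with commutes' := fun _ => rfl }

theorem Jac.mkₐ_apply (f g : NCSeries σ) : Jac.mkₐ f g = Jac.mk f g := rfl

theorem Jac.mkₐ_surjective (f : NCSeries σ) : Function.Surjective (Jac.mkₐ f) :=
  RingCon.mk'_surjective _

theorem TwoSidedIdeal.mk'_eq_zero {A : Type} [Ring A] (I : TwoSidedIdeal A) (a : A) :
    I.ringCon.mk' a = 0 ↔ a ∈ I := by
  rw [← TwoSidedIdeal.mem_ker, TwoSidedIdeal.ker_ringCon_mk']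

theorem Jac.mkₐ_eq_zero {f g : NCSeries σ} : Jac.mkₐ f g = 0 ↔ g ∈ jacobiIdeal f :=
  TwoSidedIdeal.mk'_eq_zero _ _

theorem NCSeries.mem_closure {I : TwoSidedIdeal (NCSeries σ)} {f : NCSeries σ} :
    f ∈ closure I ↔ ∀ N, ∃ g ∈ I, AgreeBelow N f g := by
  unfold closure
  exact TwoSidedIdeal.mem_mk' _ _ _ _ _ _ _

theorem Jac.mkₐ_cyclicDeriv (f : NCSeries σ) (i : σ) : Jac.mkₐ f (cyclicDeriv i f) = 0 :=
  Jac.mkₐ_eq_zero.mpr <| NCSeries.mem_closure.mpr fun _ =>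
    ⟨_, TwoSidedIdeal.subset_span ⟨i, rfl⟩, AgreeBelow.refl _ _⟩

/-- The Jacobi ideal is closed. -/
theorem Jac.mkₐ_eq_zero_of_agreeBelow {f g : NCSeries σ}
    (h : ∀ N, ∃ g', Jac.mkₐ f g' = 0 ∧ AgreeBelow N g g') : Jac.mkₐ f g = 0 := by
  refine Jac.mkₐ_eq_zero.mpr (NCSeries.mem_closure.mpr fun N => ?_)
  obtain ⟨g', h1, h2⟩ := h N
  obtain ⟨g'', h3, h4⟩ := NCSeries.mem_closure.mp (Jac.mkₐ_eq_zero.mp h1) N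
  exact ⟨g'', h3, h2.trans h4⟩

variable {S : Type} [Ring S] [Algebra ℂ S]

/-- Lifting to the quotient by a two-sided ideal. -/
noncomputable def TwoSidedIdeal.liftₐ {A : Type} [Ring A] [Algebra ℂ A] (I : TwoSidedIdeal A)
    (φ : A →ₐ[ℂ] S) (h : ∀ a ∈ I, φ a = 0) : TwoSidedQuot I →ₐ[ℂ] S :=
  I.ringCon.liftₐ φ fun a b hab => by
    have := h _ ((I.rel_iff a b).mp hab)
    rw [map_sub, sub_eq_zero] at this
    exact this

/-- Homomorphisms from a Jacobi algebra that only depend on truncations. -/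
theorem Jac.exists_lift (f : NCSeries σ) (φ : NCSeries σ →ₐ[ℂ] S) {N : ℕ}
    (hφ : ∀ g g', AgreeBelow N g g' → φ g = φ g') (h : ∀ i, φ (cyclicDeriv i f) = 0) :
    ∃ ψ : Jac f →ₐ[ℂ] S, ∀ g, ψ (Jac.mkₐ f g) = φ g := by
  refine ⟨TwoSidedIdeal.liftₐ (jacobiIdeal f) φ fun a ha => ?_, fun g => rfl⟩
  -- The map sees only degrees below N, so an element of the closure may be replaced by an element
  -- of the ideal before closure.
  obtain ⟨g, hg, hag⟩ := NCSeries.mem_closure.mp ha N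
  rw [hφ a g hag, ← TwoSidedIdeal.mem_ker]
  refine (TwoSidedIdeal.span_le.mpr ?_) hg
  rintro _ ⟨i, rfl⟩
  exact (TwoSidedIdeal.mem_ker _).mpr (h i)

/-- The projection `A → A / (s)`. -/
noncomputable def QuotBy.mkₐ {A : Type} [Ring A] [Algebra ℂ A] (s : A) : A →ₐ[ℂ] QuotBy s :=
  { (TwoSidedIdeal.span {s}).ringCon.mk' with commutes' := fun _ => rfl }

theorem QuotBy.mkₐ_surjective {A : Type} [Ring A] [Algebra ℂ A] (s : A) :
    Function.Surjective (QuotBy.mkₐ s) := RingCon.mk'_surjective _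

theorem QuotBy.mkₐ_eq_zero {A : Type} [Ring A] [Algebra ℂ A] {s a : A} :
    QuotBy.mkₐ s a = 0 ↔ a ∈ TwoSidedIdeal.span {s} := TwoSidedIdeal.mk'_eq_zero _ _

theorem QuotBy.mkₐ_self {A : Type} [Ring A] [Algebra ℂ A] (s : A) : QuotBy.mkₐ s s = 0 :=
  QuotBy.mkₐ_eq_zero.mpr (TwoSidedIdeal.subset_span rfl)

theorem QuotBy.exists_lift {A : Type} [Ring A] [Algebra ℂ A] (s : A) (φ : A →ₐ[ℂ] S)
    (h : φ s = 0) : ∃ ψ : QuotBy s →ₐ[ℂ] S, ∀ a, ψ (QuotBy.mkₐ s a) = φ a := by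
  refine ⟨TwoSidedIdeal.liftₐ _ φ fun a ha => ?_, fun g => rfl⟩
  rw [← TwoSidedIdeal.mem_ker]
  refine (TwoSidedIdeal.span_le.mpr ?_) ha
  rintro _ rfl
  exact (TwoSidedIdeal.mem_ker _).mpr h

/-- For central `s` the ideal `(s)` consists of the multiples of `s`. -/
theorem mem_span_singleton_of_central {A : Type} [Ring A] {s : A} (hs : ∀ a, s * a = a * s)
    {a : A} : a ∈ TwoSidedIdeal.span {s} ↔ ∃ w, a = s * w := by
  constructor
  · intro ha
    have : TwoSidedIdeal.span {s} ≤ TwoSidedIdeal.mk' {a | ∃ w, a = s * w} ⟨0, by simp⟩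
        (by rintro _ _ ⟨w, rfl⟩ ⟨w', rfl⟩; exact ⟨w + w', by rw [mul_add]⟩)
        (by rintro _ ⟨w, rfl⟩; exact ⟨-w, by rw [mul_neg]⟩)
        (by rintro b _ ⟨w, rfl⟩; exact ⟨b * w, by rw [← mul_assoc, ← mul_assoc, hs]⟩)
        (by rintro _ b ⟨w, rfl⟩; exact ⟨w * b, by rw [mul_assoc]⟩) := by
      rw [TwoSidedIdeal.span_le]
      rintro _ rfl
      exact (TwoSidedIdeal.mem_mk' ..).mpr ⟨1, by rw [mul_one]⟩
    exact (TwoSidedIdeal.mem_mk' {a | ∃ w, a = s * w} _ _ _ _ _ a).mp (this ha)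
  · rintro ⟨w, rfl⟩
    exact TwoSidedIdeal.mul_mem_right _ _ _ (TwoSidedIdeal.subset_span rfl)

variable [Fintype σ]

/-- An element of a Jacobi algebra that commutes with the variables is central. -/
theorem Jac.mem_center {f s : NCSeries σ}
    (h : ∀ i, Jac.mkₐ f s * Jac.mkₐ f (X i) = Jac.mkₐ f (X i) * Jac.mkₐ f s) (g : NCSeries σ) :
    Jac.mkₐ f s * Jac.mkₐ f g = Jac.mkₐ f g * Jac.mkₐ f s := by
  rw [← sub_eq_zero, ← map_mul, ← map_mul, ← map_sub]
  -- Polynomials are dense and the Jacobi ideal is closed, so commuting with all polynomials is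
  -- enough.
  refine Jac.mkₐ_eq_zero_of_agreeBelow fun N => ?_
  obtain ⟨p, hp, hgp⟩ := exists_polynomial_agreeBelow N g
  refine ⟨s * p - p * s, ?_, ((AgreeBelow.refl _ _).mul hgp).sub (hgp.mul (AgreeBelow.refl _ _))⟩
  rw [map_sub, map_mul, map_mul, sub_eq_zero]
  clear hgp
  induction hp using Algebra.adjoin_induction with
  | mem a ha => obtain ⟨i, rfl⟩ := ha; exact h i
  | algebraMap c => rw [AlgHom.commutes]; exact (Algebra.commutes c _).symm
  | add a b _ _ ha hb => rw [map_add, mul_add, add_mul, ha, hb]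
  | mul a b _ _ ha hb => rw [map_mul, ← mul_assoc, ha, mul_assoc, hb, mul_assoc]

end Jacobi

/-! ### Cyclic derivatives of the potentials -/

namespace NCSeries

variable {σ : Type}

theorem sym_monomial (u : List σ) :
    sym (monomial u) = ∑ j ∈ Finset.range u.length, monomial (u.rotate j) := by
  classical
  ext w
  rw [sum_coeff]
  simp only [sym, monomial]
  by_cases hL : w.length = u.length
  -- Rotating w by j gives u exactly when w is u rotated by u.length - j. The exponent is written
  -- u.length - 1 - j + 1 so that the sum can be reflected.
  · have e : ∀ j ∈ Finset.range w.length, (if w.rotate j = u then (1 : ℂ) else 0)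
        = if w = u.rotate (u.length - 1 - j + 1) then 1 else 0 := by
      intro j hj
      rw [Finset.mem_range] at hj
      refine if_congr ⟨?_, ?_⟩ rfl rfl
      · rintro rfl
        rw [List.rotate_rotate, List.length_rotate, show j + (w.length - 1 - j + 1) = w.length by omega,
          List.rotate_length]
      · rintro rfl
        rw [List.length_rotate] at hj
        rw [List.rotate_rotate, show u.length - 1 - j + 1 + j = u.length by omega,
          List.rotate_length]
    rw [Finset.sum_congr rfl e, hL,
      Finset.sum_range_reflect (fun j => if w = u.rotate (j + 1) then (1 : ℂ) else 0)]
    -- The rotations by 1, …, u.length and by 0, …, u.length - 1 have the same sum, as rotation by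
    -- u.length is the identity.
    have h1 := Finset.sum_range_succ (fun j => if w = u.rotate j then (1 : ℂ) else 0) u.length
    have h2 := Finset.sum_range_succ' (fun j => if w = u.rotate j then (1 : ℂ) else 0) u.length
    rw [List.rotate_length] at h1
    rw [List.rotate_zero] at h2
    exact add_right_cancel (h2.symm.trans h1)
  · rw [Finset.sum_eq_zero, Finset.sum_eq_zero]
    · intro j _
      rw [if_neg]
      rintro rfl
      exact hL (List.length_rotate _ _)
    · intro j _
      rw [if_neg]
      rintro rfl
      exact hL (List.length_rotate _ _).symm

theorem strike_sum {ι : Type} (s : Finset ι) (f : ι → NCSeries σ) (a : σ) :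
    strike a (∑ i ∈ s, f i) = ∑ i ∈ s, strike a (f i) := by
  ext w
  simp only [strike, sum_coeff]

theorem strike_monomial_cons (a b : σ) [Decidable (a = b)] (w : List σ) :
    strike a (monomial (b :: w)) = if a = b then monomial w else 0 := by
  rw [monomial_cons, strike_mul, X_nil, zero_smul, zero_add, strike_X]
  split_ifs
  · rw [one_mul]
  · rw [zero_mul]

theorem cyclicDeriv_add (i : σ) (f g : NCSeries σ) :
    cyclicDeriv i (f + g) = cyclicDeriv i f + cyclicDeriv i g := by
  ext w
  simp [cyclicDeriv, strike, sym, Finset.sum_add_distrib]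

theorem cyclicDeriv_zero (i : σ) : cyclicDeriv i (0 : NCSeries σ) = 0 := by
  ext w
  simp [cyclicDeriv, strike, sym]

theorem cyclicDeriv_sum {ι : Type} (i : σ) (s : Finset ι) (f : ι → NCSeries σ) :
    cyclicDeriv i (∑ j ∈ s, f j) = ∑ j ∈ s, cyclicDeriv i (f j) := by
  classical
  induction s using Finset.induction_on with
  | empty => simpa using cyclicDeriv_zero i
  | insert j s hj ih => rw [Finset.sum_insert hj, Finset.sum_insert hj, cyclicDeriv_add, ih]

theorem cyclicDeriv_monomial (i : σ) (u : List σ) :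
    cyclicDeriv i (monomial u)
      = ∑ j ∈ Finset.range u.length, strike i (monomial (u.rotate j)) := by
  rw [cyclicDeriv, sym_monomial, strike_sum]

theorem X_pow (a : σ) (n : ℕ) : (X a : NCSeries σ) ^ n = monomial (List.replicate n a) := by
  induction n with
  | zero => rfl
  | succ n ih => rw [List.replicate_succ, monomial_cons, pow_succ', ih]

theorem cyclicDeriv_X_pow_self (a : σ) (n : ℕ) :
    cyclicDeriv a (X a ^ n) = (n : ℂ) • X a ^ (n - 1) := by
  classical
  rw [X_pow, cyclicDeriv_monomial]
  cases n with
  | zero => simp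
  | succ n =>
    simp only [List.rotate_replicate, List.length_replicate, Finset.sum_const, Finset.card_range]
    rw [List.replicate_succ, strike_monomial_cons, if_pos rfl, X_pow, Nat.add_sub_cancel,
      Nat.cast_smul_eq_nsmul]

theorem cyclicDeriv_X_pow_of_ne {a b : σ} (h : a ≠ b) (n : ℕ) :
    cyclicDeriv a (X b ^ n) = 0 := by
  classical
  rw [X_pow, cyclicDeriv_monomial]
  refine Finset.sum_eq_zero fun j _ => ?_
  rw [List.rotate_replicate]
  cases n with
  | zero => rw [List.replicate_zero, monomial_nil, strike_one]
  | succ n => rw [List.replicate_succ, strike_monomial_cons, if_neg h]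

end NCSeries

/-- The variables are two more than the `zᵢ`. -/
def Var.equivOption (k : ℕ) : Var k ≃ Option (Option (Fin k)) where
  toFun
    | .z i => some (some i)
    | .x => some none
    | .y => none
  invFun
    | some (some i) => .z i
    | some none => .x
    | none => .y
  left_inv v := by cases v <;> rfl
  right_inv v := by rcases v with _ | _ | _ <;> rfl

instance (k : ℕ) : Fintype (Var k) := Fintype.ofEquiv _ (Var.equivOption k).symm

namespace NormalForm

open NCSeries

variable (k : ℕ)

theorem cyclicDeriv_zSquares_z (i : Fin k) :
    cyclicDeriv (.z i) (zSquares k) = (2 : ℂ) • X (.z i) := by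
  rw [zSquares, cyclicDeriv_sum, Finset.sum_eq_single i]
  · rw [cyclicDeriv_X_pow_self]; simp
  · intro j _ hj
    exact cyclicDeriv_X_pow_of_ne (by simpa using hj.symm) 2
  · simp

theorem cyclicDeriv_zSquares_x : cyclicDeriv .x (zSquares k) = 0 := by
  rw [zSquares, cyclicDeriv_sum]
  exact Finset.sum_eq_zero fun j _ => cyclicDeriv_X_pow_of_ne (by simp) 2

theorem cyclicDeriv_zSquares_y : cyclicDeriv .y (zSquares k) = 0 := by
  rw [zSquares, cyclicDeriv_sum]
  exact Finset.sum_eq_zero fun j _ => cyclicDeriv_X_pow_of_ne (by simp) 2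

theorem xyy_eq : x k * y k ^ 2 = monomial [.x, .y, .y] := by
  simp [monomial_cons, monomial_nil, x, y, pow_two]

theorem xyyy_eq : x k * y k ^ 3 = monomial [.x, .y, .y, .y] := by
  simp [monomial_cons, monomial_nil, x, y, pow_succ, mul_assoc]

theorem cyclicDeriv_xyy_z (i : Fin k) : cyclicDeriv (.z i) (x k * y k ^ 2) = 0 := by
  classical
  rw [xyy_eq, cyclicDeriv_monomial]
  simp [Finset.sum_range_succ, List.rotate, strike_monomial_cons]

theorem cyclicDeriv_xyy_x : cyclicDeriv .x (x k * y k ^ 2) = y k * y k := by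
  classical
  rw [xyy_eq, cyclicDeriv_monomial]
  simp [Finset.sum_range_succ, List.rotate, strike_monomial_cons]
  simp [monomial_cons, monomial_nil, y]

theorem cyclicDeriv_xyy_y : cyclicDeriv .y (x k * y k ^ 2) = y k * x k + x k * y k := by
  classical
  rw [xyy_eq, cyclicDeriv_monomial]
  simp [Finset.sum_range_succ, List.rotate, strike_monomial_cons]
  simp [monomial_cons, monomial_nil, x, y]

theorem cyclicDeriv_xyyy_z (i : Fin k) : cyclicDeriv (.z i) (x k * y k ^ 3) = 0 := by
  classical
  rw [xyyy_eq, cyclicDeriv_monomial]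
  simp [Finset.sum_range_succ, List.rotate, strike_monomial_cons]

theorem cyclicDeriv_xyyy_x : cyclicDeriv .x (x k * y k ^ 3) = y k * (y k * y k) := by
  classical
  rw [xyyy_eq, cyclicDeriv_monomial]
  simp [Finset.sum_range_succ, List.rotate, strike_monomial_cons]
  simp [monomial_cons, monomial_nil, y]

theorem cyclicDeriv_xyyy_y : cyclicDeriv .y (x k * y k ^ 3)
    = y k * (y k * x k) + y k * (x k * y k) + x k * (y k * y k) := by
  classical
  rw [xyyy_eq, cyclicDeriv_monomial]
  simp [Finset.sum_range_succ, List.rotate, strike_monomial_cons]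
  simp [monomial_cons, monomial_nil, x, y]

/-- A power of a variable with possibly infinite exponent, as in the potentials. -/
theorem cyclicDeriv_recTopCoe_self {σ : Type} (a : σ) (e : ℕ → ℕ) (n : ℕ∞) :
    cyclicDeriv a (ENat.recTopCoe 0 (fun n : ℕ => (X a : NCSeries σ) ^ e n) n)
      = ENat.recTopCoe 0 (fun n : ℕ => (e n : ℂ) • (X a : NCSeries σ) ^ (e n - 1)) n := by
  cases n with
  | top => simpa using cyclicDeriv_zero a
  | coe n => simpa using cyclicDeriv_X_pow_self a (e n)

theorem cyclicDeriv_recTopCoe_of_ne {σ : Type} {a b : σ} (h : a ≠ b) (e : ℕ → ℕ) (n : ℕ∞) :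
    cyclicDeriv a (ENat.recTopCoe 0 (fun n : ℕ => (X b : NCSeries σ) ^ e n) n) = 0 := by
  cases n with
  | top => simpa using cyclicDeriv_zero a
  | coe n => simpa using cyclicDeriv_X_pow_of_ne h (e n)

theorem cyclicDeriv_potA_z (n : ℕ∞) (i : Fin k) :
    cyclicDeriv (.z i) (potA k n) = (2 : ℂ) • X (.z i) := by
  rw [potA, cyclicDeriv_add, cyclicDeriv_add, cyclicDeriv_zSquares_z, x, y,
    cyclicDeriv_X_pow_of_ne (by simp), cyclicDeriv_recTopCoe_of_ne (by simp) fun n => n, add_zero,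
    add_zero]

theorem cyclicDeriv_potA_x (n : ℕ∞) : cyclicDeriv .x (potA k n) = (2 : ℂ) • x k := by
  rw [potA, cyclicDeriv_add, cyclicDeriv_add, cyclicDeriv_zSquares_x, x, y,
    cyclicDeriv_X_pow_self, cyclicDeriv_recTopCoe_of_ne (by simp) fun n => n, add_zero, zero_add]
  simp

theorem cyclicDeriv_potA_y (n : ℕ∞) : cyclicDeriv .y (potA k n)
    = ENat.recTopCoe 0 (fun n : ℕ => (n : ℂ) • y k ^ (n - 1)) n := by
  rw [potA, cyclicDeriv_add, cyclicDeriv_add, cyclicDeriv_zSquares_y, x, y,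
    cyclicDeriv_X_pow_of_ne (by simp), cyclicDeriv_recTopCoe_self _ fun n => n, zero_add, zero_add]

theorem cyclicDeriv_potD_z (n m : ℕ∞) (i : Fin k) :
    cyclicDeriv (.z i) (potD k n m) = (2 : ℂ) • X (.z i) := by
  rw [potD, cyclicDeriv_add, cyclicDeriv_add, cyclicDeriv_add, cyclicDeriv_zSquares_z,
    cyclicDeriv_xyy_z, x, cyclicDeriv_recTopCoe_of_ne (by simp) fun n => 2 * n,
    cyclicDeriv_recTopCoe_of_ne (by simp) fun n => 2 * n - 1, add_zero, add_zero, add_zero]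

theorem cyclicDeriv_potD_x (n m : ℕ∞) : cyclicDeriv .x (potD k n m) = y k * y k
    + ENat.recTopCoe 0 (fun n : ℕ => ((2 * n : ℕ) : ℂ) • x k ^ (2 * n - 1)) n
    + ENat.recTopCoe 0 (fun m : ℕ => ((2 * m - 1 : ℕ) : ℂ) • x k ^ (2 * m - 1 - 1)) m := by
  rw [potD, cyclicDeriv_add, cyclicDeriv_add, cyclicDeriv_add, cyclicDeriv_zSquares_x,
    cyclicDeriv_xyy_x, x, cyclicDeriv_recTopCoe_self _ fun n => 2 * n,
    cyclicDeriv_recTopCoe_self _ fun n => 2 * n - 1, zero_add]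

theorem cyclicDeriv_potD_y (n m : ℕ∞) :
    cyclicDeriv .y (potD k n m) = y k * x k + x k * y k := by
  rw [potD, cyclicDeriv_add, cyclicDeriv_add, cyclicDeriv_add, cyclicDeriv_zSquares_y,
    cyclicDeriv_xyy_y, x, cyclicDeriv_recTopCoe_of_ne (by simp) fun n => 2 * n,
    cyclicDeriv_recTopCoe_of_ne (by simp) fun n => 2 * n - 1, add_zero, add_zero, zero_add]

theorem cyclicDeriv_potE_z (n : ℕ∞) (i : Fin k) :
    cyclicDeriv (.z i) (potE k n) = (2 : ℂ) • X (.z i) := by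
  rw [potE, cyclicDeriv_add, cyclicDeriv_add, cyclicDeriv_add, cyclicDeriv_zSquares_z,
    cyclicDeriv_xyyy_z, x, y, cyclicDeriv_X_pow_of_ne (by simp),
    cyclicDeriv_recTopCoe_of_ne (by simp) fun n => n, add_zero, add_zero, add_zero]

theorem cyclicDeriv_potE_x (n : ℕ∞) :
    cyclicDeriv .x (potE k n) = (3 : ℂ) • (x k * x k) + y k * (y k * y k) := by
  rw [potE, cyclicDeriv_add, cyclicDeriv_add, cyclicDeriv_add, cyclicDeriv_zSquares_x,
    cyclicDeriv_xyyy_x, x, y, cyclicDeriv_X_pow_self,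
    cyclicDeriv_recTopCoe_of_ne (by simp) fun n => n, add_zero, zero_add]
  simp [pow_two]

theorem cyclicDeriv_potE_y (n : ℕ∞) : cyclicDeriv .y (potE k n)
    = y k * (y k * x k) + y k * (x k * y k) + x k * (y k * y k)
      + ENat.recTopCoe 0 (fun n : ℕ => (n : ℂ) • y k ^ (n - 1)) n := by
  rw [potE, cyclicDeriv_add, cyclicDeriv_add, cyclicDeriv_add, cyclicDeriv_zSquares_y,
    cyclicDeriv_xyyy_y, x, y, cyclicDeriv_X_pow_of_ne (by simp),
    cyclicDeriv_recTopCoe_self _ fun n => n, zero_add, zero_add]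

end NormalForm

/-! ### Preprojective algebras -/

namespace MarkedQuiver

variable (Q : MarkedQuiver)

/-- The trivial path at `v`. -/
noncomputable def vtx (v : Q.Vertex) : Q.Preprojective :=
  RingQuot.mkAlgHom ℂ Q.Rel (FreeAlgebra.ι ℂ (.vertex v))

/-- An arrow as an element of the preprojective algebra. -/
noncomputable def arr (a : Q.Arrow) : Q.Preprojective :=
  RingQuot.mkAlgHom ℂ Q.Rel (FreeAlgebra.ι ℂ (.arrow a))

/-- A reversed arrow as an element of the preprojective algebra. -/
noncomputable def dualArr (a : Q.Arrow) : Q.Preprojective :=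
  RingQuot.mkAlgHom ℂ Q.Rel (FreeAlgebra.ι ℂ (.dual a))

theorem vtx_mul_vtx (v w : Q.Vertex) : Q.vtx v * Q.vtx w = if v = w then Q.vtx v else 0 := by
  split_ifs with h
  · subst h
    simpa [vtx] using RingQuot.mkAlgHom_rel ℂ (Rel.vertex_mul_self v)
  · simpa [vtx] using RingQuot.mkAlgHom_rel ℂ (Rel.vertex_mul_vertex v w h)

theorem arr_mul_source (a : Q.Arrow) : Q.arr a * Q.vtx (Q.source a) = Q.arr a := by
  simpa [arr, vtx] using RingQuot.mkAlgHom_rel ℂ (Rel.arrow_mul_source a)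

theorem target_mul_arr (a : Q.Arrow) : Q.vtx (Q.target a) * Q.arr a = Q.arr a := by
  simpa [arr, vtx] using RingQuot.mkAlgHom_rel ℂ (Rel.target_mul_arrow a)

theorem dualArr_mul_target (a : Q.Arrow) : Q.dualArr a * Q.vtx (Q.target a) = Q.dualArr a := by
  simpa [dualArr, vtx] using RingQuot.mkAlgHom_rel ℂ (Rel.dual_mul_target a)

theorem source_mul_dualArr (a : Q.Arrow) : Q.vtx (Q.source a) * Q.dualArr a = Q.dualArr a := by
  simpa [dualArr, vtx] using RingQuot.mkAlgHom_rel ℂ (Rel.source_mul_dual a)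

theorem sum_arr_mul_dualArr :
    ∑ a, (Q.arr a * Q.dualArr a - Q.dualArr a * Q.arr a) = 0 := by
  simpa [arr, dualArr] using RingQuot.mkAlgHom_rel ℂ (Rel.preprojective (Q := Q))

theorem vtx_mul_arr (v : Q.Vertex) (a : Q.Arrow) :
    Q.vtx v * Q.arr a = if v = Q.target a then Q.arr a else 0 := by
  rw [← target_mul_arr, ← mul_assoc, vtx_mul_vtx]
  split_ifs with h
  · rw [h]
  · rw [zero_mul]

theorem vtx_mul_dualArr (v : Q.Vertex) (a : Q.Arrow) :
    Q.vtx v * Q.dualArr a = if v = Q.source a then Q.dualArr a else 0 := by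
  rw [← source_mul_dualArr, ← mul_assoc, vtx_mul_vtx]
  split_ifs with h
  · rw [h]
  · rw [zero_mul]

/-- The preprojective relation at a vertex. -/
theorem preprojective_vtx (v : Q.Vertex) :
    ∑ a, ((if v = Q.target a then Q.arr a * Q.dualArr a else 0)
      - (if v = Q.source a then Q.dualArr a * Q.arr a else 0)) = 0 := by
  have h := congrArg (Q.vtx v * ·) Q.sum_arr_mul_dualArr
  simp only [mul_zero, Finset.mul_sum, mul_sub, ← mul_assoc, vtx_mul_arr, vtx_mul_dualArr, ite_mul,
    zero_mul] at h
  exact h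

/-- Subspaces attached to the vertices and stable under arrows and reversed arrows form a submodule
over Π. This serves to bound Πe from above by guessing such a family. -/
theorem vtx_mul_mem (K : Q.Vertex → Submodule ℂ Q.Preprojective)
    (harr : ∀ a, ∀ m ∈ K (Q.source a), Q.arr a * m ∈ K (Q.target a))
    (hdual : ∀ a, ∀ m ∈ K (Q.target a), Q.dualArr a * m ∈ K (Q.source a))
    (t : FreeAlgebra ℂ Q.Gen) (n : Q.Preprojective) (hn : ∀ v, Q.vtx v * n ∈ K v) (v : Q.Vertex) :
    Q.vtx v * (RingQuot.mkAlgHom ℂ Q.Rel t * n) ∈ K v := by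
  induction t using FreeAlgebra.induction generalizing n v with
  | grade0 c =>
    rw [AlgHom.commutes, ← Algebra.smul_def, mul_smul_comm]
    exact (K v).smul_mem _ (hn v)
  | grade1 g =>
    rw [← mul_assoc]
    cases g with
    | vertex w =>
      change Q.vtx v * Q.vtx w * n ∈ K v
      rw [vtx_mul_vtx]
      split_ifs
      · exact hn v
      · rw [zero_mul]; exact zero_mem _
    | arrow a =>
      change Q.vtx v * Q.arr a * n ∈ K v
      rw [vtx_mul_arr]
      split_ifs with h
      · rw [h, ← arr_mul_source, mul_assoc]; exact harr a _ (hn _)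
      · rw [zero_mul]; exact zero_mem _
    | dual a =>
      change Q.vtx v * Q.dualArr a * n ∈ K v
      rw [vtx_mul_dualArr]
      split_ifs with h
      · rw [h, ← dualArr_mul_target, mul_assoc]; exact hdual a _ (hn _)
      · rw [zero_mul]; exact zero_mem _
  | mul s t hs ht =>
    rw [map_mul, mul_assoc]
    exact hs _ (fun v => ht n hn v) v
  | add s t hs ht =>
    rw [map_add, add_mul, mul_add]
    exact add_mem (hs n hn v) (ht n hn v)

theorem contracted_mem (K : Q.Vertex → Submodule ℂ Q.Preprojective) (he : Q.idem ∈ K Q.marked)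
    (harr : ∀ a, ∀ m ∈ K (Q.source a), Q.arr a * m ∈ K (Q.target a))
    (hdual : ∀ a, ∀ m ∈ K (Q.target a), Q.dualArr a * m ∈ K (Q.source a)) (c : Q.Contracted) :
    c.1 ∈ K Q.marked := by
  obtain ⟨h1, h2⟩ := (Subsemigroup.mem_corner_iff Q.isIdempotentElem_idem).mp c.2
  obtain ⟨t, ht⟩ := RingQuot.mkAlgHom_surjective ℂ Q.Rel c.1
  have := Q.vtx_mul_mem K harr hdual t Q.idem (fun v => ?_) Q.marked
  · rw [ht, h2] at this
    exact h1 ▸ this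
  · change Q.vtx v * Q.vtx Q.marked ∈ K v
    rw [vtx_mul_vtx]
    split_ifs with h
    · rw [h]; exact he
    · exact zero_mem _

/-- The inclusion of the contracted algebra. -/
noncomputable def contractedVal : Q.Contracted →ₗ[ℂ] Q.Preprojective where
  toFun c := c.1
  map_add' _ _ := rfl
  map_smul' _ _ := rfl

/-- The cycle `a a*` at the marked vertex. -/
noncomputable def loop {a : Q.Arrow} (h : Q.marked = Q.target a) : Q.Contracted :=
  ⟨Q.arr a * Q.dualArr a, (Subsemigroup.mem_corner_iff Q.isIdempotentElem_idem).mpr <| by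
    change Q.vtx Q.marked * _ = _ ∧ _ * Q.vtx Q.marked = _
    rw [h, ← mul_assoc, target_mul_arr, mul_assoc, dualArr_mul_target]
    exact ⟨rfl, rfl⟩⟩

theorem loop_val {a : Q.Arrow} (h : Q.marked = Q.target a) :
    (Q.loop h).1 = Q.arr a * Q.dualArr a := rfl

theorem contracted_mul_val (c d : Q.Contracted) : (c * d).1 = c.1 * d.1 := rfl

theorem contracted_one_val : (1 : Q.Contracted).1 = Q.idem := rfl

/-! ### Representations of the preprojective algebra by inclusions and left multiplications. -/

section Representation

variable {Q}
variable {S : Type} [Ring S] [Algebra ℂ S] {N : Q.Vertex → Submodule ℂ S} {W : Q.Arrow → S}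
  (hA : ∀ a, N (Q.source a) ≤ N (Q.target a)) (hB : ∀ a, ∀ m ∈ N (Q.target a), W a * m ∈ N (Q.source a))

/-- The operators on `⨁ N v` by which the generators of the path algebra act. -/
noncomputable def genAction : Q.Gen → Module.End ℂ (∀ v, N v)
  | .vertex v => LinearMap.single ℂ (fun v => N v) v ∘ₗ LinearMap.proj v
  | .arrow a => LinearMap.single ℂ (fun v => N v) (Q.target a) ∘ₗ
      Submodule.inclusion (hA a) ∘ₗ LinearMap.proj (Q.source a)
  | .dual a => LinearMap.single ℂ (fun v => N v) (Q.source a) ∘ₗ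
      (LinearMap.mulLeft ℂ (W a)).restrict (hB a) ∘ₗ LinearMap.proj (Q.target a)

theorem coe_single_apply (v w : Q.Vertex) (m : N v) :
    ((Pi.single v m : ∀ v, N v) w : S) = if w = v then (m : S) else 0 := by
  split_ifs with h
  · subst h; rw [Pi.single_eq_same]
  · rw [Pi.single_eq_of_ne h, Submodule.coe_zero]

theorem genAction_vertex_apply (v w : Q.Vertex) (f : ∀ v, N v) :
    (genAction hA hB (.vertex v) f w : S) = if w = v then (f v : S) else 0 :=
  coe_single_apply v w _

theorem genAction_arrow_apply (a : Q.Arrow) (w : Q.Vertex) (f : ∀ v, N v) :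
    (genAction hA hB (.arrow a) f w : S) = if w = Q.target a then (f (Q.source a) : S) else 0 :=
  coe_single_apply _ w _

theorem genAction_dual_apply (a : Q.Arrow) (w : Q.Vertex) (f : ∀ v, N v) :
    (genAction hA hB (.dual a) f w : S)
      = if w = Q.source a then W a * (f (Q.target a) : S) else 0 :=
  coe_single_apply _ w _

variable (hW : ∀ v, ∀ m ∈ N v, ∑ a, ((if v = Q.target a then W a * m else 0)
    - (if v = Q.source a then W a * m else 0)) = 0)

/-- The representation of the preprojective algebra in which the arrows are inclusions of
subspaces of an algebra and the reversed arrows are left multiplications. -/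
noncomputable def rep : Q.Preprojective →ₐ[ℂ] Module.End ℂ (∀ v, N v) :=
  RingQuot.liftAlgHom ℂ ⟨FreeAlgebra.lift ℂ (genAction hA hB), fun s t hst => by
    refine LinearMap.ext fun f => funext fun w => Subtype.ext ?_
    cases hst <;>
      simp only [map_mul, map_sum, map_sub, map_zero, map_one, FreeAlgebra.lift_ι_apply,
        Module.End.mul_apply, LinearMap.sum_apply, LinearMap.sub_apply, Finset.sum_apply,
        Pi.sub_apply, AddSubgroupClass.coe_sub, AddSubmonoidClass.coe_finsetSum,
        genAction_vertex_apply, genAction_arrow_apply, genAction_dual_apply, if_true,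
        LinearMap.zero_apply, Pi.zero_apply, Submodule.coe_zero, Module.End.one_apply]
    case vertex_mul_vertex v v' h => simp [h]
    case sum_vertex => simp
    case preprojective =>
      refine Eq.trans ?_ (hW w (f w) (f w).2)
      refine Finset.sum_congr rfl fun a _ => ?_
      congr 1
      · split_ifs with h
        · rw [← h]
        · rfl
      · split_ifs with h
        · rw [← h]
        · rfl⟩

theorem rep_vtx (v : Q.Vertex) : rep hA hB hW (Q.vtx v) = genAction hA hB (.vertex v) := by
  simp [rep, vtx]

theorem rep_arr (a : Q.Arrow) : rep hA hB hW (Q.arr a) = genAction hA hB (.arrow a) := by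
  simp [rep, arr]

theorem rep_dualArr (a : Q.Arrow) : rep hA hB hW (Q.dualArr a) = genAction hA hB (.dual a) := by
  simp [rep, dualArr]

/-- Homomorphisms from a contracted preprojective algebra that is generated by the cycles `a a*`
at the marked vertex. -/
theorem exists_contracted_lift (hA : ∀ a, N (Q.source a) ≤ N (Q.target a))
    (hB : ∀ a, ∀ m ∈ N (Q.target a), W a * m ∈ N (Q.source a))
    (hW : ∀ v, ∀ m ∈ N v, ∑ a, ((if v = Q.target a then W a * m else 0)
      - (if v = Q.source a then W a * m else 0)) = 0)
    (hN : N Q.marked = ⊤)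
    (hg : Algebra.adjoin ℂ {c : Q.Contracted | ∃ a, ∃ h : Q.marked = Q.target a, c = Q.loop h} = ⊤) :
    ∃ φ : Q.Contracted →ₐ[ℂ] S, ∀ a, ∀ h : Q.marked = Q.target a, φ (Q.loop h) = W a := by
  have hN' : ∀ s : S, s ∈ N Q.marked := fun s => hN ▸ Submodule.mem_top
  -- The map ι places `S` in the component of the marked vertex.
  obtain ⟨ι, hι⟩ : ∃ ι : S → ∀ v, N v, ∀ s, ι s = Pi.single Q.marked ⟨s, hN' s⟩ := ⟨_, fun _ => rfl⟩
  have hι_coe : ∀ s w, (ι s w : S) = if w = Q.marked then s else 0 := fun s w => by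
    rw [hι, coe_single_apply]
  have hι_add : ∀ s t, ι (s + t) = ι s + ι t := fun s t => by
    funext w; apply Subtype.ext; simp only [Pi.add_apply, Submodule.coe_add, hι_coe]
    split_ifs <;> simp
  have hι_smul : ∀ (c : ℂ) s, ι (c • s) = c • ι s := fun c s => by
    funext w; apply Subtype.ext; simp only [Pi.smul_apply, Submodule.coe_smul, hι_coe]
    split_ifs <;> simp
  have hι_inj : ∀ s t, ι s = ι t → s = t := fun s t h => by
    have := congrArg Subtype.val (congrFun h Q.marked)
    simpa [hι_coe] using this
  have he : ∀ s, rep hA hB hW Q.idem (ι s) = ι s := fun s => by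
    change rep hA hB hW (Q.vtx Q.marked) (ι s) = ι s
    rw [rep_vtx]
    funext w; apply Subtype.ext
    rw [genAction_vertex_apply, hι_coe, hι_coe, if_pos rfl]
  have hl : ∀ a, ∀ h : Q.marked = Q.target a, ∀ m,
      rep hA hB hW (Q.loop h).1 (ι m) = ι (W a * m) := fun a h m => by
    rw [loop_val, map_mul, rep_arr, rep_dualArr]
    funext w; apply Subtype.ext
    rw [Module.End.mul_apply, genAction_arrow_apply, genAction_dual_apply, if_pos rfl, hι_coe,
      hι_coe, if_pos h.symm, h]
  -- Every element of the contracted algebra acts on this copy of `S` as left multiplication by some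
  -- s: this holds for the loops, and they generate. Since s is recovered by acting on 1, sending c
  -- to s is a homomorphism.
  have key : ∀ c : Q.Contracted, ∃ s, ∀ m, rep hA hB hW c.1 (ι m) = ι (s * m) := fun c => by
    have hc : c ∈ Algebra.adjoin ℂ
      {c : Q.Contracted | ∃ a, ∃ h : Q.marked = Q.target a, c = Q.loop h} := hg ▸ Algebra.mem_top
    induction hc using Algebra.adjoin_induction with
    | mem c hc => obtain ⟨a, h, rfl⟩ := hc; exact ⟨W a, hl a h⟩
    | algebraMap c =>
      refine ⟨algebraMap ℂ S c, fun m => ?_⟩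
      change rep hA hB hW (c • Q.idem) (ι m) = _
      rw [map_smul, LinearMap.smul_apply, he, ← hι_smul, Algebra.smul_def]
    | add c d _ _ hc hd =>
      obtain ⟨s, hs⟩ := hc
      obtain ⟨t, ht⟩ := hd
      refine ⟨s + t, fun m => ?_⟩
      change rep hA hB hW (c.1 + d.1) (ι m) = _
      rw [map_add, LinearMap.add_apply, hs, ht, ← hι_add, add_mul]
    | mul c d _ _ hc hd =>
      obtain ⟨s, hs⟩ := hc
      obtain ⟨t, ht⟩ := hd
      refine ⟨s * t, fun m => ?_⟩
      rw [contracted_mul_val, map_mul, Module.End.mul_apply, ht, hs, mul_assoc]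
  choose φ hφ using key
  have huniq : ∀ c s, (rep hA hB hW c.1 (ι 1) = ι s) → φ c = s := fun c s h => by
    rw [hφ, mul_one] at h
    exact hι_inj _ _ h
  refine ⟨AlgHom.ofLinearMap
    { toFun := φ, map_add' := fun c d => huniq _ _ ?_, map_smul' := fun r c => huniq _ _ ?_ }
    (huniq _ _ ?_) fun c d => huniq _ _ ?_, fun a h => huniq _ _ ?_⟩
  · change rep hA hB hW (c.1 + d.1) (ι 1) = _
    rw [map_add, LinearMap.add_apply, hφ, hφ, ← hι_add, mul_one, mul_one]
  · change rep hA hB hW (r • c.1) (ι 1) = _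
    rw [map_smul, LinearMap.smul_apply, hφ, mul_one, ← hι_smul, RingHom.id_apply]
  · rw [contracted_one_val, he]
  · rw [contracted_mul_val, map_mul, Module.End.mul_apply, hφ, hφ, mul_one]
    rfl
  · rw [hl, mul_one]

end Representation

end MarkedQuiver

/-! ### The contracted preprojective algebras of types `A₁`, `D₄` and `E₆` -/

namespace MarkedQuiver

theorem adjoin_eq_top_of_mem {Q : MarkedQuiver} (C : Subalgebra ℂ Q.Contracted)
    (h : ∀ c : Q.Contracted, c.1 ∈ C.toSubmodule.map Q.contractedVal) : C = ⊤ := by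
  rw [eq_top_iff]
  intro c _
  obtain ⟨d, hd, hdc⟩ := h c
  have : d = c := Subtype.ext hdc
  exact this ▸ hd

theorem contracted_zero_val (Q : MarkedQuiver) : (0 : Q.Contracted).1 = 0 := rfl

theorem contracted_add_val (Q : MarkedQuiver) (c d : Q.Contracted) : (c + d).1 = c.1 + d.1 := rfl

theorem idem_mem (Q : MarkedQuiver) (C : Subalgebra ℂ Q.Contracted) :
    Q.idem ∈ C.toSubmodule.map Q.contractedVal := ⟨1, one_mem C, rfl⟩

theorem A₁_adjoin : Algebra.adjoin ℂ
    {c : A₁.Contracted | ∃ a, ∃ h : A₁.marked = A₁.target a, c = A₁.loop h} = ⊤ := by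
  refine adjoin_eq_top_of_mem _ fun c => ?_
  exact A₁.contracted_mem (fun _ => _) (A₁.idem_mem _) (fun a => Fin.elim0 a)
    (fun a => Fin.elim0 a) c

theorem A₁_adjoin_empty : Algebra.adjoin ℂ (∅ : Set A₁.Contracted) = ⊤ := by
  rw [← A₁_adjoin]
  congr 1
  ext c
  simp only [Set.mem_empty_iff_false, Set.mem_ofPred_eq, false_iff]
  rintro ⟨a, _⟩
  exact Fin.elim0 a

theorem A₁_exists_lift (S : Type) [Ring S] [Algebra ℂ S] :
    Nonempty (A₁.Contracted →ₐ[ℂ] S) := by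
  obtain ⟨φ, _⟩ := exists_contracted_lift (Q := A₁) (S := S) (N := fun _ => ⊤) (W := fun _ => 0)
    (fun _ => le_rfl) (fun _ _ _ => Submodule.mem_top) (fun v m _ => by simp) rfl A₁_adjoin
  exact ⟨φ⟩

theorem mulLeft_mem_map {A : Type} [Ring A] [Algebra ℂ A] (K : Submodule ℂ A) (d : A) {m : A}
    (hm : m ∈ K) : d * m ∈ K.map (LinearMap.mulLeft ℂ d) := ⟨m, hm, rfl⟩

theorem loop_mul_mem {Q : MarkedQuiver} {a : Q.Arrow} (h : Q.marked = Q.target a) {m : Q.Preprojective}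
    (hm : m ∈ (Algebra.adjoin ℂ {c : Q.Contracted | ∃ a, ∃ h : Q.marked = Q.target a,
      c = Q.loop h}).toSubmodule.map Q.contractedVal) :
    Q.arr a * (Q.dualArr a * m) ∈ (Algebra.adjoin ℂ {c : Q.Contracted | ∃ a,
      ∃ h : Q.marked = Q.target a, c = Q.loop h}).toSubmodule.map Q.contractedVal := by
  obtain ⟨c, hc, rfl⟩ := hm
  refine ⟨Q.loop h * c, Subalgebra.mul_mem _ (Algebra.subset_adjoin ⟨a, h, rfl⟩) hc, ?_⟩
  rw [← mul_assoc]
  rfl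

section D₄

/-- Paths from the marked vertex to a leaf are a* times elements at the centre; returning along a
produces the loop a a*. -/
theorem D₄_adjoin : Algebra.adjoin ℂ
    {c : D₄.Contracted | ∃ a, ∃ h : D₄.marked = D₄.target a, c = D₄.loop h} = ⊤ := by
  refine adjoin_eq_top_of_mem _ fun c => ?_
  set K₀ := (Algebra.adjoin ℂ {c : D₄.Contracted | ∃ a, ∃ h : D₄.marked = D₄.target a,
    c = D₄.loop h}).toSubmodule.map D₄.contractedVal with hK
  let K : Fin 4 → Submodule ℂ D₄.Preprojective := ![K₀,
    K₀.map (LinearMap.mulLeft ℂ (D₄.dualArr (0 : Fin 3))),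
    K₀.map (LinearMap.mulLeft ℂ (D₄.dualArr (1 : Fin 3))),
    K₀.map (LinearMap.mulLeft ℂ (D₄.dualArr (2 : Fin 3)))]
  refine D₄.contracted_mem K (D₄.idem_mem _) (fun (a : Fin 3) => ?_) (fun (a : Fin 3) => ?_) c
  · fin_cases a
    all_goals
      rintro _ ⟨m, hm, rfl⟩
      exact loop_mul_mem rfl hm
  · fin_cases a
    all_goals
      intro m hm
      exact mulLeft_mem_map K₀ _ hm

theorem D₄_relation (v : Fin 4) :
    ((if v = 0 then D₄.arr (0 : Fin 3) * D₄.dualArr (0 : Fin 3) else 0)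
        - (if v = 1 then D₄.dualArr (0 : Fin 3) * D₄.arr (0 : Fin 3) else 0))
      + ((if v = 0 then D₄.arr (1 : Fin 3) * D₄.dualArr (1 : Fin 3) else 0)
        - (if v = 2 then D₄.dualArr (1 : Fin 3) * D₄.arr (1 : Fin 3) else 0))
      + ((if v = 0 then D₄.arr (2 : Fin 3) * D₄.dualArr (2 : Fin 3) else 0)
        - (if v = 3 then D₄.dualArr (2 : Fin 3) * D₄.arr (2 : Fin 3) else 0)) = 0 :=
  (Fin.sum_univ_three _).symm.trans (D₄.preprojective_vtx v)

theorem loop_mul_self {Q : MarkedQuiver} {a : Q.Arrow} (h : Q.marked = Q.target a)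
    (ha : Q.dualArr a * Q.arr a = 0) : Q.loop h * Q.loop h = 0 := by
  apply Subtype.ext
  rw [contracted_mul_val, loop_val, contracted_zero_val, mul_assoc, ← mul_assoc (Q.dualArr a), ha,
    zero_mul, mul_zero]

theorem mul_add_mul_eq_zero {S : Type} [Ring S] {a b c : S} (ha : a * a = 0) (hb : b * b = 0)
    (hc : c * c = 0) (h : a + b + c = 0) : a * b + b * a = 0 := by
  rw [add_eq_zero_iff_eq_neg'.mp h, neg_mul_neg, add_mul, mul_add, mul_add, ha, hb] at hc
  simpa using hc

theorem adjoin_eq_top_of_sum_eq_zero {S : Type} [Ring S] [Algebra ℂ S] {l : Fin 3 → S}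
    (h : l 0 + l 1 + l 2 = 0) (hl : Algebra.adjoin ℂ (Set.range l) = ⊤) :
    Algebra.adjoin ℂ {l 0, l 1} = ⊤ := by
  rw [eq_top_iff, ← hl]
  refine Algebra.adjoin_le ?_
  rintro _ ⟨a, rfl⟩
  fin_cases a
  · exact left_mem_adjoin_pair _ _
  · exact right_mem_adjoin_pair _ _
  · change l 2 ∈ Algebra.adjoin ℂ {l 0, l 1}
    rw [add_eq_zero_iff_eq_neg'.mp h]
    exact neg_mem (add_mem (left_mem_adjoin_pair _ _) (right_mem_adjoin_pair _ _))

/-- The contracted preprojective algebra of type `D₄` is generated by `p`, `q` subject to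
`p² = q² = (p + q)² = 0`. -/
theorem D₄_presentation : ∃ p q : D₄.Contracted, p * p = 0 ∧ q * q = 0 ∧ p * q + q * p = 0 ∧
    Algebra.adjoin ℂ {p, q} = ⊤ ∧ ∀ (S : Type) [Ring S] [Algebra ℂ S] (P R : S), P * P = 0 →
      R * R = 0 → P * R + R * P = 0 → ∃ φ : D₄.Contracted →ₐ[ℂ] S, φ p = P ∧ φ q = R := by
  obtain ⟨l, hl⟩ : ∃ l : Fin 3 → D₄.Contracted, ∀ a : Fin 3, ∃ h, l a = D₄.loop (a := a) h := by
    refine ⟨![D₄.loop (a := (0 : Fin 3)) rfl, D₄.loop (a := (1 : Fin 3)) rfl,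
      D₄.loop (a := (2 : Fin 3)) rfl], fun a => ?_⟩
    fin_cases a <;> exact ⟨rfl, rfl⟩
  have h0 : D₄.dualArr (0 : Fin 3) * D₄.arr (0 : Fin 3) = 0 := by simpa using D₄_relation 1
  have h1 : D₄.dualArr (1 : Fin 3) * D₄.arr (1 : Fin 3) = 0 := by simpa using D₄_relation 2
  have h2 : D₄.dualArr (2 : Fin 3) * D₄.arr (2 : Fin 3) = 0 := by simpa using D₄_relation 3
  have hv (a : Fin 3) : (l a).1 = D₄.arr a * D₄.dualArr a := by
    obtain ⟨h, e⟩ := hl a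
    rw [e]
    rfl
  have hs (a : Fin 3) (ha : D₄.dualArr a * D₄.arr a = 0) : l a * l a = 0 := by
    obtain ⟨h, e⟩ := hl a
    rw [e, loop_mul_self h ha]
  have hsum : l 0 + l 1 + l 2 = 0 := by
    apply Subtype.ext
    rw [contracted_add_val, contracted_add_val, hv, hv, hv, contracted_zero_val]
    simpa using D₄_relation 0
  refine ⟨l 0, l 1, hs 0 h0, hs 1 h1, mul_add_mul_eq_zero (S := D₄.Contracted) (hs 0 h0) (hs 1 h1) (hs 2 h2) hsum,
    ?_, ?_⟩
  · refine adjoin_eq_top_of_sum_eq_zero (S := D₄.Contracted) (l := l) hsum ?_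
    rw [eq_top_iff, ← D₄_adjoin]
    refine Algebra.adjoin_mono ?_
    rintro _ ⟨a, h, rfl⟩
    obtain ⟨h', e⟩ := hl a
    exact ⟨a, e⟩
  · intro S _ _ P R hP hR hPR
    have hPR' : (-(P + R)) * (-(P + R)) = 0 := by
      rw [neg_mul_neg, add_mul, mul_add, mul_add, hP, hR, zero_add, add_zero, hPR]
    -- Each leaf carries the image of its loop, which the loop kills because its square is zero;
    -- this is the preprojective relation at the leaf.
    obtain ⟨N, hN⟩ : ∃ N : Fin 4 → Submodule ℂ S, N = ![⊤, LinearMap.range (LinearMap.mulLeft ℂ P),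
      LinearMap.range (LinearMap.mulLeft ℂ R), LinearMap.range (LinearMap.mulLeft ℂ (-(P + R)))] :=
      ⟨_, rfl⟩
    obtain ⟨W, hW⟩ : ∃ W : Fin 3 → S, W = ![P, R, -(P + R)] := ⟨_, rfl⟩
    have hkill {a m : S} (ha : a * a = 0) (hm : m ∈ LinearMap.range (LinearMap.mulLeft ℂ a)) :
        a * m = 0 := by
      obtain ⟨n, rfl⟩ := hm
      rw [LinearMap.mulLeft_apply, ← mul_assoc, ha, zero_mul]
    obtain ⟨φ, hφ⟩ := exists_contracted_lift (Q := D₄) (S := S) (N := N) (W := W)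
      (fun (a : Fin 3) => by subst hN; fin_cases a <;> exact le_top)
      (fun (a : Fin 3) m _ => by subst hN hW; fin_cases a <;> exact ⟨m, rfl⟩)
      (fun (v : Fin 4) m hm => (Fin.sum_univ_three _).trans <| by
        change ((if v = 0 then W 0 * m else 0) - (if v = 1 then W 0 * m else 0))
          + ((if v = 0 then W 1 * m else 0) - (if v = 2 then W 1 * m else 0))
          + ((if v = 0 then W 2 * m else 0) - (if v = 3 then W 2 * m else 0)) = 0
        subst hN hW
        fin_cases v
        · simp [add_mul]
        · simpa using hkill hP hm
        · simpa using hkill hR hm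
        · simpa using hkill hPR' hm)
      (by subst hN; rfl) D₄_adjoin
    refine ⟨φ, ?_, ?_⟩
    · obtain ⟨h, e⟩ := hl 0
      rw [e, hφ (0 : Fin 3) h, hW]
      rfl
    · obtain ⟨h, e⟩ := hl 1
      rw [e, hφ (1 : Fin 3) h, hW]
      rfl

end D₄

end MarkedQuiver

namespace MarkedQuiver

section E₆

theorem E₆_relation (v : Fin 6) :
    ((if v = 0 then E₆.arr (0 : Fin 5) * E₆.dualArr (0 : Fin 5) else 0)
        - (if v = 1 then E₆.dualArr (0 : Fin 5) * E₆.arr (0 : Fin 5) else 0))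
      + ((if v = 0 then E₆.arr (1 : Fin 5) * E₆.dualArr (1 : Fin 5) else 0)
        - (if v = 2 then E₆.dualArr (1 : Fin 5) * E₆.arr (1 : Fin 5) else 0))
      + ((if v = 2 then E₆.arr (2 : Fin 5) * E₆.dualArr (2 : Fin 5) else 0)
        - (if v = 3 then E₆.dualArr (2 : Fin 5) * E₆.arr (2 : Fin 5) else 0))
      + ((if v = 0 then E₆.arr (3 : Fin 5) * E₆.dualArr (3 : Fin 5) else 0)
        - (if v = 4 then E₆.dualArr (3 : Fin 5) * E₆.arr (3 : Fin 5) else 0))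
      + ((if v = 4 then E₆.arr (4 : Fin 5) * E₆.dualArr (4 : Fin 5) else 0)
        - (if v = 5 then E₆.dualArr (4 : Fin 5) * E₆.arr (4 : Fin 5) else 0)) = 0 :=
  (Fin.sum_univ_five _).symm.trans (E₆.preprojective_vtx v)

theorem E₆_relation_two : E₆.arr (2 : Fin 5) * E₆.dualArr (2 : Fin 5)
      = E₆.dualArr (1 : Fin 5) * E₆.arr (1 : Fin 5) := by
  have := E₆_relation 2
  simp only [show (2 : Fin 6) = 0 ↔ False by decide, show (2 : Fin 6) = 1 ↔ False by decide,
    show (2 : Fin 6) = 3 ↔ False by decide, show (2 : Fin 6) = 4 ↔ False by decide,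
    show (2 : Fin 6) = 5 ↔ False by decide, if_true, if_false, sub_zero, zero_add, zero_sub,
    add_zero] at this
  exact (neg_add_eq_zero.mp this).symm

theorem E₆_relation_four : E₆.arr (4 : Fin 5) * E₆.dualArr (4 : Fin 5)
      = E₆.dualArr (3 : Fin 5) * E₆.arr (3 : Fin 5) := by
  have := E₆_relation 4
  simp only [show (4 : Fin 6) = 0 ↔ False by decide, show (4 : Fin 6) = 1 ↔ False by decide,
    show (4 : Fin 6) = 3 ↔ False by decide, show (4 : Fin 6) = 2 ↔ False by decide,
    show (4 : Fin 6) = 5 ↔ False by decide, if_true, if_false, sub_zero, zero_add, zero_sub,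
    add_zero] at this
  exact (neg_add_eq_zero.mp this).symm

/-- As for D₄, except for the tips of the long arms: returning from a tip gives b b* a* m, which the
preprojective relation b b* = a* a turns into a* times a loop times m. -/
theorem E₆_adjoin : Algebra.adjoin ℂ
    {c : E₆.Contracted | ∃ a, ∃ h : E₆.marked = E₆.target a, c = E₆.loop h} = ⊤ := by
  refine adjoin_eq_top_of_mem _ fun c => ?_
  set K₀ := (Algebra.adjoin ℂ {c : E₆.Contracted | ∃ a, ∃ h : E₆.marked = E₆.target a,
    c = E₆.loop h}).toSubmodule.map E₆.contractedVal with hK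
  let K : Fin 6 → Submodule ℂ E₆.Preprojective := ![K₀,
    K₀.map (LinearMap.mulLeft ℂ (E₆.dualArr (0 : Fin 5))),
    K₀.map (LinearMap.mulLeft ℂ (E₆.dualArr (1 : Fin 5))),
    (K₀.map (LinearMap.mulLeft ℂ (E₆.dualArr (1 : Fin 5)))).map
      (LinearMap.mulLeft ℂ (E₆.dualArr (2 : Fin 5))),
    K₀.map (LinearMap.mulLeft ℂ (E₆.dualArr (3 : Fin 5))),
    (K₀.map (LinearMap.mulLeft ℂ (E₆.dualArr (3 : Fin 5)))).map
      (LinearMap.mulLeft ℂ (E₆.dualArr (4 : Fin 5)))]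
  refine E₆.contracted_mem K (E₆.idem_mem _) (fun (a : Fin 5) => ?_) (fun (a : Fin 5) => ?_) c
  · fin_cases a
    · rintro _ ⟨m, hm, rfl⟩
      exact loop_mul_mem rfl hm
    · rintro _ ⟨m, hm, rfl⟩
      exact loop_mul_mem rfl hm
    · rintro _ ⟨_, ⟨m, hm, rfl⟩, rfl⟩
      refine ⟨_, loop_mul_mem (a := (1 : Fin 5)) rfl hm, ?_⟩
      change E₆.dualArr (1 : Fin 5) * (E₆.arr (1 : Fin 5) * (E₆.dualArr (1 : Fin 5) * m))
        = E₆.arr (2 : Fin 5) * (E₆.dualArr (2 : Fin 5) * (E₆.dualArr (1 : Fin 5) * m))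
      rw [← mul_assoc (E₆.arr (2 : Fin 5)), E₆_relation_two, mul_assoc]
    · rintro _ ⟨m, hm, rfl⟩
      exact loop_mul_mem rfl hm
    · rintro _ ⟨_, ⟨m, hm, rfl⟩, rfl⟩
      refine ⟨_, loop_mul_mem (a := (3 : Fin 5)) rfl hm, ?_⟩
      change E₆.dualArr (3 : Fin 5) * (E₆.arr (3 : Fin 5) * (E₆.dualArr (3 : Fin 5) * m))
        = E₆.arr (4 : Fin 5) * (E₆.dualArr (4 : Fin 5) * (E₆.dualArr (3 : Fin 5) * m))
      rw [← mul_assoc (E₆.arr (4 : Fin 5)), E₆_relation_four, mul_assoc]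
  · fin_cases a
    all_goals
      intro m hm
      exact ⟨m, hm, rfl⟩

/-- On an arm of length two, (a a*)³ = a (a* a)² a* = a b (b* b) b* a*, and b* b = 0 at the tip. -/
theorem loop_cube {Q : MarkedQuiver} {a b : Q.Arrow} (h : Q.marked = Q.target a)
    (hab : Q.arr b * Q.dualArr b = Q.dualArr a * Q.arr a) (hb : Q.dualArr b * Q.arr b = 0) :
    Q.loop h * (Q.loop h * Q.loop h) = 0 := by
  apply Subtype.ext
  rw [contracted_mul_val, contracted_mul_val, loop_val, contracted_zero_val]
  simp only [mul_assoc]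
  rw [← mul_assoc (Q.dualArr a), ← hab, ← mul_assoc (Q.dualArr a) (Q.arr a), ← hab]
  simp only [mul_assoc]
  rw [← mul_assoc (Q.dualArr b) (Q.arr b), hb]
  simp only [zero_mul, mul_zero]

theorem add_mul_self_eq_zero {S : Type} [Ring S] {a b c : S} (hc : c * c = 0)
    (h : a + b + c = 0) : (a + b) * (a + b) = 0 := by
  rwa [add_eq_zero_iff_eq_neg'.mp h, neg_mul_neg] at hc

/-- The contracted preprojective algebra of type `E₆` is generated by `p`, `q` subject to
`p³ = q³ = (p + q)² = 0`. -/
theorem E₆_presentation : ∃ p q : E₆.Contracted, p * (p * p) = 0 ∧ q * (q * q) = 0 ∧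
    (p + q) * (p + q) = 0 ∧ Algebra.adjoin ℂ {p, q} = ⊤ ∧
    ∀ (S : Type) [Ring S] [Algebra ℂ S] (P R : S), P * (P * P) = 0 → R * (R * R) = 0 →
      (P + R) * (P + R) = 0 → ∃ φ : E₆.Contracted →ₐ[ℂ] S, φ p = P ∧ φ q = R := by
  have h0 : E₆.dualArr (0 : Fin 5) * E₆.arr (0 : Fin 5) = 0 := by simpa using E₆_relation 1
  have h3 : E₆.dualArr (2 : Fin 5) * E₆.arr (2 : Fin 5) = 0 := by simpa using E₆_relation 3
  have h5 : E₆.dualArr (4 : Fin 5) * E₆.arr (4 : Fin 5) = 0 := by simpa using E₆_relation 5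
  -- Arrows 1 and 3 start the two long arms and give p and q; arrow 0 is the short arm and gives -(p
  -- + q).
  obtain ⟨l, hl⟩ : ∃ l : Fin 3 → E₆.Contracted, ∀ i : Fin 3,
      ∃ h, l i = E₆.loop (a := (![1, 3, 0] i : Fin 5)) h := by
    refine ⟨![E₆.loop (a := (1 : Fin 5)) rfl, E₆.loop (a := (3 : Fin 5)) rfl,
      E₆.loop (a := (0 : Fin 5)) rfl], fun a => ?_⟩
    fin_cases a <;> exact ⟨rfl, rfl⟩
  have hp : l 0 * (l 0 * l 0) = 0 := by
    obtain ⟨h, e⟩ := hl 0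
    rw [e]
    exact loop_cube h E₆_relation_two h3
  have hq : l 1 * (l 1 * l 1) = 0 := by
    obtain ⟨h, e⟩ := hl 1
    rw [e]
    exact loop_cube h E₆_relation_four h5
  have hr : l 2 * l 2 = 0 := by
    obtain ⟨h, e⟩ := hl 2
    rw [e]
    exact loop_mul_self h h0
  have hv (i : Fin 3) : (l i).1 = E₆.arr (![1, 3, 0] i : Fin 5) * E₆.dualArr (![1, 3, 0] i : Fin 5) := by
    obtain ⟨h, e⟩ := hl i
    rw [e]
    rfl
  have hsum : l 0 + l 1 + l 2 = 0 := by
    apply Subtype.ext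
    rw [contracted_add_val, contracted_add_val, hv, hv, hv, contracted_zero_val]
    rw [add_comm, ← add_assoc]
    simpa using E₆_relation 0
  refine ⟨l 0, l 1, hp, hq, ?_, ?_, ?_⟩
  · exact add_mul_self_eq_zero (S := E₆.Contracted) hr hsum
  · refine adjoin_eq_top_of_sum_eq_zero (S := E₆.Contracted) (l := l) hsum ?_
    rw [eq_top_iff, ← E₆_adjoin]
    refine Algebra.adjoin_mono ?_
    rintro _ ⟨a, h, rfl⟩
    change Fin 5 at a
    have : ∃ i : Fin 3, (![1, 3, 0] i : Fin 5) = a := by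
      fin_cases a
      · exact ⟨2, rfl⟩
      · exact ⟨0, rfl⟩
      · exact absurd h (by decide : ¬ (0 : Fin 6) = 2)
      · exact ⟨1, rfl⟩
      · exact absurd h (by decide : ¬ (0 : Fin 6) = 4)
    obtain ⟨i, rfl⟩ := this
    obtain ⟨h', e⟩ := hl i
    exact ⟨i, e⟩
  · intro S _ _ P R hP hR hPR
    have hPR' : (-(P + R)) * (-(P + R)) = 0 := by rw [neg_mul_neg, hPR]
    -- Along a long arm the spaces are S ⊇ PS ⊇ P²S. At the middle vertex both terms of the relation
    -- are multiplication by P and cancel; at the tip P kills P²S because P³ = 0.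
    obtain ⟨N, hN⟩ : ∃ N : Fin 6 → Submodule ℂ S, N = ![⊤,
      LinearMap.range (LinearMap.mulLeft ℂ (-(P + R))),
      LinearMap.range (LinearMap.mulLeft ℂ P), LinearMap.range (LinearMap.mulLeft ℂ (P * P)),
      LinearMap.range (LinearMap.mulLeft ℂ R), LinearMap.range (LinearMap.mulLeft ℂ (R * R))] :=
      ⟨_, rfl⟩
    obtain ⟨W, hW⟩ : ∃ W : Fin 5 → S, W = ![-(P + R), P, P, R, R] := ⟨_, rfl⟩
    have hkill {a b m : S} (ha : a * b = 0) (hm : m ∈ LinearMap.range (LinearMap.mulLeft ℂ b)) :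
        a * m = 0 := by
      obtain ⟨n, rfl⟩ := hm
      rw [LinearMap.mulLeft_apply, ← mul_assoc, ha, zero_mul]
    have hle (a : S) : LinearMap.range (LinearMap.mulLeft ℂ (a * a))
        ≤ LinearMap.range (LinearMap.mulLeft ℂ a) := by
      rintro _ ⟨n, rfl⟩
      exact ⟨a * n, (mul_assoc _ _ _).symm⟩
    have hsq {a m : S} (hm : m ∈ LinearMap.range (LinearMap.mulLeft ℂ a)) :
        a * m ∈ LinearMap.range (LinearMap.mulLeft ℂ (a * a)) := by
      obtain ⟨n, rfl⟩ := hm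
      exact ⟨n, mul_assoc _ _ _⟩
    obtain ⟨φ, hφ⟩ := exists_contracted_lift (Q := E₆) (S := S) (N := N) (W := W)
      (fun (a : Fin 5) => by
        subst hN
        fin_cases a
        · exact le_top
        · exact le_top
        · exact hle P
        · exact le_top
        · exact hle R)
      (fun (a : Fin 5) m hm => by
        subst hN hW
        fin_cases a
        · exact ⟨m, rfl⟩
        · exact ⟨m, rfl⟩
        · exact hsq hm
        · exact ⟨m, rfl⟩
        · exact hsq hm)
      (fun (v : Fin 6) m hm => (Fin.sum_univ_five _).trans <| by
        change ((if v = 0 then W 0 * m else 0) - (if v = 1 then W 0 * m else 0))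
          + ((if v = 0 then W 1 * m else 0) - (if v = 2 then W 1 * m else 0))
          + ((if v = 2 then W 2 * m else 0) - (if v = 3 then W 2 * m else 0))
          + ((if v = 0 then W 3 * m else 0) - (if v = 4 then W 3 * m else 0))
          + ((if v = 4 then W 4 * m else 0) - (if v = 5 then W 4 * m else 0)) = 0
        subst hN hW
        fin_cases v
        · simp [add_mul, add_assoc]
        · simpa using hkill hPR' hm
        · simp
        · simpa using hkill hP hm
        · simp
        · simpa using hkill hR hm)
      (by subst hN; rfl) E₆_adjoin
    refine ⟨φ, ?_, ?_⟩
    · obtain ⟨h, e⟩ := hl 0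
      rw [e]
      exact (hφ (1 : Fin 5) h).trans (by rw [hW]; rfl)
    · obtain ⟨h, e⟩ := hl 1
      rw [e]
      exact (hφ (3 : Fin 5) h).trans (by rw [hW]; rfl)

end E₆

end MarkedQuiver

/-! ### Identification of finite-dimensional quotients -/

/-- The composite is a surjective endomorphism of a finite-dimensional space, hence injective.
Nothing need be known about the dimension of `B`. -/
theorem nonempty_algEquiv_of_surjective {R B : Type} [Ring R] [Algebra ℂ R] [Ring B] [Algebra ℂ B]
    [FiniteDimensional ℂ R] (ψ : R →ₐ[ℂ] B) (φ : B →ₐ[ℂ] R) (hψ : Function.Surjective ψ)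
    (hφ : Function.Surjective φ) : Nonempty (R ≃ₐ[ℂ] B) := by
  have h : Function.Injective (φ.comp ψ).toLinearMap :=
    LinearMap.injective_iff_surjective.mpr (hφ.comp hψ)
  exact ⟨AlgEquiv.ofBijective ψ ⟨Function.Injective.of_comp (f := φ) h, hψ⟩⟩

namespace NCSeries

variable {σ : Type} [Fintype σ] {S : Type} [Ring S] [Algebra ℂ S]

theorem evalTrunc_mem (v : σ → S) (W : Submodule ℂ S) (h1 : 1 ∈ W) (hW : ∀ a, ∀ m ∈ W, v a * m ∈ W)
    (N : ℕ) (f : NCSeries σ) : evalTrunc v N f ∈ W := by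
  induction N generalizing f with
  | zero => exact zero_mem _
  | succ N ih => exact add_mem (W.smul_mem _ h1) (sum_mem fun a _ => hW a _ (ih _))

theorem evalTrunc_mem_span (v : σ → S) (N : ℕ) (f : NCSeries σ) :
    evalTrunc v N f ∈ Submodule.span ℂ ((fun l : List σ => (l.map v).prod) '' {l | l.length < N}) := by
  induction N generalizing f with
  | zero => exact zero_mem _
  | succ N ih =>
    refine add_mem (Submodule.smul_mem _ _ (Submodule.subset_span ⟨[], by simp, by simp⟩))
      (sum_mem fun a _ => ?_)
    have := Submodule.mem_map_of_mem (f := LinearMap.mulLeft ℂ (v a)) (ih (strike a f))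
    rw [Submodule.map_span] at this
    refine Submodule.span_mono ?_ this
    rintro _ ⟨_, ⟨l, hl, rfl⟩, rfl⟩
    exact ⟨a :: l, by simpa using hl, by simp⟩

theorem evalTrunc_mem_subalgebra (v : σ → S) (C : Subalgebra ℂ S) (hC : ∀ a, v a ∈ C) (N : ℕ)
    (f : NCSeries σ) : evalTrunc v N f ∈ C :=
  evalTrunc_mem v C.toSubmodule (one_mem C) (fun a _ hm => C.mul_mem (hC a) hm) N f

theorem finiteDimensional_of_prod_eq_zero (π : NCSeries σ →ₐ[ℂ] S) (hπ : Function.Surjective π)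
    {N : ℕ} (h : ∀ l : List σ, N ≤ l.length → (l.map fun a => π (X a)).prod = 0) :
    FiniteDimensional ℂ S := by
  refine ⟨⟨((List.finite_length_lt σ N).image
    (fun l : List σ => (l.map fun a => π (X a)).prod)).toFinset, ?_⟩⟩
  rw [Set.Finite.coe_toFinset, eq_top_iff]
  intro s _
  obtain ⟨f, rfl⟩ := hπ s
  rw [map_eq_evalTrunc π h]
  exact evalTrunc_mem_span _ N f

end NCSeries

open NCSeries

/-- The projection from power series to `Jac f / (s)`. -/
noncomputable def quotProj {σ : Type} (f s : NCSeries σ) :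
    NCSeries σ →ₐ[ℂ] QuotBy (Jac.mk f s) :=
  (QuotBy.mkₐ (Jac.mk f s)).comp (Jac.mkₐ f)

section quotProj

variable {σ : Type} (f s : NCSeries σ)

theorem quotProj_surjective : Function.Surjective (quotProj f s) :=
  (QuotBy.mkₐ_surjective _).comp (Jac.mkₐ_surjective f)

theorem quotProj_cyclicDeriv (i : σ) : quotProj f s (cyclicDeriv i f) = 0 := by
  rw [quotProj, AlgHom.comp_apply, Jac.mkₐ_cyclicDeriv, map_zero]

theorem quotProj_self : quotProj f s s = 0 := QuotBy.mkₐ_self _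

variable {f s}

/-- Common frame for all three types: φ comes from the presentation of `B`, and the map in the other
direction is evaluation at v, which factors through the quotient by `hrel` and `hs`. -/
theorem nonempty_quotBy_algEquiv [Fintype σ] {B : Type} [Ring B] [Algebra ℂ B] {M N : ℕ}
    (hR : ∀ l : List σ, M ≤ l.length → (l.map fun a => quotProj f s (X a)).prod = 0)
    (φ : B →ₐ[ℂ] QuotBy (Jac.mk f s)) (hφ : ∀ a, quotProj f s (X a) ∈ φ.range)
    (v : σ → B) (hv : ∀ l : List σ, N ≤ l.length → (l.map v).prod = 0)
    (hrel : ∀ i, evalNilpotent hv (cyclicDeriv i f) = 0) (hs : evalNilpotent hv s = 0)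
    (hgen : Algebra.adjoin ℂ (Set.range v) = ⊤) :
    Nonempty (QuotBy (Jac.mk f s) ≃ₐ[ℂ] B) := by
  have : FiniteDimensional ℂ (QuotBy (Jac.mk f s)) :=
    finiteDimensional_of_prod_eq_zero (quotProj f s) (quotProj_surjective f s) hR
  obtain ⟨ψ₀, hψ₀⟩ := Jac.exists_lift f (evalNilpotent hv)
    (fun _ _ h => evalNilpotent_congr hv h) hrel
  obtain ⟨ψ, hψ⟩ := QuotBy.exists_lift (Jac.mk f s) ψ₀ ((hψ₀ s).trans hs)
  refine nonempty_algEquiv_of_surjective ψ φ ?_ ?_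
  · rw [← AlgHom.range_eq_top, eq_top_iff, ← hgen]
    refine Algebra.adjoin_le ?_
    rintro _ ⟨a, rfl⟩
    refine ⟨QuotBy.mkₐ _ (Jac.mkₐ f (X a)), ?_⟩
    change ψ _ = _
    rw [hψ, hψ₀, evalNilpotent_X]
  · intro r
    obtain ⟨g, rfl⟩ := quotProj_surjective f s r
    rw [map_eq_evalTrunc _ hR]
    exact evalTrunc_mem_subalgebra _ φ.range hφ M g

end quotProj

/-! ### The quotients of types `A` and `D` -/

section

variable {σ : Type}

theorem prod_map_eq_zero_of_forall {S : Type} [Ring S] {v : σ → S} (hv : ∀ a, v a = 0) (l : List σ) (hl : 1 ≤ l.length) :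
    (l.map v).prod = 0 := by
  cases l with
  | nil => simp at hl
  | cons a l => rw [List.map_cons, List.prod_cons, hv, zero_mul]

/-- In an algebra with `x² = y² = xy + yx = 0`, words of length three in `x` and `y` vanish. -/
theorem prod_map_eq_zero_of_anticommute {S : Type} [Ring S] [Algebra ℂ S] {x y : S} (hx : x * x = 0) (hy : y * y = 0)
    (hxy : y * x + x * y = 0) {v : σ → S} (hv : ∀ a, v a = 0 ∨ v a = x ∨ v a = y) (l : List σ)
    (hl : 3 ≤ l.length) : (l.map v).prod = 0 := by
  have hyx : y * x = -(x * y) := eq_neg_of_add_eq_zero_left hxy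
  let G : ℕ → Submodule ℂ S
    | 0 => Submodule.span ℂ {1}
    | 1 => Submodule.span ℂ {x, y}
    | 2 => Submodule.span ℂ {x * y}
    | _ + 3 => ⊥
  have hG : ∀ a n, G n ≤ (G (n + 1)).comap (LinearMap.mulLeft ℂ (v a)) := by
    intro a n
    rcases hv a with h | h | h
    · intro m _
      rw [Submodule.mem_comap, LinearMap.mulLeft_apply, h, zero_mul]
      exact zero_mem _
    all_goals
      rw [h]
      match n with
      | 0 =>
        refine Submodule.span_le.mpr ?_
        rintro _ rfl
        simp only [SetLike.mem_coe, Submodule.mem_comap, LinearMap.mulLeft_apply, mul_one]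
        exact Submodule.subset_span (by simp)
      | 1 =>
        refine Submodule.span_le.mpr ?_
        rintro _ (rfl | rfl)
        all_goals
          simp only [SetLike.mem_coe, Submodule.mem_comap, LinearMap.mulLeft_apply, hx, hy, hyx]
          first
            | exact zero_mem _
            | exact Submodule.subset_span rfl
            | exact neg_mem (Submodule.subset_span rfl)
      | 2 =>
        refine Submodule.span_le.mpr ?_
        rintro _ rfl
        simp only [SetLike.mem_coe, Submodule.mem_comap, LinearMap.mulLeft_apply, ← mul_assoc, hx,
          hyx]
        simp only [neg_mul, mul_assoc, hy, mul_zero, zero_mul, neg_zero]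
        exact zero_mem _
      | n + 3 =>
        intro m hm
        obtain rfl : m = 0 := hm
        simp
  have := prod_mem_filtration v G (Submodule.subset_span rfl) hG l
  obtain ⟨n, hn⟩ := Nat.exists_eq_add_of_le' hl
  rw [hn] at this
  exact this

/-- The map on variables with `zᵢ ↦ 0`. -/
def varMap {S : Type} [Zero S] {k : ℕ} (x y : S) : Var k → S
  | .z _ => 0
  | .x => x
  | .y => y

theorem varMap_cases {S : Type} [Zero S] {k : ℕ} (x y : S) (a : Var k) :
    varMap x y a = 0 ∨ varMap x y a = x ∨ varMap x y a = y := by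
  cases a
  · exact .inl rfl
  · exact .inr (.inl rfl)
  · exact .inr (.inr rfl)

theorem adjoin_range_varMap {S : Type} [Ring S] [Algebra ℂ S] {k : ℕ} {x y : S} (h : Algebra.adjoin ℂ {x, y} = ⊤) :
    Algebra.adjoin ℂ (Set.range (varMap (k := k) x y)) = ⊤ := by
  rw [eq_top_iff, ← h]
  refine Algebra.adjoin_mono ?_
  rintro _ (rfl | rfl)
  · exact ⟨.x, rfl⟩
  · exact ⟨.y, rfl⟩

theorem Jac.mk_mem_center [Fintype σ] {f s : NCSeries σ}
    (h : ∀ i, Jac.mkₐ f s * Jac.mkₐ f (X i) = Jac.mkₐ f (X i) * Jac.mkₐ f s) :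
    Jac.mk f s ∈ Subalgebra.center ℂ (Jac f) := by
  rw [Subalgebra.mem_center_iff]
  intro b
  obtain ⟨g, rfl⟩ := Jac.mkₐ_surjective f b
  exact (Jac.mem_center h g).symm

end

namespace NormalForm

variable {k : ℕ} {S : Type} [Ring S] [Algebra ℂ S]

section TypeA

variable {n : ℕ∞} (π : NCSeries (Var k) →ₐ[ℂ] S)

theorem potA_z_eq_zero (h : ∀ i, π (cyclicDeriv i (potA k n)) = 0) (i : Fin k) : π (X (.z i)) = 0 := by
  have := h (.z i)
  rw [cyclicDeriv_potA_z, map_smul] at this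
  exact (smul_eq_zero_iff_right two_ne_zero).mp this

theorem potA_x_eq_zero (h : ∀ i, π (cyclicDeriv i (potA k n)) = 0) : π (X .x) = 0 := by
  have := h .x
  rw [cyclicDeriv_potA_x, map_smul] at this
  exact (smul_eq_zero_iff_right two_ne_zero).mp this

theorem potA_y_mem_center (n : ℕ∞) :
    Jac.mk (potA k n) (y k) ∈ Subalgebra.center ℂ (Jac (potA k n)) := by
  refine Jac.mk_mem_center fun i => ?_
  cases i with
  | z i => rw [potA_z_eq_zero (n := n) _ (Jac.mkₐ_cyclicDeriv _), mul_zero, zero_mul]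
  | x => rw [potA_x_eq_zero (n := n) _ (Jac.mkₐ_cyclicDeriv _), mul_zero, zero_mul]
  | y => rfl

theorem potA_quot_letter (n : ℕ∞) (a : Var k) : quotProj (potA k n) (y k) (X a) = 0 := by
  cases a with
  | z i => exact potA_z_eq_zero (n := n) _ (quotProj_cyclicDeriv _ _) i
  | x => exact potA_x_eq_zero (n := n) _ (quotProj_cyclicDeriv _ _)
  | y => exact quotProj_self _ _

theorem potA_quot_equiv_of {B : Type} [Ring B] [Algebra ℂ B] (n : ℕ∞) (hn : 2 ≤ n)
    (hB : Algebra.adjoin ℂ (∅ : Set B) = ⊤) (φ : B →ₐ[ℂ] QuotBy (Jac.mk (potA k n) (y k))) :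
    Nonempty (QuotBy (Jac.mk (potA k n) (y k)) ≃ₐ[ℂ] B) := by
  have hv : ∀ l : List (Var k), 1 ≤ l.length →
      (l.map fun _ => (0 : B)).prod = 0 :=
    prod_map_eq_zero_of_forall fun _ => rfl
  have hX (a : Var k) : evalNilpotent hv (X a) = 0 := evalNilpotent_X hv a
  refine nonempty_quotBy_algEquiv (prod_map_eq_zero_of_forall (potA_quot_letter n)) φ
    (fun a => by rw [potA_quot_letter]; exact zero_mem _) (fun _ => 0) hv (fun i => ?_) (hX _) ?_
  · cases i with
    | z i => rw [cyclicDeriv_potA_z, map_smul, hX, smul_zero]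
    | x => rw [cyclicDeriv_potA_x, map_smul, x, hX, smul_zero]
    | y =>
      rw [cyclicDeriv_potA_y]
      induction n using ENat.recTopCoe with
      | top => exact map_zero _
      | coe n =>
        have hn' : 2 ≤ n := by exact_mod_cast hn
        rw [ENat.recTopCoe_natCast, map_smul, map_pow, y, hX, zero_pow (by omega), smul_zero]
  · rw [eq_top_iff, ← hB]
    exact Algebra.adjoin_mono (Set.empty_subset _)

theorem potA_quot_equiv (n : ℕ∞) (hn : 2 ≤ n) :
    Nonempty (QuotBy (Jac.mk (potA k n) (y k)) ≃ₐ[ℂ] MarkedQuiver.A₁.Contracted) := by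
  obtain ⟨φ⟩ := MarkedQuiver.A₁_exists_lift (QuotBy (Jac.mk (potA k n) (y k)))
  exact potA_quot_equiv_of (B := MarkedQuiver.A₁.Contracted) n hn MarkedQuiver.A₁_adjoin_empty φ

end TypeA

section TypeD

variable {n m : ℕ∞} (π : NCSeries (Var k) →ₐ[ℂ] S)

theorem potD_z_eq_zero (h : ∀ i, π (cyclicDeriv i (potD k n m)) = 0) (i : Fin k) :
    π (X (.z i)) = 0 := by
  have := h (.z i)
  rw [cyclicDeriv_potD_z, map_smul] at this
  exact (smul_eq_zero_iff_right two_ne_zero).mp this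

theorem potD_anticommute (h : ∀ i, π (cyclicDeriv i (potD k n m)) = 0) :
    π (X .y) * π (X .x) + π (X .x) * π (X .y) = 0 := by
  have := h .y
  rwa [cyclicDeriv_potD_y, map_add, map_mul, map_mul] at this

/-- The bounds on n and m make the exponents 2n - 1 and 2m - 2 at least two, so both powers of x
die. -/
theorem map_cyclicDeriv_potD_x (hn : 2 ≤ n) (hm : 2 ≤ m) (hx : π (X .x) * π (X .x) = 0) :
    π (cyclicDeriv .x (potD k n m)) = π (X .y) * π (X .y) := by
  have hp (j : ℕ) (hj : 2 ≤ j) : π (X .x) ^ j = 0 := pow_eq_zero_of_le hj (by rw [pow_two, hx])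
  rw [cyclicDeriv_potD_x, map_add, map_add, map_mul]
  have h1 : π (ENat.recTopCoe 0 (fun n : ℕ => ((2 * n : ℕ) : ℂ) • x k ^ (2 * n - 1)) n) = 0 := by
    induction n using ENat.recTopCoe with
    | top => exact map_zero _
    | coe n =>
      have hn' : 2 ≤ n := by exact_mod_cast hn
      rw [ENat.recTopCoe_natCast, map_smul, map_pow, x, hp _ (by omega), smul_zero]
  have h2 : π (ENat.recTopCoe 0 (fun m : ℕ => ((2 * m - 1 : ℕ) : ℂ) • x k ^ (2 * m - 1 - 1)) m)
      = 0 := by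
    induction m using ENat.recTopCoe with
    | top => exact map_zero _
    | coe m =>
      have hm' : 2 ≤ m := by exact_mod_cast hm
      rw [ENat.recTopCoe_natCast, map_smul, map_pow, x, hp _ (by omega), smul_zero]
  rw [h1, h2, add_zero, add_zero]
  rfl

/-- The relation δ_y f = 0 says that y anticommutes with x, hence commutes with x². -/
theorem potD_xx_mem_center (n m : ℕ∞) :
    Jac.mk (potD k n m) (x k ^ 2) ∈ Subalgebra.center ℂ (Jac (potD k n m)) := by
  have hyx := eq_neg_of_add_eq_zero_left
    (potD_anticommute (n := n) (m := m) _ (Jac.mkₐ_cyclicDeriv (potD k n m)))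
  refine Jac.mk_mem_center fun i => ?_
  rw [map_pow, pow_two, x]
  cases i with
  | z i => rw [potD_z_eq_zero (n := n) (m := m) _ (Jac.mkₐ_cyclicDeriv _), mul_zero, zero_mul]
  | x => rw [mul_assoc]
  | y => rw [← mul_assoc, hyx, neg_mul, mul_assoc, mul_assoc, hyx, mul_neg, neg_neg]

theorem potD_quot_relations (hn : 2 ≤ n) (hm : 2 ≤ m) (π : NCSeries (Var k) →ₐ[ℂ] S)
    (h : ∀ i, π (cyclicDeriv i (potD k n m)) = 0) (hs : π (x k ^ 2) = 0) :
    π (X .x) * π (X .x) = 0 ∧ π (X .y) * π (X .y) = 0 ∧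
      π (X .y) * π (X .x) + π (X .x) * π (X .y) = 0 := by
  have hxx : π (X .x) * π (X .x) = 0 := by rwa [← map_mul, ← pow_two]
  exact ⟨hxx, by rw [← map_cyclicDeriv_potD_x π hn hm hxx, h], potD_anticommute π h⟩

theorem potD_letters (π : NCSeries (Var k) →ₐ[ℂ] S)
    (h : ∀ i, π (cyclicDeriv i (potD k n m)) = 0) (a : Var k) :
    π (X a) = 0 ∨ π (X a) = π (X .x) ∨ π (X a) = π (X .y) := by
  cases a with
  | z i => exact .inl (potD_z_eq_zero π h i)
  | x => exact .inr (.inl rfl)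
  | y => exact .inr (.inr rfl)

theorem potD_quot_equiv_of {B : Type} [Ring B] [Algebra ℂ B] (n m : ℕ∞) (hn : 2 ≤ n) (hm : 2 ≤ m)
    {p q : B} (hp : p * p = 0) (hq : q * q = 0) (hpq : p * q + q * p = 0)
    (hgen : Algebra.adjoin ℂ {p, q} = ⊤) (hlift : ∀ (S : Type) [Ring S] [Algebra ℂ S] (P R : S),
      P * P = 0 → R * R = 0 → P * R + R * P = 0 → ∃ φ : B →ₐ[ℂ] S, φ p = P ∧ φ q = R) :
    Nonempty (QuotBy (Jac.mk (potD k n m) (x k ^ 2)) ≃ₐ[ℂ] B) := by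
  set π := quotProj (potD k n m) (x k ^ 2) with hπ
  obtain ⟨hxx, hyy, hyx⟩ := potD_quot_relations hn hm π (quotProj_cyclicDeriv _ _)
    (quotProj_self _ _)
  have hletters := potD_letters π (quotProj_cyclicDeriv _ _)
  obtain ⟨φ, hφp, hφq⟩ := hlift _ (π (X .x)) (π (X .y)) hxx hyy (by rwa [add_comm])
  have hqp : q * p + p * q = 0 := (add_comm (q * p) (p * q)).trans hpq
  have hv : ∀ l : List (Var k), 3 ≤ l.length → (l.map (varMap p q)).prod = 0 :=
    prod_map_eq_zero_of_anticommute hp hq hqp (varMap_cases p q)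
  refine nonempty_quotBy_algEquiv (prod_map_eq_zero_of_anticommute hxx hyy hyx hletters) φ
    (fun a => ?_) (varMap p q) hv (fun i => ?_) ?_ 
    (adjoin_range_varMap hgen)
  · rcases hletters a with h | h | h
    · rw [← hπ, h]; exact zero_mem _
    · exact ⟨p, hφp.trans h.symm⟩
    · exact ⟨q, hφq.trans h.symm⟩
  · cases i with
    | z i =>
      rw [cyclicDeriv_potD_z, map_smul, evalNilpotent_X]
      exact smul_zero _
    | x =>
      rw [map_cyclicDeriv_potD_x _ hn hm (by rw [evalNilpotent_X]; exact hp), evalNilpotent_X]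
      exact hq
    | y =>
      rw [cyclicDeriv_potD_y, map_add, map_mul, map_mul, x, y, evalNilpotent_X, evalNilpotent_X]
      exact hqp
  · rw [map_pow, x, evalNilpotent_X, pow_two]
    exact hp

theorem potD_quot_equiv (n m : ℕ∞) (hn : 2 ≤ n) (hm : 2 ≤ m) :
    Nonempty (QuotBy (Jac.mk (potD k n m) (x k ^ 2)) ≃ₐ[ℂ] MarkedQuiver.D₄.Contracted) := by
  obtain ⟨p, q, hp, hq, hpq, hgen, hlift⟩ := MarkedQuiver.D₄_presentation
  exact potD_quot_equiv_of (B := MarkedQuiver.D₄.Contracted) n m hn hm hp hq hpq hgen hlift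

end TypeD

end NormalForm

/-! ### The relations of type `E` -/

namespace NormalForm

variable {S : Type} [Ring S] [Algebra ℂ S]

/-- The derivative of the term `yⁿ` of the potential of type `E`. -/
noncomputable def derivTermE (n : ℕ∞) (y : S) : S :=
  ENat.recTopCoe 0 (fun n : ℕ => (n : ℂ) • y ^ (n - 1)) n

/-- The correction term of `g_{6,n}` evaluated in an algebra. -/
noncomputable def correctionE (n : ℕ∞) (x y : S) : S :=
  ENat.recTopCoe 0 (fun n : ℕ =>
    if n % 3 = 1 then 0
    else if n % 3 = 2 then
      ((-1) ^ (n / 3) * 3 ^ (n / 3) * (3 * (n / 3 : ℕ) + 2) : ℂ) • x ^ (2 * (n / 3) + 1)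
    else
      ((-1) ^ (n / 3 + 1) * 3 ^ (n / 3) * (n / 3 : ℕ) : ℂ) •
        (x * y * x ^ (2 * (n / 3) - 2) + y * x ^ (2 * (n / 3) - 1))) n

variable {k : ℕ} (π : NCSeries (Var k) →ₐ[ℂ] S)

theorem map_gE (n : ℕ∞) : π (gE k n) = π (X .x) * π (X .x) + π (X .x) * (π (X .y) * π (X .x))
    + π (X .y) * (π (X .x) * π (X .x)) + correctionE n (π (X .x)) (π (X .y)) := by
  have h : π (ENat.recTopCoe 0 (gCorrection k) n) = correctionE n (π (X .x)) (π (X .y)) := by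
    induction n using ENat.recTopCoe with
    | top => exact map_zero π
    | coe n =>
      simp only [correctionE, ENat.recTopCoe_natCast, gCorrection]
      split_ifs
      · exact map_zero π
      · rw [map_smul, map_pow]; rfl
      · rw [map_smul, map_add, map_mul, map_mul, map_mul, map_pow, map_pow]; rfl
  rw [gE, map_add, h]
  simp only [map_add, map_mul, pow_two, mul_assoc]
  rfl

theorem map_cyclicDeriv_potE_x (n : ℕ∞) : π (cyclicDeriv .x (potE k n))
    = (3 : ℂ) • (π (X .x) * π (X .x)) + π (X .y) * (π (X .y) * π (X .y)) := by
  rw [cyclicDeriv_potE_x, map_add, map_smul]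
  simp only [map_mul]
  rfl

theorem map_cyclicDeriv_potE_y (n : ℕ∞) : π (cyclicDeriv .y (potE k n))
    = π (X .y) * (π (X .y) * π (X .x)) + π (X .y) * (π (X .x) * π (X .y))
      + π (X .x) * (π (X .y) * π (X .y)) + derivTermE n (π (X .y)) := by
  have h : π (ENat.recTopCoe 0 (fun n : ℕ => (n : ℂ) • y k ^ (n - 1)) n)
      = derivTermE n (π (X .y)) := by
    induction n using ENat.recTopCoe with
    | top => exact map_zero π
    | coe n =>
      simp only [derivTermE, ENat.recTopCoe_natCast]
      rw [map_smul, map_pow]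
      rfl
  rw [cyclicDeriv_potE_y, map_add, h]
  simp only [map_add, map_mul]
  rfl

variable {x y : S}

theorem commute_of_cube (h : y * (y * y) = (-3 : ℂ) • (x * x)) : y * (x * x) = x * x * y := by
  have e : x * x = (-3 : ℂ)⁻¹ • (y * (y * y)) := by rw [h, smul_smul]; norm_num
  rw [e, mul_smul_comm, smul_mul_assoc]
  simp only [mul_assoc]

theorem y_pow_three_mul (h : y * (y * y) = (-3 : ℂ) • (x * x)) (t : ℕ) :
    y ^ (3 * t) = (-3 : ℂ) ^ t • (x * x) ^ t := by
  rw [pow_mul, show y ^ 3 = y * (y * y) by rw [pow_succ, pow_two, mul_assoc], h, smul_pow]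

/-- In each residue class of n modulo 3, y³ = -3x² turns y ^ (n - 1) into a scalar times a power of
the central element x² times 1, y or y². -/
theorem derivTermE_one (h : y * (y * y) = (-3 : ℂ) • (x * x)) (t : ℕ) :
    derivTermE ((3 * t + 4 : ℕ) : ℕ∞) y = (((3 * t + 4 : ℕ) : ℂ) * (-3) ^ (t + 1)) • (x * x) ^ (t + 1) := by
  rw [derivTermE, ENat.recTopCoe_natCast, show 3 * t + 4 - 1 = 3 * (t + 1) by omega, y_pow_three_mul h,
    smul_smul]

theorem derivTermE_two (h : y * (y * y) = (-3 : ℂ) • (x * x)) (t : ℕ) :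
    derivTermE ((3 * t + 5 : ℕ) : ℕ∞) y
      = (((3 * t + 5 : ℕ) : ℂ) * (-3) ^ (t + 1)) • ((x * x) ^ (t + 1) * y) := by
  rw [derivTermE, ENat.recTopCoe_natCast, show 3 * t + 5 - 1 = 3 * (t + 1) + 1 by omega, pow_succ,
    y_pow_three_mul h, smul_mul_assoc, smul_smul]

theorem derivTermE_zero (h : y * (y * y) = (-3 : ℂ) • (x * x)) (t : ℕ) :
    derivTermE ((3 * t + 6 : ℕ) : ℕ∞) y
      = (((3 * t + 6 : ℕ) : ℂ) * (-3) ^ (t + 1)) • ((x * x) ^ (t + 1) * (y * y)) := by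
  rw [derivTermE, ENat.recTopCoe_natCast, show 3 * t + 6 - 1 = 3 * (t + 1) + 1 + 1 by omega, pow_succ,
    pow_succ, y_pow_three_mul h, smul_mul_assoc, smul_mul_assoc, smul_smul, mul_assoc]

theorem correctionE_one (x y : S) (t : ℕ) : correctionE ((3 * t + 4 : ℕ) : ℕ∞) x y = 0 := by
  rw [correctionE, ENat.recTopCoe_natCast, if_pos (by omega)]

/-- The coefficients of the correction are designed to equal those of the derivative term; only the
last factor 1, y, y² is replaced by 0, x, xy + yx respectively. -/
theorem correctionE_two (x y : S) (t : ℕ) : correctionE ((3 * t + 5 : ℕ) : ℕ∞) x y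
    = (((3 * t + 5 : ℕ) : ℂ) * (-3) ^ (t + 1)) • ((x * x) ^ (t + 1) * x) := by
  rw [correctionE, ENat.recTopCoe_natCast, if_neg (by omega), if_pos (by omega),
    show (3 * t + 5) / 3 = t + 1 by omega, pow_succ x, pow_mul, pow_two, ← mul_pow]
  congr 1
  push_cast
  rw [neg_one_mul]
  ring

theorem correctionE_zero (h : y * (x * x) = x * x * y) (t : ℕ) :
    correctionE ((3 * t + 6 : ℕ) : ℕ∞) x y
      = (((3 * t + 6 : ℕ) : ℂ) * (-3) ^ (t + 1)) • ((x * x) ^ (t + 1) * (x * y + y * x)) := by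
  have hy : Commute y (x * x) := h
  have hx : Commute x (x * x) := (mul_assoc x x x).symm
  rw [correctionE, ENat.recTopCoe_natCast, if_neg (by omega), if_neg (by omega),
    show (3 * t + 6) / 3 = t + 2 by omega, show 2 * (t + 2) - 2 = 2 * (t + 1) by omega,
    show 2 * (t + 2) - 1 = 2 * (t + 1) + 1 by omega, pow_succ x, pow_mul, pow_two,
    ((hx.mul_left hy).pow_right (t + 1)).eq, ← mul_assoc y, (hy.pow_right (t + 1)).eq,
    mul_assoc _ y x, ← mul_add]
  congr 1
  have e : (-1 : ℂ) ^ (t + 2 + 1) * 3 ^ (t + 2) = 3 * (-3) ^ (t + 1) := by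
    rw [show (-3 : ℂ) = -1 * 3 by norm_num, mul_pow]
    ring
  rw [e]
  push_cast
  ring

theorem exists_of_four_le {n : ℕ∞} (hn : 4 ≤ n) : n = ⊤ ∨ (∃ t : ℕ, n = (3 * t + 4 : ℕ)) ∨
    (∃ t : ℕ, n = (3 * t + 5 : ℕ)) ∨ ∃ t : ℕ, n = (3 * t + 6 : ℕ) := by
  induction n using ENat.recTopCoe with
  | top => exact .inl rfl
  | coe n =>
    have hn' : 4 ≤ n := by exact_mod_cast hn
    obtain h | h | h : n % 3 = 1 ∨ n % 3 = 2 ∨ n % 3 = 0 := by omega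
    · exact .inr (.inl ⟨(n - 4) / 3, congrArg _ (by omega)⟩)
    · exact .inr (.inr (.inl ⟨(n - 5) / 3, congrArg _ (by omega)⟩))
    · exact .inr (.inr (.inr ⟨(n - 6) / 3, congrArg _ (by omega)⟩))

theorem mul_correctionE_comm (h : y * (y * y) = (-3 : ℂ) • (x * x)) {n : ℕ∞} (hn : 4 ≤ n) :
    x * correctionE n x y = correctionE n x y * x := by
  have hx : Commute x (x * x) := (mul_assoc x x x).symm
  obtain rfl | ⟨t, rfl⟩ | ⟨t, rfl⟩ | ⟨t, rfl⟩ := exists_of_four_le hn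
  · exact (mul_zero x).trans (zero_mul x).symm
  · rw [correctionE_one, mul_zero, zero_mul]
  · rw [correctionE_two, mul_smul_comm, smul_mul_assoc, ← mul_assoc, (hx.pow_right _).eq]
  · rw [correctionE_zero (commute_of_cube h), mul_smul_comm, smul_mul_assoc, ← mul_assoc,
      (hx.pow_right _).eq, mul_assoc, mul_assoc, mul_add, add_mul, mul_assoc, mul_assoc y,
      commute_of_cube h, mul_assoc, add_comm (x * (x * y))]

/-- Up to the common central factor the identities are 0 = [1, x], [y, x] = [y, x] and [y, xy + yx]
= [y², x]. This is the reason for the shape of g. -/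
theorem commutator_correctionE (h : y * (y * y) = (-3 : ℂ) • (x * x)) {n : ℕ∞} (hn : 4 ≤ n) :
    y * correctionE n x y - correctionE n x y * y = derivTermE n y * x - x * derivTermE n y := by
  have hx : Commute x (x * x) := (mul_assoc x x x).symm
  have hy : Commute y (x * x) := commute_of_cube h
  obtain rfl | ⟨t, rfl⟩ | ⟨t, rfl⟩ | ⟨t, rfl⟩ := exists_of_four_le hn
  · change y * 0 - 0 * y = 0 * x - x * 0
    simp only [mul_zero, zero_mul]
  · rw [correctionE_one, derivTermE_one h, mul_zero, zero_mul, mul_smul_comm, smul_mul_assoc,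
      (hx.pow_right _).eq, sub_self, sub_self]
  · rw [correctionE_two, derivTermE_two h]
    simp only [mul_smul_comm, smul_mul_assoc]
    rw [← mul_assoc x, ← mul_assoc y, (hx.pow_right _).eq, (hy.pow_right _).eq]
  · rw [correctionE_zero (commute_of_cube h), derivTermE_zero h]
    simp only [mul_smul_comm, smul_mul_assoc]
    rw [← mul_assoc x, ← mul_assoc y, (hx.pow_right _).eq, (hy.pow_right _).eq]
    simp only [mul_assoc, mul_add, add_mul, ← smul_sub]
    congr 1
    abel

theorem derivTermE_eq_mul (h : y * (y * y) = (-3 : ℂ) • (x * x)) {n : ℕ∞} (hn : 4 ≤ n) :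
    ∃ w, derivTermE n y = x * x * w := by
  obtain rfl | ⟨t, rfl⟩ | ⟨t, rfl⟩ | ⟨t, rfl⟩ := exists_of_four_le hn
  · exact ⟨0, (mul_zero _).symm⟩
  · rw [derivTermE_one h, pow_succ' (x * x), ← mul_smul_comm]
    exact ⟨_, rfl⟩
  · rw [derivTermE_two h, pow_succ' (x * x), mul_assoc (x * x), ← mul_smul_comm]
    exact ⟨_, rfl⟩
  · rw [derivTermE_zero h, pow_succ' (x * x), mul_assoc (x * x), ← mul_smul_comm]
    exact ⟨_, rfl⟩

/-- The second property is needed when the relation g = 0 is multiplied by x. In the case of xy + yx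
it holds because x(xy + yx) = x²y + xyx, where xyx is a multiple of x² modulo g. -/
theorem correctionE_eq_mul (h : y * (y * y) = (-3 : ℂ) • (x * x)) {n : ℕ∞} (hn : 4 ≤ n) :
    ∃ w, correctionE n x y = x * x * w ∧
      ∀ v, x * (y * x) = x * x * v → ∃ u, x * w = x * x * u := by
  have hx : Commute x (x * x) := (mul_assoc x x x).symm
  have hy : Commute y (x * x) := commute_of_cube h
  obtain rfl | ⟨t, rfl⟩ | ⟨t, rfl⟩ | ⟨t, rfl⟩ := exists_of_four_le hn
  · exact ⟨0, (mul_zero _).symm, fun _ _ => ⟨0, by simp⟩⟩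
  · exact ⟨0, by rw [correctionE_one, mul_zero], fun _ _ => ⟨0, by simp⟩⟩
  · rw [correctionE_two, pow_succ' (x * x), mul_assoc (x * x), ← mul_smul_comm]
    refine ⟨_, rfl, fun _ _ => ?_⟩
    rw [mul_smul_comm, ← mul_assoc, (hx.pow_right _).eq, mul_assoc,
      ((Commute.refl (x * x)).pow_left _).eq, ← mul_smul_comm]
    exact ⟨_, rfl⟩
  · rw [correctionE_zero (commute_of_cube h), pow_succ' (x * x), mul_assoc (x * x), ← mul_smul_comm]
    refine ⟨_, rfl, fun v hv => ?_⟩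
    rw [mul_smul_comm, ← mul_assoc, (hx.pow_right _).eq, mul_assoc, mul_add, hv, ← mul_assoc x x y,
      ← mul_add, ← mul_assoc, ((Commute.refl (x * x)).pow_left _).eq, mul_assoc, ← mul_smul_comm]
    exact ⟨_, rfl⟩

theorem correctionE_eq_zero (h : y * (x * x) = x * x * y) (hx : x * x * x = 0) {n : ℕ∞}
    (hn : 4 ≤ n) : correctionE n x y = 0 := by
  have hyx : x * x * (y * x) = 0 := by rw [← mul_assoc, ← h, mul_assoc, hx, mul_zero]
  obtain rfl | ⟨t, rfl⟩ | ⟨t, rfl⟩ | ⟨t, rfl⟩ := exists_of_four_le hn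
  · rfl
  · exact correctionE_one x y t
  · rw [correctionE_two, pow_succ (x * x), mul_assoc, hx, mul_zero, smul_zero]
  · rw [correctionE_zero h, pow_succ (x * x), mul_assoc, mul_add, hyx, ← mul_assoc _ x y, hx, zero_mul,
      add_zero, mul_zero, smul_zero]

/-- The parameters of the deformation to which type `E` leads. -/
theorem exists_parameters {n : ℕ∞} (hn : 4 ≤ n) : ∃ a : Fin 3 → ℂ, -3 + a 0 ^ 2 / 4 ≠ 0 ∧
    ∀ (S : Type) [Ring S] [Algebra ℂ S] (x y : S), y * (y * y) = (-3 : ℂ) • (x * x) →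
      x * x * (x * x) = 0 →
      derivTermE n y = -(a 0 • (x * x) + a 1 • (x * x * y) + a 2 • (x * x * (y * y))) := by
  have hpow {S : Type} [Ring S] {c : S} (hc : c * c = 0) (t : ℕ) : c ^ (t + 1 + 1) = 0 := by
    rw [pow_succ, pow_succ, mul_assoc, hc, mul_zero]
  obtain rfl | ⟨t, rfl⟩ | ⟨t, rfl⟩ | ⟨t, rfl⟩ := exists_of_four_le hn
  · exact ⟨0, by norm_num, fun S _ _ x y h hc => by simp [derivTermE]⟩
  · obtain _ | t := t
    -- For n = 4, 5, 6 the derivative term is -12c, -15cy, -18cy² with c = x². For n ≥ 7 it contains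
    -- c² and vanishes.
    · refine ⟨![12, 0, 0], by norm_num, fun S _ _ x y h hc => ?_⟩
      rw [derivTermE_one h]
      norm_num
      exact .inl rfl
    · refine ⟨0, by norm_num, fun S _ _ x y h hc => ?_⟩
      rw [derivTermE_one h, hpow hc]
      simp
  · obtain _ | t := t
    · refine ⟨![0, 15, 0], by norm_num, fun S _ _ x y h hc => ?_⟩
      rw [derivTermE_two h]
      norm_num
      exact .inl rfl
    · refine ⟨0, by norm_num, fun S _ _ x y h hc => ?_⟩
      rw [derivTermE_two h, hpow hc]
      simp
  · obtain _ | t := t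
    · refine ⟨![0, 0, 18], by norm_num, fun S _ _ x y h hc => ?_⟩
      rw [derivTermE_zero h]
      norm_num
      rfl
    · refine ⟨0, by norm_num, fun S _ _ x y h hc => ?_⟩
      rw [derivTermE_zero h, hpow hc]
      simp

end NormalForm

/-! ### The quotient of type `E` -/

section

variable {S : Type} [Ring S] {x y : S}

/-- In xs - sx with s = -(y²x + yxy + xy²) the terms xyyx cancel, and so do y²x² and x²y², because y
commutes with x². -/
theorem commutator_eq_of_anticommutators {s : S} (h : y * (x * x) = x * x * y)
    (hs : y * (y * x) + y * (x * y) + x * (y * y) + s = 0) :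
    y * (x * (y * x)) - x * (y * x) * y = x * s - s * x := by
  have e : s = -(y * (y * x) + y * (x * y) + x * (y * y)) := (neg_eq_of_add_eq_zero_right hs).symm
  have h1 : y * (y * (x * x)) = x * (x * (y * y)) := by
    rw [h, ← mul_assoc, h, mul_assoc, mul_assoc]
  rw [e]
  simp only [mul_neg, neg_mul, mul_add, add_mul, mul_assoc, h1]
  abel

/-- With c = x², multiplying g = 0 by x puts c(x + yx + xy) into c²S, and δ_y f = 0 does the same
for c(y²x + yxy + xy²). These combine to (1 + y + y²)cx, whose first factor is a unit, so cx = c²r.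
Hence c² = cx·x = c²rx, and the unit 1 - rx gives c² = 0 and then cx = 0. -/
theorem mul_self_eq_zero_of_relations {s w u : S} (hx : ∀ r, x * x * r = r * (x * x))
    (hs : y * (y * x) + y * (x * y) + x * (y * y) + x * x * s = 0)
    (hg : x * x + x * (y * x) + y * (x * x) + x * x * w = 0) (hw : x * w = x * x * u)
    (hy : IsUnit (1 + y + y * y)) (hunit : ∀ r, IsUnit (1 - r * x)) : x * x * x = 0 := by
  obtain ⟨c, hc⟩ : ∃ c, c = x * x := ⟨_, rfl⟩
  rw [← hc] at hx hs hg hw ⊢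
  have hxc : x * c = c * x := (hx x).symm
  have e1 : c * (x + y * x + x * y) = c * (c * -u) := by
    have := congrArg (x * ·) hg
    simp only [mul_add, mul_zero, ← mul_assoc x c w, hxc, mul_assoc c x w, hw, ← mul_assoc x x, ← hc] at this
    rw [← mul_assoc x y c, ← hx (x * y)] at this
    rw [mul_neg, mul_neg, eq_neg_iff_add_eq_zero, ← this]
    simp only [mul_add]
  have e2 : c * (y * (y * x) + y * (x * y) + x * (y * y)) = c * (c * -s) := by
    rw [eq_neg_of_add_eq_zero_left hs, mul_neg, mul_neg, mul_neg]
  have e3 : (1 + y + y * y) * (c * x) = c * (c * (-s + u * y - u)) := by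
    have h1 : (1 + y + y * y) * (c * x) = c * (y * (y * x) + y * (x * y) + x * (y * y))
        + c * (x + y * x + x * y) - c * (x + y * x + x * y) * y := by
      rw [← mul_assoc, ← hx]
      simp only [mul_add, add_mul, mul_assoc, mul_one]
      abel
    rw [h1, e1, e2]
    simp only [mul_add, mul_sub, mul_neg, neg_mul, mul_assoc]
    abel
  obtain ⟨v, hv⟩ := hy.exists_left_inv
  have e4 : c * x = c * (c * (v * (-s + u * y - u))) := by
    have := congrArg (v * ·) e3
    simp only [← mul_assoc v, hv, one_mul] at this
    rw [this, ← hx v, mul_assoc, ← mul_assoc v, ← hx v, mul_assoc]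
  obtain ⟨r, hr⟩ : ∃ r, r = v * (-s + u * y - u) := ⟨_, rfl⟩
  rw [← hr] at e4
  have e5 : c * c * (1 - r * x) = 0 := by
    have h1 : c * c = c * (c * (r * x)) := by
      calc c * c = c * x * x := by rw [mul_assoc, ← hc]
        _ = c * (c * (r * x)) := by rw [e4]; simp only [mul_assoc]
    rw [mul_sub, mul_one, mul_assoc, ← h1, sub_self]
  have e6 : c * c = 0 := by
    obtain ⟨q, hq⟩ := (hunit r).exists_right_inv
    rw [← mul_one (c * c), ← hq, ← mul_assoc, e5, zero_mul]
  rw [e4, ← mul_assoc, e6, zero_mul]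

end

namespace NormalForm

variable {k : ℕ} {S : Type} [Ring S] [Algebra ℂ S] {n : ℕ∞} (π : NCSeries (Var k) →ₐ[ℂ] S)

theorem potE_z_eq_zero (h : ∀ i, π (cyclicDeriv i (potE k n)) = 0) (i : Fin k) :
    π (X (.z i)) = 0 := by
  have := h (.z i)
  rw [cyclicDeriv_potE_z, map_smul] at this
  exact (smul_eq_zero_iff_right two_ne_zero).mp this

theorem potE_cube (h : ∀ i, π (cyclicDeriv i (potE k n)) = 0) :
    π (X .y) * (π (X .y) * π (X .y)) = (-3 : ℂ) • (π (X .x) * π (X .x)) := by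
  have := h .x
  rw [map_cyclicDeriv_potE_x] at this
  rw [neg_smul]
  exact (neg_eq_of_add_eq_zero_right this).symm

theorem mul_gE_comm {S : Type} [Ring S] {x y : S} (h : y * (x * x) = x * x * y) {K : S} (hK : x * K = K * x) :
    (x * x + x * (y * x) + y * (x * x) + K) * x = x * (x * x + x * (y * x) + y * (x * x) + K) := by
  have e1 : x * (x * (y * x)) = y * (x * (x * x)) := by
    rw [← mul_assoc x x, ← mul_assoc (x * x), ← h, mul_assoc, mul_assoc]
  simp only [mul_add, add_mul, mul_assoc, hK, e1]
  abel

theorem commutator_gE {S : Type} [Ring S] {x y : S} (h : y * (x * x) = x * x * y) {K s : S}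
    (hs : y * (y * x) + y * (x * y) + x * (y * y) + s = 0) (hK : y * K - K * y = s * x - x * s) :
    (x * x + x * (y * x) + y * (x * x) + K) * y = y * (x * x + x * (y * x) + y * (x * x) + K) := by
  have e1 := commutator_eq_of_anticommutators h hs
  have e2 : y * (x * x + x * (y * x) + y * (x * x) + K)
      - (x * x + x * (y * x) + y * (x * x) + K) * y
      = (y * (x * (y * x)) - x * (y * x) * y) + (y * K - K * y) := by
    simp only [mul_add, add_mul, h]
    rw [← mul_assoc y (x * x) y, h]
    abel
  rw [e1, hK, sub_add_sub_cancel, sub_self, sub_eq_zero] at e2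
  exact e2.symm

theorem potE_gE_mem_center (hn : 4 ≤ n) :
    Jac.mk (potE k n) (gE k n) ∈ Subalgebra.center ℂ (Jac (potE k n)) := by
  have hrel := Jac.mkₐ_cyclicDeriv (potE k n)
  have h3 := potE_cube _ hrel
  refine Jac.mk_mem_center fun i => ?_
  rw [map_gE]
  cases i with
  | z i => rw [potE_z_eq_zero (n := n) _ hrel, mul_zero, zero_mul]
  | x => exact mul_gE_comm (commute_of_cube h3) (mul_correctionE_comm h3 hn)
  | y =>
    refine commutator_gE (commute_of_cube h3) ?_ (commutator_correctionE h3 hn)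
    rw [← map_cyclicDeriv_potE_y]
    exact hrel .y

theorem isUnit_map {f : NCSeries (Var k)} (hf : f [] ≠ 0) : IsUnit (π f) :=
  (isUnit_of_nil_ne_zero hf).map π

/-- The relations of type `E` force the quotient to be a deformation. -/
theorem deformedE6_of_relations (hn : 4 ≤ n) (hπ : Function.Surjective π)
    (hc : ∀ r, π (X .x) * π (X .x) * r = r * (π (X .x) * π (X .x)))
    (hrel : ∀ i, π (cyclicDeriv i (potE k n)) = 0) (hg : π (gE k n) = 0) {a : Fin 3 → ℂ}
    (ha : ∀ (S : Type) [Ring S] [Algebra ℂ S] (x y : S), y * (y * y) = (-3 : ℂ) • (x * x) →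
      x * x * (x * x) = 0 →
      derivTermE n y = -(a 0 • (x * x) + a 1 • (x * x * y) + a 2 • (x * x * (y * y)))) :
    DeformedE6 ![-3, 0, 0] a (π (X .x)) (π (X .y)) (π (X .x) * π (X .x)) := by
  have h3 := potE_cube π hrel
  have hs := hrel .y
  rw [map_cyclicDeriv_potE_y] at hs
  rw [map_gE] at hg
  -- The required inverses exist because these elements are images of series with constant term 1.
  have hunit (r : S) : IsUnit (1 - r * π (X .x)) := by
    obtain ⟨g, rfl⟩ := hπ r
    rw [← map_mul, ← map_one π, ← map_sub]
    exact isUnit_map π (by simp [mul_nil, one_nil, X_nil])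
  have hy : IsUnit (1 + π (X .y) + π (X .y) * π (X .y)) := by
    rw [← map_mul, ← map_one π, ← map_add, ← map_add]
    exact isUnit_map π (by simp [mul_nil, one_nil, X_nil])
  set x := π (X .x)
  set y := π (X .y)
  have hyc := commute_of_cube h3
  have hcx : x * x * x = 0 := by
    obtain ⟨s, hs'⟩ := derivTermE_eq_mul h3 hn
    obtain ⟨w, hw, hu⟩ := correctionE_eq_mul h3 hn
    rw [hs'] at hs
    rw [hw] at hg
    -- Solving g = 0 for xyx gives xyx = -x²(1 + y + w).
    obtain ⟨u, hu⟩ := hu (-(1 + y + w)) (by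
      rw [← sub_eq_zero, ← hg]
      simp only [mul_neg, mul_add, mul_one, hyc]
      abel)
    exact mul_self_eq_zero_of_relations hc hs hg hu hy hunit
  have hcc : x * x * (x * x) = 0 := by rw [← mul_assoc, hcx, zero_mul]
  refine ⟨rfl, by rw [← mul_assoc, hcx], hcx, hyc, ?_, ?_, ?_, ?_⟩
  · rw [h3, mul_smul_comm, hcc, smul_zero]
  · rw [h3]
    simp
  · rw [ha S x y h3 hcc, ← sub_eq_add_neg, sub_eq_zero] at hs
    rw [← hs]
    abel
  · rw [correctionE_eq_zero hyc hcx hn, add_zero] at hg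
    rw [← hyc, ← sub_eq_zero, ← hg]
    abel

theorem quotProj_potE_comm (s : NCSeries (Var k)) (r : QuotBy (Jac.mk (potE k n) s)) :
    quotProj (potE k n) s (X .x) * quotProj (potE k n) s (X .x) * r
      = r * (quotProj (potE k n) s (X .x) * quotProj (potE k n) s (X .x)) := by
  have hrel := Jac.mkₐ_cyclicDeriv (potE k n)
  obtain ⟨g, rfl⟩ := quotProj_surjective _ _ r
  have := Jac.mem_center (f := potE k n) (s := X .x * X .x) (fun i => by
    rw [map_mul]
    cases i with
    | z i => rw [potE_z_eq_zero (n := n) _ hrel, mul_zero, zero_mul]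
    | x => rw [mul_assoc]
    | y => exact (commute_of_cube (potE_cube _ hrel)).symm) g
  simpa only [map_mul, quotProj, AlgHom.comp_apply] using congrArg (QuotBy.mkₐ (Jac.mk (potE k n) s)) this

theorem _root_.DeformedE6.correctionE_eq_zero {S : Type} [Ring S] [Algebra ℂ S] {κ a : Fin 3 → ℂ} {x y c : S}
    (h : DeformedE6 κ a x y c) (hn : 4 ≤ n) : correctionE n x y = 0 :=
  NormalForm.correctionE_eq_zero (by rw [h.xx, h.yc]) (by rw [h.xx, h.cx]) hn

/-- The quotient and `B` both satisfy the deformed relations with the same parameters. In the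
quotient they produce the p, q of the presentation; in `B` they produce a point at which the power
series can be evaluated. -/
theorem potE_quot_equiv_of {B : Type} [Ring B] [Algebra ℂ B] (hn : 4 ≤ n) {p q : B}
    (hp : p * (p * p) = 0) (hq : q * (q * q) = 0) (hpq : (p + q) * (p + q) = 0)
    (hgen : Algebra.adjoin ℂ {p, q} = ⊤) (hlift : ∀ (S : Type) [Ring S] [Algebra ℂ S] (P R : S),
      P * (P * P) = 0 → R * (R * R) = 0 → (P + R) * (P + R) = 0 →
      ∃ φ : B →ₐ[ℂ] S, φ p = P ∧ φ q = R) :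
    Nonempty (QuotBy (Jac.mk (potE k n) (gE k n)) ≃ₐ[ℂ] B) := by
  obtain ⟨a, ha0, ha⟩ := exists_parameters hn
  set π := quotProj (potE k n) (gE k n) with hπ
  have hz (i : Fin k) : π (X (.z i)) = 0 := potE_z_eq_zero (n := n) π (quotProj_cyclicDeriv _ _) i
  have hR := deformedE6_of_relations π hn (quotProj_surjective _ _) (quotProj_potE_comm _)
    (quotProj_cyclicDeriv _ _) (quotProj_self _ _) ha
  have hletters (i : Var k) : π (X i) = 0 ∨ π (X i) = π (X .x) ∨ π (X i) = π (X .y) := by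
    cases i with
    | z i => exact .inl (hz i)
    | x => exact .inr (.inl rfl)
    | y => exact .inr (.inr rfl)
  have hwords := hR.prod_eq_zero (fun i => π (X i)) hletters
  have hgenR : Algebra.adjoin ℂ {π (X .x), π (X .y)} = ⊤ := by
    rw [eq_top_iff]
    intro r _
    obtain ⟨g, rfl⟩ := quotProj_surjective (potE k n) (gE k n) r
    change π g ∈ _
    rw [map_eq_evalTrunc π hwords g]
    refine evalTrunc_mem_subalgebra (fun i => π (X i)) (Algebra.adjoin ℂ {π (X .x), π (X .y)}) (fun i => ?_) _ _
    rcases hletters i with h | h | h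
    · rw [h]; exact zero_mem _
    · rw [h]; exact left_mem_adjoin_pair _ _
    · rw [h]; exact right_mem_adjoin_pair _ _
  obtain ⟨P, R, hP, hR', hPR, hPRgen⟩ := hR.exists_generators ha0 hgenR
  obtain ⟨φ, hφp, hφq⟩ := hlift _ P R hP hR' hPR
  have hφ : φ.range = ⊤ := by
    rw [eq_top_iff, ← hPRgen]
    refine Algebra.adjoin_le ?_
    rintro _ (rfl | rfl)
    exacts [⟨p, hφp⟩, ⟨q, hφq⟩]
  obtain ⟨x', y', c, h, hgen'⟩ := DeformedE6.exists_of_generators hp hq hpq hgen ![-3, 0, 0] a ha0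
  have hv := h.prod_eq_zero (varMap (k := k) x' y') (varMap_cases x' y')
  have hx : evalNilpotent hv (X .x) = x' := evalNilpotent_X hv .x
  have hy : evalNilpotent hv (X .y) = y' := evalNilpotent_X hv .y
  have h3 : y' * (y' * y') = (-3 : ℂ) • (x' * x') := by
    rw [h.yyy, h.xx]
    simp
  refine nonempty_quotBy_algEquiv hwords φ (fun a => hφ ▸ Algebra.mem_top) (varMap x' y') hv
    (fun i => ?_) ?_ (adjoin_range_varMap hgen')
  · cases i with
    | z i =>
      rw [cyclicDeriv_potE_z, map_smul, evalNilpotent_X]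
      exact smul_zero _
    | x =>
      rw [map_cyclicDeriv_potE_x, hx, hy, h3, ← add_smul]
      norm_num
    | y =>
      rw [map_cyclicDeriv_potE_y, hx, hy, ha B x' y' h3 (by rw [h.xx, h.cc]), h.yyx, h.xx]
      abel
  · rw [map_gE, hx, hy, h.correctionE_eq_zero hn, h.xx, h.xyx, h.yc]
    abel

theorem potE_quot_equiv (n : ℕ∞) (hn : 4 ≤ n) :
    Nonempty (QuotBy (Jac.mk (potE k n) (gE k n)) ≃ₐ[ℂ] MarkedQuiver.E₆.Contracted) := by
  obtain ⟨p, q, hp, hq, hpq, hgen, hlift⟩ := MarkedQuiver.E₆_presentation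
  exact potE_quot_equiv_of (B := MarkedQuiver.E₆.Contracted) hn hp hq hpq hgen hlift

end NormalForm

/-! ### Finiteness over power series in a central element -/

section Finiteness

variable {σ : Type} {f s : NCSeries σ}

theorem Jac.commute_of_mem_center (hs : Jac.mk f s ∈ Subalgebra.center ℂ (Jac f)) (a : Jac f) :
    Jac.mk f s * a = a * Jac.mk f s := (Subalgebra.mem_center_iff.mp hs a).symm

theorem Jac.exists_eq_sum_add (hs : Jac.mk f s ∈ Subalgebra.center ℂ (Jac f)) {ι : Type} [Fintype ι]
    {E : ι → NCSeries σ} (hE : Submodule.span ℂ (Set.range fun i => quotProj f s (E i)) = ⊤)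
    (g : NCSeries σ) : ∃ (c : ι → ℂ) (g' : NCSeries σ),
      Jac.mkₐ f g = ∑ i, c i • Jac.mkₐ f (E i) + Jac.mkₐ f s * Jac.mkₐ f g' := by
  have h : quotProj f s g ∈ Submodule.span ℂ (Set.range fun i => quotProj f s (E i)) :=
    hE ▸ Submodule.mem_top
  obtain ⟨c, hc⟩ := (Submodule.mem_span_range_iff_exists_fun ℂ).mp h
  have h0 : QuotBy.mkₐ (Jac.mk f s) (Jac.mkₐ f g - ∑ i, c i • Jac.mkₐ f (E i)) = 0 := by
    rw [map_sub, map_sum, sub_eq_zero]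
    simp only [map_smul]
    exact hc.symm
  obtain ⟨w, hw⟩ := (mem_span_singleton_of_central (Jac.commute_of_mem_center hs)).mp
    (QuotBy.mkₐ_eq_zero.mp h0)
  obtain ⟨g', rfl⟩ := Jac.mkₐ_surjective f w
  exact ⟨c, g', by rw [← sub_eq_iff_eq_add', hw]; rfl⟩

/-- Successive approximation: expand modulo s, divide the remainder by s, and repeat. The
coefficients form power series in s, and the error s ^ N * G N has order at least N, so it
disappears in the limit because the Jacobi ideal is closed. -/
theorem Jac.exists_eq_sum_subst (hs0 : s [] = 0) (hs : Jac.mk f s ∈ Subalgebra.center ℂ (Jac f))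
    {ι : Type} [Fintype ι] {E : ι → NCSeries σ}
    (hE : Submodule.span ℂ (Set.range fun i => quotProj f s (E i)) = ⊤) (a : Jac f) :
    ∃ p : ι → PowerSeries ℂ, a = ∑ i, Jac.mkₐ f (subst hs0 (p i)) * Jac.mkₐ f (E i) := by
  obtain ⟨g, rfl⟩ := Jac.mkₐ_surjective f a
  choose c g' hg' using Jac.exists_eq_sum_add hs hE
  let G : ℕ → NCSeries σ := fun n => g'^[n] g
  have hG (n : ℕ) : G (n + 1) = g' (G n) := Function.iterate_succ_apply' _ _ _
  let p : ι → PowerSeries ℂ := fun i => PowerSeries.mk fun n => c (G n) i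
  have hp (N : ℕ) (i : ι) : Polynomial.aeval s ((p i).trunc N)
      = ∑ n ∈ Finset.range N, c (G n) i • s ^ n := by
    induction N with
    | zero => simp
    | succ N ih =>
      rw [PowerSeries.trunc_succ, map_add, ih, Finset.sum_range_succ, Polynomial.aeval_monomial,
        PowerSeries.coeff_mk, Algebra.smul_def]
  have key (N : ℕ) : Jac.mkₐ f g = ∑ i, Jac.mkₐ f (Polynomial.aeval s ((p i).trunc N)) * Jac.mkₐ f (E i)
      + Jac.mkₐ f (s ^ N * G N) := by
    induction N with
    | zero => simp [G]
    | succ N ih =>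
      rw [ih, map_mul, hg' (G N), ← hG]
      simp only [hp, Finset.sum_range_succ, map_add, add_mul, Finset.sum_add_distrib, mul_add,
        map_mul, map_smul, Finset.mul_sum, smul_mul_assoc, mul_smul_comm, map_pow, pow_succ,
        mul_assoc, add_assoc]
  refine ⟨p, ?_⟩
  rw [← sub_eq_zero]
  simp only [← map_mul, ← map_sum]
  rw [← map_sub]
  refine Jac.mkₐ_eq_zero_of_agreeBelow fun N => ?_
  refine ⟨g - ∑ i, Polynomial.aeval s ((p i).trunc N) * E i - s ^ N * G N, ?_, ?_⟩
  · have := key N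
    rw [map_sub, map_sub, this, map_sum]
    simp only [map_mul]
    abel
  · have h1 : AgreeBelow N (s ^ N * G N) 0 :=
      (agreeBelow_pow hs0 N).mul_zero_zero (n := 0) (fun w hw => by omega)
    have h2 := ((AgreeBelow.refl N g).sub (AgreeBelow.sum fun i (_ : i ∈ Finset.univ) =>
      (subst_agreeBelow hs0 N (p i)).mul (AgreeBelow.refl N (E i)))).sub h1.symm
    simpa using h2

variable [Fintype σ]

/-- Power series in a central element are central. -/
theorem Jac.subst_mem_center (hs0 : s [] = 0) (hs : Jac.mk f s ∈ Subalgebra.center ℂ (Jac f))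
    (p : PowerSeries ℂ) : Jac.mkₐ f (subst hs0 p) ∈ Subalgebra.center ℂ (Jac f) := by
  refine Jac.mk_mem_center fun i => ?_
  rw [← sub_eq_zero, ← map_mul, ← map_mul, ← map_sub]
  refine Jac.mkₐ_eq_zero_of_agreeBelow fun N => ?_
  obtain ⟨q, hq⟩ : ∃ q, q = Polynomial.aeval s (p.trunc N) := ⟨_, rfl⟩
  refine ⟨q * X i - X i * q, ?_, ?_⟩
  · have : Jac.mkₐ f q ∈ Subalgebra.center ℂ (Jac f) := by
      rw [hq, ← Polynomial.aeval_algHom_apply]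
      exact Algebra.adjoin_le (Set.singleton_subset_iff.mpr hs)
        (Polynomial.aeval_mem_adjoin_singleton ℂ (Jac.mkₐ f s))
    rw [map_sub, map_mul, map_mul, Subalgebra.mem_center_iff.mp this, sub_self]
  · have h := subst_agreeBelow hs0 N p
    rw [← hq] at h
    exact (h.mul (AgreeBelow.refl _ _)).sub ((AgreeBelow.refl _ _).mul h)

/-- The centre is Noetherian. -/
theorem JacCentre.isNoetherianRing (hs0 : s [] = 0) (hs : Jac.mk f s ∈ Subalgebra.center ℂ (Jac f))
    (hfin : FiniteDimensional ℂ (QuotBy (Jac.mk f s))) : IsNoetherianRing (JacCentre f) := by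
  obtain ⟨n, e, he⟩ := Module.Finite.exists_fin (R := ℂ) (M := QuotBy (Jac.mk f s))
  choose E hE using fun i => quotProj_surjective f s (e i)
  have hE' : Submodule.span ℂ (Set.range fun i => quotProj f s (E i)) = ⊤ := by
    simp only [hE]
    exact he
  -- The centre is a submodule of Jac(f), which is finite over the Noetherian ring ℂ[[s]].
  let θ : PowerSeries ℂ →ₐ[ℂ] JacCentre f :=
    ((Jac.mkₐ f).comp (subst hs0)).codRestrict _ (Jac.subst_mem_center hs0 hs)
  let : Algebra (PowerSeries ℂ) (JacCentre f) := θ.toRingHom.toAlgebra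
  let : Module (PowerSeries ℂ) (Jac f) := Module.compHom (Jac f) θ.toRingHom
  have hfinite : Module.Finite (PowerSeries ℂ) (Jac f) := by
    classical
    refine ⟨⟨Finset.univ.image fun i => Jac.mkₐ f (E i), ?_⟩⟩
    rw [eq_top_iff]
    intro a _
    obtain ⟨p, hp⟩ := Jac.exists_eq_sum_subst hs0 hs hE' a
    rw [hp]
    refine sum_mem fun i _ => ?_
    exact Submodule.smul_mem _ (p i) (Submodule.subset_span (by simp))
  have hnoeth : IsNoetherian (PowerSeries ℂ) (Jac f) := inferInstance
  let ι : JacCentre f →ₗ[PowerSeries ℂ] Jac f :=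
    { toFun := Subtype.val, map_add' := fun _ _ => rfl, map_smul' := fun _ _ => rfl }
  have : IsNoetherian (PowerSeries ℂ) (JacCentre f) := isNoetherian_of_injective ι Subtype.val_injective
  exact isNoetherian_of_tower (PowerSeries ℂ) this

end Finiteness

/-! ### Generic central elements -/

section Generic

variable {σ : Type} {f : NCSeries σ}

/-- The augmentation of a Jacobi algebra whose relations have no constant terms. -/
theorem Jac.exists_augmentation (hf : ∀ i, cyclicDeriv i f [] = 0) :
    ∃ ε : Jac f →ₐ[ℂ] ℂ, ∀ g, ε (Jac.mkₐ f g) = g [] :=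
  Jac.exists_lift f constTerm (N := 1) (fun g g' h => h [] (by simp)) hf

theorem Jac.isUnit_of_augmentation_ne_zero {ε : Jac f →ₐ[ℂ] ℂ} (hε : ∀ g, ε (Jac.mkₐ f g) = g [])
    {a : Jac f} (ha : ε a ≠ 0) : IsUnit a := by
  obtain ⟨g, rfl⟩ := Jac.mkₐ_surjective f a
  rw [hε] at ha
  exact (isUnit_of_nil_ne_zero ha).map _

theorem JacCentre.isUnit_of_isUnit {z : JacCentre f} (hz : IsUnit (z : Jac f)) : IsUnit z := by
  obtain ⟨w, h1, h2⟩ := isUnit_iff_exists.mp hz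
  have hw : w ∈ Subalgebra.center ℂ (Jac f) := by
    rw [Subalgebra.mem_center_iff]
    intro b
    have hb := Subalgebra.mem_center_iff.mp z.2 b
    calc b * w = w * z * b * w := by rw [h2, one_mul]
      _ = w * b * (z * w) := by rw [mul_assoc w, ← hb]; simp only [mul_assoc]
      _ = w * b := by rw [h1, mul_one]
  exact isUnit_iff_exists.mpr ⟨⟨w, hw⟩, Subtype.ext h1, Subtype.ext h2⟩

theorem mem_centreRadical {ε : Jac f →ₐ[ℂ] ℂ} (hε : ∀ g, ε (Jac.mkₐ f g) = g []) (z : JacCentre f) :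
    z ∈ centreRadical f ↔ ε z = 0 := by
  rw [centreRadical, ← Ideal.jacobson_bot]
  refine (Ideal.mem_jacobson_bot (R := JacCentre f)).trans ?_
  constructor
  · intro h
    by_contra hz
    -- If ε z ≠ 0, then 1 - z/ε(z) would be a unit although its constant term is zero.
    have h1 := (((h (algebraMap ℂ _ (-(ε z)⁻¹))).map (Subalgebra.center ℂ (Jac f)).val).map ε).ne_zero
    apply h1
    change ε (z * algebraMap ℂ (Jac f) (-(ε z)⁻¹) + 1) = 0
    rw [map_add, map_mul, map_one, AlgHom.commutes, Algebra.algebraMap_self_apply, mul_neg,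
      mul_inv_cancel₀ hz, neg_add_cancel]
  · intro h y
    refine JacCentre.isUnit_of_isUnit (Jac.isUnit_of_augmentation_ne_zero hε ?_)
    change ε (z * y + 1) ≠ 0
    rw [map_add, map_mul, h, zero_mul, zero_add, map_one]
    exact one_ne_zero

/-- The cotangent space is finitely generated over the Noetherian centre, which acts on it through
its residue field ℂ, since z - ε(z) lies in the radical. -/
theorem finiteDimensional_cotangent [Fintype σ] {s : NCSeries σ} (hf : ∀ i, cyclicDeriv i f [] = 0)
    (hs0 : s [] = 0) (hs : Jac.mk f s ∈ Subalgebra.center ℂ (Jac f))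
    (hfin : FiniteDimensional ℂ (QuotBy (Jac.mk f s))) :
    FiniteDimensional ℂ (centreRadical f).Cotangent := by
  obtain ⟨ε, hε⟩ := Jac.exists_augmentation hf
  have := JacCentre.isNoetherianRing hs0 hs hfin
  have : IsNoetherian (JacCentre f) (JacCentre f) := this
  have : IsNoetherian (JacCentre f) (centreRadical f) := inferInstance
  have : IsNoetherian (JacCentre f) (centreRadical f).Cotangent :=
    isNoetherian_of_surjective (centreRadical f).toCotangent
      (LinearMap.range_eq_top.mpr (Ideal.toCotangent_surjective _))
  obtain ⟨G, hG⟩ : (⊤ : Submodule (JacCentre f) (centreRadical f).Cotangent).FG := Module.Finite.fg_top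
  refine ⟨⟨G, ?_⟩⟩
  rw [eq_top_iff]
  intro v _
  have hv : v ∈ Submodule.span (JacCentre f) (G : Set (centreRadical f).Cotangent) := hG ▸ Submodule.mem_top
  induction hv using Submodule.span_induction with
  | mem x h => exact Submodule.subset_span h
  | zero => exact zero_mem _
  | add x y _ _ hx hy => exact add_mem (hx trivial) (hy trivial)
  | smul z x _ hx =>
    have h0 : (z - algebraMap ℂ (JacCentre f) (ε z)) • x = 0 := by
      refine Ideal.Cotangent.smul_eq_zero_of_mem ?_ x
      rw [mem_centreRadical hε]
      change ε (z - algebraMap ℂ (Jac f) (ε z)) = 0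
      rw [map_sub, AlgHom.commutes, Algebra.algebraMap_self_apply, sub_self]
    rw [sub_smul, sub_eq_zero, algebraMap_smul] at h0
    rw [h0]
    exact Submodule.smul_mem _ _ (hx trivial)

theorem quotBy_algEquiv_of_eq_mul_unit {A B : Type} [Ring A] [Algebra ℂ A] [Ring B] [Algebra ℂ B]
    {s u w : A} (hw : IsUnit w) (hu : u = s * w) (h : Nonempty (QuotBy s ≃ₐ[ℂ] B)) :
    Nonempty (QuotBy u ≃ₐ[ℂ] B) := by
  have e : TwoSidedIdeal.span {u} = TwoSidedIdeal.span {s} := by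
    apply le_antisymm
    · rw [TwoSidedIdeal.span_le]
      rintro _ rfl
      rw [hu]
      exact TwoSidedIdeal.mul_mem_right _ _ _ (TwoSidedIdeal.subset_span rfl)
    · rw [TwoSidedIdeal.span_le, Set.singleton_subset_iff]
      obtain ⟨v, hv⟩ := hw.exists_right_inv
      have : s = u * v := by rw [hu, mul_assoc, hv, mul_one]
      have hm : u * v ∈ TwoSidedIdeal.span {u} :=
        TwoSidedIdeal.mul_mem_right _ _ _ (TwoSidedIdeal.subset_span rfl)
      exact this ▸ hm
  change Nonempty (TwoSidedQuot (TwoSidedIdeal.span {u}) ≃ₐ[ℂ] B)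
  rw [e]
  exact h

/-- If every central element without constant term is a multiple of `s`, then a generic one is a
unit multiple of `s`. -/
theorem hasType_of_forall_eq_mul {s : NCSeries σ} {Q : MarkedQuiver}
    (hf : ∀ i, cyclicDeriv i f [] = 0) (hs0 : s [] = 0)
    (hs : Jac.mk f s ∈ Subalgebra.center ℂ (Jac f))
    (hQ : Nonempty (QuotBy (Jac.mk f s) ≃ₐ[ℂ] Q.Contracted))
    (hmul : ∀ g, Jac.mk f g ∈ Subalgebra.center ℂ (Jac f) → g [] = 0 →
      ∃ w, Jac.mk f g = Jac.mk f s * w) : HasType f Q := by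
  obtain ⟨ε, hε⟩ := Jac.exists_augmentation hf
  obtain ⟨t, ht⟩ : ∃ t, t = Jac.mk f s := ⟨_, rfl⟩
  have htε : ε t = 0 := by rw [ht, ← Jac.mkₐ_apply, hε, hs0]
  rw [← ht] at hs hQ hmul
  have hm (z : centreRadical f) : ∃ w, (z.1.1 : Jac f) = t * w := by
    obtain ⟨⟨a, ha⟩, hz⟩ := z
    obtain ⟨g, rfl⟩ := Jac.mkₐ_surjective f a
    rw [mem_centreRadical hε, hε] at hz
    exact hmul g ha hz
  choose w hw using hm
  intro V _ hV
  -- If s = 0 in Jac(f), the radical of the centre is zero and all of V works.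
  by_cases ht0 : t = 0
  · refine ⟨Set.univ, ⟨{1}, by ext; simp⟩, ⟨0, trivial⟩, fun u _ => ?_⟩
    have : (u.1.1.1 : Jac f) = t := by rw [hw, ht0, zero_mul]
    rw [this]
    exact hQ
  -- The cofactor of t is not unique, but its constant term is: if it differed, t would be
  -- annihilated by a unit.
  have hinj {a b : Jac f} (h : t * a = t * b) : ε a = ε b := by
    by_contra hab
    obtain ⟨v, hv⟩ := (Jac.isUnit_of_augmentation_ne_zero hε (a := a - b)
      (by rwa [map_sub, sub_ne_zero])).exists_right_inv
    refine ht0 ?_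
    rw [← mul_one t, ← hv, ← mul_assoc, mul_sub, h, sub_self, zero_mul]
  let l : centreRadical f →ₗ[ℂ] ℂ :=
    { toFun := fun z => ε (w z)
      map_add' := fun z z' => by
        rw [← map_add]
        refine hinj ?_
        rw [← hw, mul_add, ← hw, ← hw]
        rfl
      map_smul' := fun c z => by
        rw [RingHom.id_apply, ← map_smul]
        refine hinj ?_
        rw [← hw, mul_smul_comm, ← hw]
        rfl }
  have hl {z : centreRadical f} {a : Jac f} (h : (z.1.1 : Jac f) = t * a) : l z = ε a :=
    hinj ((hw z).symm.trans h)
  have hsq (x : JacCentre f) (hx : x ∈ centreRadical f ^ 2) :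
      ∃ a, (x : Jac f) = t * a ∧ ε a = 0 := by
    rw [pow_two] at hx
    induction hx using Submodule.mul_induction_on' with
    | mem_mul_mem m hm n hn =>
      refine ⟨w ⟨m, hm⟩ * n, ?_, ?_⟩
      · rw [← mul_assoc, ← hw]
        rfl
      · rw [map_mul, (mem_centreRadical hε n).mp hn, mul_zero]
    | add x _ y _ hx hy =>
      obtain ⟨a, ha, ha'⟩ := hx
      obtain ⟨b, hb, hb'⟩ := hy
      refine ⟨a + b, ?_, by rw [map_add, ha', hb', add_zero]⟩
      rw [mul_add, ← ha, ← hb]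
      rfl
  refine ⟨{v | l v ≠ 0}, ⟨{MvPolynomial.X (l.comp V.subtype)}, by ext; simp⟩, ?_, fun u hu => ?_⟩
  -- Some v in V agrees with t modulo the square of the radical, where the functional vanishes; so
  -- its value at v is 1.
  · have htm : (⟨t, hs⟩ : JacCentre f) ∈ centreRadical f := (mem_centreRadical hε _).mpr htε
    obtain ⟨v, hv⟩ := hV ((centreRadical f).toCotangent ⟨_, htm⟩)
    obtain ⟨a, ha, ha'⟩ := hsq _ ((Ideal.toCotangent_eq _).mp hv)
    refine ⟨v, ?_⟩
    have : (v.1.1.1 : Jac f) = t * (a + 1) := by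
      rw [mul_add, mul_one, ← ha]
      exact (sub_add_cancel _ _).symm
    rw [Set.mem_ofPred_eq, hl this, map_add, ha', map_one, zero_add]
    exact one_ne_zero
  · exact quotBy_algEquiv_of_eq_mul_unit (B := Q.Contracted) (Jac.isUnit_of_augmentation_ne_zero hε hu) (hw u.1) hQ

end Generic

namespace NormalForm

variable {k : ℕ}

/-! ### Generic central elements in type `A` -/

theorem cyclicDeriv_potA_nil {n : ℕ∞} (hn : 2 ≤ n) (i : Var k) : cyclicDeriv i (potA k n) [] = 0 := by
  change constTerm (cyclicDeriv i (potA k n)) = 0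
  have hX (a : Var k) : constTerm (X a : NCSeries (Var k)) = 0 := X_nil a
  cases i with
  | z i => rw [cyclicDeriv_potA_z, map_smul, hX, smul_zero]
  | x => rw [cyclicDeriv_potA_x, map_smul, x, hX, smul_zero]
  | y =>
    rw [cyclicDeriv_potA_y]
    induction n using ENat.recTopCoe with
    | top => exact map_zero _
    | coe n =>
      have hn' : 2 ≤ n := by exact_mod_cast hn
      rw [ENat.recTopCoe_natCast, map_smul, map_pow, y, hX, zero_pow (by omega), smul_zero]

theorem potA_finiteDimensional (n : ℕ∞) : FiniteDimensional ℂ (QuotBy (Jac.mk (potA k n) (y k))) :=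
  finiteDimensional_of_prod_eq_zero _ (quotProj_surjective _ _)
    (prod_map_eq_zero_of_forall (potA_quot_letter n))

theorem potA_cotangent {n : ℕ∞} (hn : 2 ≤ n) :
    FiniteDimensional ℂ (centreRadical (potA k n)).Cotangent :=
  finiteDimensional_cotangent (cyclicDeriv_potA_nil hn) (X_nil _) (potA_y_mem_center n)
    (potA_finiteDimensional n)

/-- All letters except y vanish in the Jacobi algebra, so a series without constant term is y times
the series obtained by striking off y. -/
theorem potA_hasType {n : ℕ∞} (hn : 2 ≤ n) : HasType (potA k n) MarkedQuiver.A₁ := by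
  refine hasType_of_forall_eq_mul (cyclicDeriv_potA_nil hn) (X_nil _) (potA_y_mem_center n)
    (potA_quot_equiv n hn) fun g _ hg => ⟨Jac.mkₐ _ (strike .y g), ?_⟩
  have hrel := Jac.mkₐ_cyclicDeriv (potA k n)
  change Jac.mkₐ _ g = Jac.mkₐ _ (y k) * _
  conv_lhs => rw [eq_const_add_sum g]
  rw [hg, zero_smul, zero_add, map_sum, Finset.sum_eq_single Var.y, map_mul]
  · rfl
  · intro a _ ha
    cases a with
    | z i => rw [map_mul, potA_z_eq_zero (n := n) _ hrel, zero_mul]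
    | x => rw [map_mul, potA_x_eq_zero (n := n) _ hrel, zero_mul]
    | y => exact absurd rfl ha
  · simp

/-! ### Generic central elements in type `D` -/

section Representation

variable {S : Type} [Ring S] [Algebra ℂ S] {x y : S} {c : ℂ}

theorem words_eq_zero (hx : x * (x * x) = 0) (hyx : y * x = -(x * y)) (hy : y * y = c • (x * x))
    {σ : Type} {v : σ → S} (hv : ∀ a, v a = 0 ∨ v a = x ∨ v a = y) (l : List σ)
    (hl : 4 ≤ l.length) : (l.map v).prod = 0 := by
  have hxw (w : S) : x * (x * (x * w)) = 0 := by
    rw [← mul_assoc x x w, ← mul_assoc, hx, zero_mul]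
  have hyxw (w : S) : y * (x * w) = -(x * (y * w)) := by
    rw [← mul_assoc, hyx, neg_mul, mul_assoc]
  let G : ℕ → Submodule ℂ S
    | 0 => Submodule.span ℂ {1}
    | 1 => Submodule.span ℂ {x, y}
    | 2 => Submodule.span ℂ {x * x, x * y}
    | 3 => Submodule.span ℂ {x * (x * y)}
    | _ + 4 => ⊥
  have hG : ∀ a n, G n ≤ (G (n + 1)).comap (LinearMap.mulLeft ℂ (v a)) := by
    intro a n
    rcases hv a with h | h | h
    · intro m _
      rw [Submodule.mem_comap, LinearMap.mulLeft_apply, h, zero_mul]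
      exact zero_mem _
    all_goals
      rw [h]
      match n with
      | 0 =>
        refine Submodule.span_le.mpr ?_
        rintro _ rfl
        simp only [SetLike.mem_coe, Submodule.mem_comap, LinearMap.mulLeft_apply, mul_one]
        exact Submodule.subset_span (by simp)
      | 1 =>
        refine Submodule.span_le.mpr ?_
        rintro _ (rfl | rfl)
        all_goals
          simp only [SetLike.mem_coe, Submodule.mem_comap, LinearMap.mulLeft_apply, hy, hyx]
          first
            | exact neg_mem (Submodule.subset_span (by simp))
            | exact Submodule.smul_mem _ c (Submodule.subset_span (by simp))
            | exact Submodule.subset_span (by simp)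
      | 2 =>
        refine Submodule.span_le.mpr ?_
        rintro _ (rfl | rfl)
        all_goals
          simp only [SetLike.mem_coe, Submodule.mem_comap, LinearMap.mulLeft_apply, hx, hy, hyx, hyxw,
            mul_neg, neg_neg, mul_smul_comm, smul_zero, neg_zero]
          first
            | exact zero_mem _
            | exact Submodule.subset_span rfl
      | 3 =>
        refine Submodule.span_le.mpr ?_
        rintro _ rfl
        simp only [SetLike.mem_coe, Submodule.mem_comap, LinearMap.mulLeft_apply, hxw, hyxw, hy,
          mul_neg, neg_neg, mul_smul_comm, hx, mul_zero, smul_zero]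
        exact zero_mem _
      | n + 4 =>
        intro m hm
        obtain rfl : m = 0 := hm
        simp
  have := prod_mem_filtration v G (Submodule.subset_span rfl) hG l
  obtain ⟨n, hn⟩ := Nat.exists_eq_add_of_le' hl
  rw [hn] at this
  exact this

/-- An algebra in which `x² y ≠ 0` although `x³ = 0`. -/
theorem exists_representation (c : ℂ) : ∃ (S : Type) (_ : Ring S) (_ : Algebra ℂ S) (x y : S),
    x * (x * x) = 0 ∧ y * x = -(x * y) ∧ y * y = c • (x * x) ∧ x * (x * y) ≠ 0 := by
  -- A nilpotent Jordan block with t³ = 0 ≠ t². The sign in diag(t, -t) produces anticommutation,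
  -- and the corner entry ct² produces y² = cx².
  let t : Matrix (Fin 3) (Fin 3) ℂ := !![0, 0, 0; 1, 0, 0; 0, 1, 0]
  have ht3 : t * (t * t) = 0 := by
    simp [t]
    ext i j; fin_cases i <;> fin_cases j <;> rfl
  have ht2 : t * t ≠ 0 := fun h => by simpa [t] using congrFun (congrFun h 2) 0
  refine ⟨Matrix (Fin 2) (Fin 2) (Matrix (Fin 3) (Fin 3) ℂ), inferInstance, inferInstance,
    !![t, 0; 0, -t], !![0, c • (t * t); 1, 0], ?_, ?_, ?_, fun h => ht2 ?_⟩
  · ext1 i j; fin_cases i <;> fin_cases j <;> simp [ht3]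
  · ext1 i j; fin_cases i <;> fin_cases j <;> simp [ht3, mul_assoc]
  · ext1 i j; fin_cases i <;> fin_cases j <;> simp
  · have := congrFun (congrFun h 1) 0
    simpa using this

/-- In such an algebra, the central elements are sums of a scalar and a multiple of `x²`. -/
theorem coefficients_eq_zero (hx : x * (x * x) = 0) (hyx : y * x = -(x * y))
    (hy : y * y = c • (x * x)) (hne : x * (x * y) ≠ 0) {z w : S} {a₀ a₁ b₀ b₁ : ℂ}
    (hz : z = a₀ • 1 + a₁ • x + b₀ • y + b₁ • (x * y) + x * x * w) (hzx : z * x = x * z)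
    (hzy : z * y = y * z) (hwx : x * x * w * x = 0) (hwy : x * x * w * y = y * (x * x * w)) :
    a₁ = 0 ∧ b₀ = 0 ∧ b₁ = 0 := by
  have hxyw (u : S) : y * (x * u) = -(x * (y * u)) := by
    rw [← mul_assoc, hyx, neg_mul, mul_assoc]
  have hxw (u : S) : x * (x * (x * u)) = 0 := by
    rw [← mul_assoc x x u, ← mul_assoc, hx, zero_mul]
  have hxxw : x * (x * x * w) = 0 := by simp only [mul_assoc, hxw]
  -- The commutator of x and z sees only the terms y and xy, and that of z and y only the term x.
  -- Multiplying `e1` by x then separates b₀ from b₁, since x³ = 0 and x²y ≠ 0.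
  have e1 : (2 * b₀) • (x * y) + (2 * b₁) • (x * (x * y)) = 0 := by
    have h1 : x * z - z * x = (2 * b₀) • (x * y) + (2 * b₁) • (x * (x * y)) := by
      rw [hz]
      simp only [mul_add, add_mul, hwx, hxxw]
      simp only [mul_smul_comm, smul_mul_assoc, mul_one, one_mul, mul_assoc, hyx, mul_neg]
      module
    rw [← h1, hzx, sub_self]
  have e2 : (2 * a₁) • (x * y) = 0 := by
    have h1 : z * y - y * z = (2 * a₁) • (x * y) := by
      rw [hz]
      simp only [mul_add, add_mul, hwy]
      simp only [mul_smul_comm, smul_mul_assoc, mul_one, one_mul, mul_assoc, hyx, hxyw, mul_neg, hy,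
        hx, smul_zero]
      module
    rw [← h1, hzy, sub_self]
  have cancel {r : ℂ} {u : S} (hu : u ≠ 0) (h : (2 * r) • u = 0) : r = 0 := by
    simpa [hu] using h
  have hxy : x * y ≠ 0 := fun h => hne (by rw [h, mul_zero])
  have hb₀ : b₀ = 0 := by
    have := congrArg (x * ·) e1
    simp only [mul_add, mul_smul_comm, hxw, smul_zero, add_zero, mul_zero] at this
    exact cancel hne this
  rw [hb₀, mul_zero, zero_smul, zero_add] at e1
  exact ⟨cancel hxy e2, hb₀, cancel hne e1⟩

end Representation

variable {n m : ℕ∞}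

theorem cyclicDeriv_potD_nil (hn : 2 ≤ n) (hm : 2 ≤ m) (i : Var k) :
    cyclicDeriv i (potD k n m) [] = 0 := by
  change constTerm (cyclicDeriv i (potD k n m)) = 0
  have hX (a : Var k) : constTerm (X a : NCSeries (Var k)) = 0 := X_nil a
  cases i with
  | z i => rw [cyclicDeriv_potD_z, map_smul, hX, smul_zero]
  | x => rw [map_cyclicDeriv_potD_x _ hn hm (by rw [hX, zero_mul]), hX, zero_mul]
  | y => rw [cyclicDeriv_potD_y, map_add, map_mul, map_mul, x, hX, mul_zero, zero_mul, add_zero]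

theorem x_sq_nil : (x k ^ 2) [] = 0 := by
  rw [pow_two, mul_nil, x, X_nil, zero_mul]

theorem potD_quot_words (hn : 2 ≤ n) (hm : 2 ≤ m) (l : List (Var k)) (hl : 3 ≤ l.length) :
    (l.map fun a => quotProj (potD k n m) (x k ^ 2) (X a)).prod = 0 := by
  obtain ⟨hxx, hyy, hyx⟩ := potD_quot_relations hn hm _ (quotProj_cyclicDeriv _ _)
    (quotProj_self (potD k n m) (x k ^ 2))
  exact prod_map_eq_zero_of_anticommute hxx hyy hyx
    (potD_letters _ (quotProj_cyclicDeriv (potD k n m) (x k ^ 2))) l hl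

theorem potD_finiteDimensional (hn : 2 ≤ n) (hm : 2 ≤ m) :
    FiniteDimensional ℂ (QuotBy (Jac.mk (potD k n m) (x k ^ 2))) :=
  finiteDimensional_of_prod_eq_zero _ (quotProj_surjective _ _) (potD_quot_words hn hm)

theorem potD_cotangent (hn : 2 ≤ n) (hm : 2 ≤ m) :
    FiniteDimensional ℂ (centreRadical (potD k n m)).Cotangent :=
  finiteDimensional_cotangent (cyclicDeriv_potD_nil hn hm) x_sq_nil (potD_xx_mem_center n m)
    (potD_finiteDimensional hn hm)

/-- Modulo x² the span of 1, x, y, xy contains 1 and is stable under left multiplication by the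
letters, so it is everything; the difference from such a combination is a multiple of the central
element x². -/
theorem potD_normal_form (hn : 2 ≤ n) (hm : 2 ≤ m) (g : NCSeries (Var k)) :
    ∃ (a₀ a₁ b₀ b₁ : ℂ) (w : NCSeries (Var k)), Jac.mkₐ (potD k n m) g
      = Jac.mkₐ (potD k n m) (a₀ • 1 + a₁ • X .x + b₀ • X .y + b₁ • (X .x * X .y)
        + X .x * X .x * w) := by
  set π := quotProj (potD k n m) (x k ^ 2) with hπ
  obtain ⟨hxx, hyy, hyx⟩ := potD_quot_relations hn hm π (quotProj_cyclicDeriv _ _)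
    (quotProj_self (potD k n m) (x k ^ 2))
  have hyx' := eq_neg_of_add_eq_zero_left hyx
  obtain ⟨W, hW⟩ : ∃ W : Submodule ℂ _, W = Submodule.span ℂ
      {1, π (X .x), π (X .y), π (X .x) * π (X .y)} := ⟨_, rfl⟩
  have h1 : 1 ∈ W := hW ▸ Submodule.subset_span (by simp)
  have hx : π (X .x) ∈ W := hW ▸ Submodule.subset_span (by simp)
  have hy : π (X .y) ∈ W := hW ▸ Submodule.subset_span (by simp)
  have hxy : π (X .x) * π (X .y) ∈ W := hW ▸ Submodule.subset_span (by simp)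
  have hstable (a : Var k) (u) (hu : u ∈ W) : π (X a) * u ∈ W := by
    rcases potD_letters π (quotProj_cyclicDeriv _ _) a with h | h | h
    · rw [h, zero_mul]; exact zero_mem _
    · rw [h]
      have : W ≤ W.comap (LinearMap.mulLeft ℂ (π (X .x))) := by
        conv_lhs => rw [hW]
        rw [Submodule.span_le]
        rintro _ (rfl | rfl | rfl | rfl)
        · simpa using hx
        · simp [hxx]
        · simpa using hxy
        · simp [← mul_assoc, hxx]
      exact this hu
    · rw [h]
      have : W ≤ W.comap (LinearMap.mulLeft ℂ (π (X .y))) := by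
        conv_lhs => rw [hW]
        rw [Submodule.span_le]
        rintro _ (rfl | rfl | rfl | rfl)
        · simpa using hy
        · simpa [hyx'] using hxy
        · simp [hyy]
        · simp [← mul_assoc, hyx']
          simp [mul_assoc, hyy]
      exact this hu
  have hg : π g ∈ W := by
    rw [map_eq_evalTrunc π (potD_quot_words hn hm) g]
    exact evalTrunc_mem _ W h1 hstable _ _
  rw [hW] at hg
  obtain ⟨a₀, u, hu, e0⟩ := Submodule.mem_span_insert.mp hg
  obtain ⟨a₁, u', hu', e1⟩ := Submodule.mem_span_insert.mp hu
  obtain ⟨b₀, b₁, e2⟩ := Submodule.mem_span_pair.mp hu'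
  obtain ⟨h, hh⟩ : ∃ h : NCSeries (Var k),
      h = a₀ • 1 + a₁ • X .x + b₀ • X .y + b₁ • (X .x * X .y) := ⟨_, rfl⟩
  have h0 : QuotBy.mkₐ (Jac.mk (potD k n m) (x k ^ 2)) (Jac.mkₐ (potD k n m) (g - h)) = 0 := by
    change π (g - h) = 0
    rw [map_sub, sub_eq_zero, e0, e1, ← e2, hh]
    simp only [map_add, map_smul, map_mul, map_one, add_assoc]
  obtain ⟨w, hw⟩ := (mem_span_singleton_of_central
    (Jac.commute_of_mem_center (potD_xx_mem_center n m))).mp (QuotBy.mkₐ_eq_zero.mp h0)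
  obtain ⟨w, rfl⟩ := Jac.mkₐ_surjective _ w
  refine ⟨a₀, a₁, b₀, b₁, w, ?_⟩
  rw [← hh, map_add, ← sub_eq_iff_eq_add', ← map_sub, hw, ← Jac.mkₐ_apply, ← map_mul, pow_two]
  rfl

theorem exists_map_cyclicDeriv_potD_x (hn : 2 ≤ n) (hm : 2 ≤ m) : ∃ c : ℂ,
    ∀ (S : Type) [Ring S] [Algebra ℂ S] (π : NCSeries (Var k) →ₐ[ℂ] S),
      π (X .x) * (π (X .x) * π (X .x)) = 0 →
      π (cyclicDeriv .x (potD k n m)) = π (X .y) * π (X .y) - c • (π (X .x) * π (X .x)) := by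
  have hp {S : Type} [Ring S] {x : S} (hx : x * (x * x) = 0) (j : ℕ) (hj : 3 ≤ j) : x ^ j = 0 :=
    pow_eq_zero_of_le hj (by rw [pow_succ, pow_two, mul_assoc, hx])
  -- When x³ = 0, the only power that survives in δ_x f is 3x², from m = 2.
  refine ⟨if m = 2 then -3 else 0, fun S _ _ π hx => ?_⟩
  have h1 : π (ENat.recTopCoe 0 (fun n : ℕ => ((2 * n : ℕ) : ℂ) • x k ^ (2 * n - 1)) n) = 0 := by
    induction n using ENat.recTopCoe with
    | top => exact map_zero _
    | coe n =>
      have hn' : 2 ≤ n := by exact_mod_cast hn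
      rw [ENat.recTopCoe_natCast, map_smul, map_pow, x, hp hx _ (by omega), smul_zero]
  have h2 : π (ENat.recTopCoe 0 (fun m : ℕ => ((2 * m - 1 : ℕ) : ℂ) • x k ^ (2 * m - 1 - 1)) m)
      = -((if m = 2 then -3 else 0 : ℂ) • (π (X .x) * π (X .x))) := by
    induction m using ENat.recTopCoe with
    | top => simp
    | coe m =>
      have hm' : 2 ≤ m := by exact_mod_cast hm
      rw [ENat.recTopCoe_natCast, map_smul, map_pow, x]
      split_ifs with h
      · obtain rfl : m = 2 := by exact_mod_cast h
        simp [pow_two]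
      · have : m ≠ 2 := fun e => h (by rw [e]; rfl)
        rw [hp hx _ (by omega), smul_zero, zero_smul, neg_zero]
  rw [cyclicDeriv_potD_x, map_add, map_add, h1, h2, add_zero, ← sub_eq_add_neg, map_mul]
  rfl

theorem potD_hasType (hn : 2 ≤ n) (hm : 2 ≤ m) : HasType (potD k n m) MarkedQuiver.D₄ := by
  refine hasType_of_forall_eq_mul (cyclicDeriv_potD_nil hn hm) x_sq_nil (potD_xx_mem_center n m)
    (potD_quot_equiv n m hn hm) fun g hg hg0 => ?_
  obtain ⟨c, hc⟩ := exists_map_cyclicDeriv_potD_x (k := k) hn hm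
  obtain ⟨S, _, _, x', y', hx, hyx, hy, hne⟩ := exists_representation c
  have hv := words_eq_zero hx hyx hy (varMap_cases (k := k) x' y')
  have hX : evalNilpotent hv (X .x) = x' := evalNilpotent_X hv .x
  have hY : evalNilpotent hv (X .y) = y' := evalNilpotent_X hv .y
  obtain ⟨ρ, hρ⟩ := Jac.exists_lift (potD k n m) (evalNilpotent hv)
    (fun _ _ h => evalNilpotent_congr hv h) (fun i => by
      cases i with
      | z i =>
        rw [cyclicDeriv_potD_z, map_smul, evalNilpotent_X]
        exact smul_zero _
      | x => rw [hc _ _ (by rw [hX, hx]), hX, hY, hy, sub_self]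
      | y =>
        rw [cyclicDeriv_potD_y, map_add, map_mul, map_mul, x, y, hX, hY, hyx, neg_add_cancel])
  obtain ⟨a₀, a₁, b₀, b₁, w, hw⟩ := potD_normal_form hn hm g
  have hcomm (b : NCSeries (Var k)) :
      evalNilpotent hv g * evalNilpotent hv b = evalNilpotent hv b * evalNilpotent hv g := by
    rw [← hρ, ← hρ, ← map_mul ρ, ← map_mul ρ]
    exact congrArg ρ (Subalgebra.mem_center_iff.mp hg (Jac.mkₐ _ b)).symm
  have hz := congrArg ρ hw
  rw [hρ, hρ] at hz
  simp only [map_add, map_smul, map_mul, map_one, hX, hY] at hz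
  have hxw (u : S) : x' * (x' * (x' * u)) = 0 := by
    rw [← mul_assoc x' x' u, ← mul_assoc, hx, zero_mul]
  have hxxy : x' * x' * y' = y' * (x' * x') := by
    rw [← mul_assoc y', hyx, neg_mul, mul_assoc x' y', hyx, mul_neg, neg_neg, mul_assoc]
  have hcomm2 : x' * x' * evalNilpotent hv w * x' = 0 ∧
      x' * x' * evalNilpotent hv w * y' = y' * (x' * x' * evalNilpotent hv w) := by
    -- The elements u for which x²u is killed by x on the right and commutes with y form a subspace
    -- containing 1 and stable under left multiplication by the letters; hence it contains every
    -- value of truncated evaluation.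
    let W : Submodule ℂ S :=
      { carrier := {u | x' * x' * u * x' = 0 ∧ x' * x' * u * y' = y' * (x' * x' * u)}
        zero_mem' := by simp
        add_mem' := fun {u v} hu hv => by
          refine ⟨?_, ?_⟩
          · rw [mul_add, add_mul, hu.1, hv.1, add_zero]
          · rw [mul_add, add_mul, hu.2, hv.2, mul_add]
        smul_mem' := fun r u hu => by
          refine ⟨?_, ?_⟩
          · rw [mul_smul_comm, smul_mul_assoc, hu.1, smul_zero]
          · rw [mul_smul_comm, smul_mul_assoc, hu.2, mul_smul_comm] }
    have hW : evalTrunc (varMap x' y') 4 w ∈ W := by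
      refine evalTrunc_mem _ W ⟨by rw [mul_one, mul_assoc, hx], by rw [mul_one, hxxy]⟩
        (fun a u hu => ?_) _ _
      rcases varMap_cases (k := k) x' y' a with h | h | h
      · rw [h, zero_mul]
        exact zero_mem _
      · rw [h]
        have : x' * x' * (x' * u) = 0 := by rw [mul_assoc, hxw]
        exact ⟨by rw [this, zero_mul], by rw [this, zero_mul, mul_zero]⟩
      · rw [h]
        have : x' * x' * (y' * u) = y' * (x' * x' * u) := by rw [← mul_assoc, hxxy, mul_assoc]
        exact ⟨by rw [this, mul_assoc, hu.1, mul_zero], by rw [this, mul_assoc y', hu.2]⟩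
    exact hW
  have hgx := hcomm (X .x)
  have hgy := hcomm (X .y)
  rw [hX] at hgx
  rw [hY] at hgy
  obtain ⟨h1, h2, h3⟩ := coefficients_eq_zero hx hyx hy hne hz hgx hgy hcomm2.1 hcomm2.2
  -- The representation gives no information on a₀; it is the constant term of g.
  have hε : a₀ = 0 := by
    obtain ⟨ε, hε⟩ := Jac.exists_augmentation (cyclicDeriv_potD_nil (k := k) hn hm)
    have := congrArg ε hw
    rw [hε, hε, hg0] at this
    simpa [mul_nil, one_nil, X_nil] using this.symm
  refine ⟨Jac.mkₐ _ w, ?_⟩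
  rw [← Jac.mkₐ_apply, ← Jac.mkₐ_apply, hw, h1, h2, h3, hε, ← map_mul, pow_two]
  simp only [zero_smul, zero_add]
  rfl

end NormalForm

theorem theorem6 (k : ℕ) :
    -- the element `s` is central, and `Jac f / (s) ≅ e Π e`
    ((∀ n : ℕ∞, 2 ≤ n →
        Jac.mk (NormalForm.potA k n) (NormalForm.y k) ∈
          Subalgebra.center ℂ (Jac (NormalForm.potA k n)) ∧
        Nonempty (QuotBy (Jac.mk (NormalForm.potA k n) (NormalForm.y k)) ≃ₐ[ℂ]
          MarkedQuiver.A₁.Contracted)) ∧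
      (∀ n m : ℕ∞, 2 ≤ n → 2 ≤ m →
        Jac.mk (NormalForm.potD k n m) (NormalForm.x k ^ 2) ∈
          Subalgebra.center ℂ (Jac (NormalForm.potD k n m)) ∧
        Nonempty (QuotBy (Jac.mk (NormalForm.potD k n m) (NormalForm.x k ^ 2)) ≃ₐ[ℂ]
          MarkedQuiver.D₄.Contracted)) ∧
      (∀ n : ℕ∞, 4 ≤ n →
        Jac.mk (NormalForm.potE k n) (NormalForm.gE k n) ∈
          Subalgebra.center ℂ (Jac (NormalForm.potE k n)) ∧
        Nonempty (QuotBy (Jac.mk (NormalForm.potE k n) (NormalForm.gE k n)) ≃ₐ[ℂ]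
          MarkedQuiver.E₆.Contracted))) ∧
    -- in Types A and D the same holds for a generic central element
    ((∀ n : ℕ∞, 2 ≤ n →
        FiniteDimensional ℂ (centreRadical (NormalForm.potA k n)).Cotangent ∧
        HasType (NormalForm.potA k n) MarkedQuiver.A₁) ∧
      (∀ n m : ℕ∞, 2 ≤ n → 2 ≤ m →
        FiniteDimensional ℂ (centreRadical (NormalForm.potD k n m)).Cotangent ∧
        HasType (NormalForm.potD k n m) MarkedQuiver.D₄)) := by
  refine ⟨⟨fun n hn => ⟨NormalForm.potA_y_mem_center n, NormalForm.potA_quot_equiv n hn⟩,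
    fun n m hn hm => ⟨NormalForm.potD_xx_mem_center n m, NormalForm.potD_quot_equiv n m hn hm⟩,
    fun n hn => ⟨NormalForm.potE_gE_mem_center hn, NormalForm.potE_quot_equiv n hn⟩⟩,
    fun n hn => ⟨NormalForm.potA_cotangent hn, NormalForm.potA_hasType hn⟩,
    fun n m hn hm => ⟨NormalForm.potD_cotangent hn hm, NormalForm.potD_hasType hn hm⟩⟩
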